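/- Let $\mathbb S=\{e^{i\theta}\}$ be the unit circle and let $\Lambda:C^\infty(\mathbb S)\to C^\infty(\mathbb S)$ be the linear operator with $\Lambda e^{in\theta}=|n|e^{in\theta}$ for $n\in\mathbb Z$. For a positive function $a\in C^\infty(\mathbb S)$ put $\Lambda_a=a^{1/2}\Lambda a^{1/2}$. If $\frac1{2\pi}\int_0^{2\pi}\frac{d\theta}{a(\theta)}=1$, the Steklov zeta function of $a$ is $\zeta_a(z)=\sum_{k\ge1}\lambda_k(a)^{-z}$ for $\Re z>1$, where $0<\lambda_1(a)\le\lambda_2(a)\le\dots$ are the positive eigenvalues of $\Lambda_a$, each repeated according to its multiplicity. It is continued meromorphically to $\mathbb C$ with its only pole at $z=1$, in such a way that $\zeta_a-2\zeta_R$ is entire, where $\zeta_R$ is the Riemann zeta function. Let $\varepsilon>0$ and let $\alpha_\tau$ $(-\varepsilon<\tau<\varepsilon)$ be a $C^2$-smooth variation of the constant function $\mathbf 1$. That is, $\tau\mapsto\alpha_\tau$ belongs to $C^2\big((-\varepsilon,\varepsilon),C^\infty(\mathbb S)\big)$ with the Fréchet topology on $C^\infty(\mathbb S)$, every $\alpha_\tau$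 is real and positive, $\alpha_0=\mathbf 1$, and $\frac1{2\pi}\int_0^{2\pi}\frac{d\theta}{\alpha_\tau(\theta)}=1$ for all $\tau\in(-\varepsilon,\varepsilon)$. Let $\beta(\theta)=\frac{\partial\alpha_\tau(\theta)}{\partial\tau}\big|_{\tau=0}$ be its direction and $\hat\beta_k=\frac1{2\pi}\int_0^{2\pi}\beta(\theta)e^{-ik\theta}\,d\theta$. Then, for all sufficiently small $|\tau|$, $\zeta_{\alpha_\tau}-2\zeta_R$ does extend from $\Re z>1$ to an entire function, and for every $z\in\mathbb C$ the function $\tau\mapsto\zeta_{\alpha_\tau}(z)$ is differentiable near $\tau=0$ and twice differentiable at $\tau=0$, with $$\frac{\partial\zeta_{\alpha_\tau}(z)}{\partial\tau}\Big|_{\tau=0}=0,$$ $$\frac{\partial^2\zeta_{\alpha_\tau}(z)}{\partial\tau^2}\Big|_{\tau=0}=4z\sum_{\substack{n,p>0\\ n\ne p}}\frac{n^{-z}-p^{-z}}{p^2-n^2}\,pn\,|\hat\beta_{p+n}|^2+2z^2\sum_{n>0}n^{-z}|\hat\beta_{2n}|^2,$$ where $n,p$ run over the positive integers and both series converge absolutely.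 At the pole $z=1$, the $\tau$-derivatives of $\zeta_{\alpha_\tau}(z)$ are understood as those of the entire function $\zeta_{\alpha_\tau}(z)-2\zeta_R(z)$ at $z=1$. -/

import Mathlib

open Set Filter Topology Real
open scoped ContDiff

noncomputable section

/-- `C^∞(𝕊)` for the circle `𝕊 = {e^{iθ}}`: the smooth `2π`-periodic functions of the angle `θ`,
with values in `𝕜 = ℝ` or `ℂ`. -/
def smoothCircle (𝕜 : Type) [RCLike 𝕜] : Submodule 𝕜 (ℝ → 𝕜) where
  carrier := {f | ContDiff ℝ ∞ f ∧ Function.Periodic f (2 * π)}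
  add_mem' := fun hf hg => ⟨hf.1.add hg.1, hf.2.add hg.2⟩
  zero_mem' := ⟨contDiff_const, fun _ => rfl⟩
  smul_mem' := fun c _ hf => ⟨contDiff_const.smul hf.1, fun x => by simp [hf.2 x]⟩

instance fact_two_pi_pos : Fact (0 < 2 * π) := ⟨Real.two_pi_pos⟩

/-- The derivative `∂_θ` on `C^∞(𝕊)`. -/
def circleDeriv {𝕜 : Type} [RCLike 𝕜] (f : smoothCircle 𝕜) : smoothCircle 𝕜 :=
  ⟨deriv f.1, ((contDiff_infty_iff_deriv (𝕜 := ℝ)).1 f.2.1).2, fun x => by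
    have h : (fun y => f.1 (y + 2 * π)) = f.1 := funext f.2.2
    have h2 := deriv_comp_add_const (f := f.1) (2 * π) x
    rw [h] at h2
    exact h2.symm⟩

/-- A smooth function on the circle as an element of the Banach space `C(ℝ/2πℤ)`. -/
def circleToC {𝕜 : Type} [RCLike 𝕜] (f : smoothCircle 𝕜) : C(AddCircle (2 * π), 𝕜) where
  toFun := f.2.2.lift
  continuous_toFun := continuous_coinduced_dom.2 f.2.1.continuous

/-- `α ∈ C^l(J, C^∞(𝕊))` for a set `J ⊆ ℝ`: with the Fréchet topology of `C^∞(𝕊)` given by the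
norms `sup |∂_θ^m f|`, this means that `τ ↦ ∂_θ^m α_τ ∈ C(𝕊)` is of class `C^l` for every `m`. -/
def IsSmoothFamily (l : ℕ∞) (J : Set ℝ) (α : ℝ → smoothCircle ℝ) : Prop :=
  ∀ m : ℕ, ContDiffOn ℝ l (fun τ => circleToC (circleDeriv^[m] (α τ))) J

/-- The Fourier coefficient `(2π)⁻¹ ∫_0^{2π} f(θ) e^{-inθ} dθ`. -/
def circleCoeff (f : ℝ → ℂ) (n : ℤ) : ℂ := fourierCoeffOn Real.two_pi_pos f n

theorem circleCoeff_eq (f : ℝ → ℂ) (n : ℤ) :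
    circleCoeff f n =
      (1 / (2 * π) : ℝ) • ∫ θ in (0 : ℝ)..(2 * π), Complex.exp (-(Complex.I * n * θ)) * f θ := by
  have hpi : (π : ℂ) ≠ 0 := by exact_mod_cast Real.pi_ne_zero
  rw [circleCoeff, fourierCoeffOn_eq_integral, sub_zero]
  congr 1
  refine intervalIntegral.integral_congr fun θ _ => ?_
  simp only [smul_eq_mul, fourier_coe_apply]
  congr 2
  push_cast
  field_simp

theorem circleCoeff_add {f g : ℝ → ℂ} (hf : Continuous f) (hg : Continuous g) (n : ℤ) :
    circleCoeff (f + g) n = circleCoeff f n + circleCoeff g n := by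
  rw [circleCoeff_eq, circleCoeff_eq, circleCoeff_eq, ← smul_add,
    ← intervalIntegral.integral_add]
  · simp [mul_add]
  · exact Continuous.intervalIntegrable (by fun_prop) _ _
  · exact Continuous.intervalIntegrable (by fun_prop) _ _

theorem circleCoeff_smul (c : ℂ) (f : ℝ → ℂ) (n : ℤ) :
    circleCoeff (c • f) n = c * circleCoeff f n :=
  fourierCoeffOn.const_smul f c n Real.two_pi_pos

theorem circleCoeff_circleDeriv (f : smoothCircle ℂ) {n : ℤ} (hn : n ≠ 0) :
    circleCoeff (circleDeriv f).1 n = Complex.I * n * circleCoeff f.1 n := by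
  have hd : ∀ x ∈ uIcc 0 (2 * π), HasDerivAt f.1 (deriv f.1 x) x := fun x _ =>
    ((f.2.1.differentiable (by simp)) x).hasDerivAt
  have h := fourierCoeffOn_of_hasDerivAt Real.two_pi_pos hn hd
    ((circleDeriv f).2.1.continuous.intervalIntegrable _ _)
  have hp : f.1 (2 * π) = f.1 0 := by simpa using f.2.2 0
  have hn' : (n : ℂ) ≠ 0 := by exact_mod_cast hn
  have hpi : (π : ℂ) ≠ 0 := by exact_mod_cast Real.pi_ne_zero
  rw [circleCoeff, circleCoeff, h, hp]
  simp only [circleDeriv]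
  push_cast
  field_simp
  ring

theorem norm_circleCoeff_iterate (f : smoothCircle ℂ) {n : ℤ} (hn : n ≠ 0) (k : ℕ) :
    ‖circleCoeff (circleDeriv^[k] f).1 n‖ = |(n : ℝ)| ^ k * ‖circleCoeff f.1 n‖ := by
  induction k with
  | zero => simp
  | succ k ih =>
    rw [Function.iterate_succ_apply', circleCoeff_circleDeriv _ hn, norm_mul, norm_mul, ih]
    simp [pow_succ]
    ring

theorem norm_circleCoeff_bounded (f : smoothCircle ℂ) : ∃ C, ∀ n, ‖circleCoeff f.1 n‖ ≤ C := by
  refine ⟨|1 / (2 * π)| * (‖circleToC f‖ * |2 * π - 0|), fun n => ?_⟩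
  rw [circleCoeff_eq, norm_smul, Real.norm_eq_abs]
  gcongr
  refine intervalIntegral.norm_integral_le_of_norm_le_const fun θ _ => ?_
  have h : ‖Complex.exp (-(Complex.I * n * θ))‖ = 1 := by
    simp [Complex.norm_exp]
  rw [norm_mul, h, one_mul]
  exact (circleToC f).norm_coe_le_norm (θ : AddCircle (2 * π))

/-- Rapid decay of the Fourier coefficients of a smooth function. -/
theorem summable_pow_mul_circleCoeff (f : smoothCircle ℂ) (k : ℕ) :
    Summable (fun n : ℤ => |(n : ℝ)| ^ (k + 1) * ‖circleCoeff f.1 n‖) := by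
  obtain ⟨C, hC⟩ := norm_circleCoeff_bounded (circleDeriv^[k + 3] f)
  refine Summable.of_nonneg_of_le (fun n => by positivity) (fun n => ?_)
    ((Real.summable_one_div_int_pow (p := 2)).2 one_lt_two |>.mul_left C)
  rcases eq_or_ne n 0 with rfl | hn
  · simp
  · have hn' : (0 : ℝ) < |(n : ℝ)| := by positivity
    have h := hC n
    rw [norm_circleCoeff_iterate f hn] at h
    rw [mul_one_div, le_div_iff₀ (by positivity), ← sq_abs]
    calc _ = |(n : ℝ)| ^ (k + 3) * ‖circleCoeff f.1 n‖ := by ring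
      _ ≤ C := h

theorem norm_iteratedFDeriv_expI (n : ℤ) (c : ℂ) (k : ℕ) (x : ℝ) :
    ‖iteratedFDeriv ℝ k (fun θ : ℝ => c * Complex.exp (Complex.I * n * θ)) x‖
      = |(n : ℝ)| ^ k * ‖c‖ := by
  have key : ∀ k : ℕ, iteratedDeriv k (fun θ : ℝ => c * Complex.exp (Complex.I * n * θ)) =
      fun θ : ℝ => (Complex.I * n) ^ k * (c * Complex.exp (Complex.I * n * θ)) := by
    intro k
    induction k with
    | zero => simp
    | succ k ih =>
      rw [iteratedDeriv_succ, ih]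
      funext θ
      have h1 : HasDerivAt (fun θ : ℝ => Complex.I * n * (θ : ℂ)) (Complex.I * n * 1) θ :=
        (HasDerivAt.ofReal_comp (hasDerivAt_id θ)).const_mul _
      have h2 := ((h1.cexp.const_mul c).const_mul ((Complex.I * n) ^ k)).deriv
      rw [h2]
      ring
  rw [norm_iteratedFDeriv_eq_norm_iteratedDeriv, key, norm_mul, norm_mul, norm_pow]
  simp [Complex.norm_exp]

/-- The Dirichlet-to-Neumann operator `Λ` of the unit disk on `C^∞(𝕊)`: the linear operator with
`Λ e^{inθ} = |n| e^{inθ}`, i.e. `Λ f = ∑_n |n| f̂_n e^{inθ}`. -/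
def dnOp : Module.End ℂ (smoothCircle ℂ) where
  toFun f := ⟨fun θ => ∑' n : ℤ,
      ((|n| : ℤ) : ℂ) * circleCoeff f.1 n * Complex.exp (Complex.I * n * θ), by
    refine contDiff_tsum (𝕜 := ℝ) (N := ⊤)
      (v := fun k (n : ℤ) => |(n : ℝ)| ^ (k + 1) * ‖circleCoeff f.1 n‖) (fun n => ?_)
      (fun k _ => summable_pow_mul_circleCoeff f k) (fun k n x _ => ?_)
    · exact contDiff_const.mul (contDiff_const.mul Complex.ofRealCLM.contDiff).cexp
    · refine (norm_iteratedFDeriv_expI n _ k x).le.trans (le_of_eq ?_)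
      rw [norm_mul]
      simp
      ring, fun θ => by
    refine tsum_congr fun n => ?_
    congr 1
    rw [Complex.exp_eq_exp_iff_exists_int]
    exact ⟨n, by push_cast; ring⟩⟩
  map_add' f g := by
    have hs : ∀ (f : smoothCircle ℂ) (θ : ℝ), Summable fun n : ℤ =>
        ((|n| : ℤ) : ℂ) * circleCoeff f.1 n * Complex.exp (Complex.I * n * θ) := fun f θ => by
      refine Summable.of_norm ((summable_pow_mul_circleCoeff f 0).congr fun n => ?_)
      simp [Complex.norm_exp]
    ext θ
    simp only [Submodule.coe_add, Pi.add_apply]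
    rw [← (hs f θ).tsum_add (hs g θ)]
    refine tsum_congr fun n => ?_
    rw [circleCoeff_add f.2.1.continuous g.2.1.continuous]
    ring
  map_smul' c f := by
    ext θ
    simp only [Submodule.coe_smul, Pi.smul_apply, smul_eq_mul, RingHom.id_apply]
    rw [← tsum_mul_left]
    refine tsum_congr fun n => ?_
    rw [circleCoeff_smul]
    ring

/-- The positive functions in `C^∞(𝕊)`. -/
abbrev PosCircle : Type := {a : smoothCircle ℝ // ∀ θ, 0 < a.1 θ}

/-- Multiplication by `a^{1/2}` on `C^∞(𝕊)`. -/
def sqrtMulOp (a : PosCircle) : Module.End ℂ (smoothCircle ℂ) where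
  toFun f := ⟨fun θ => (√(a.1.1 θ) : ℂ) * f.1 θ, by
    refine ContDiff.mul ?_ f.2.1
    exact Complex.ofRealCLM.contDiff.comp (a.1.2.1.sqrt fun θ => (a.2 θ).ne'),
    fun θ => by simp only [a.1.2.2 θ, f.2.2 θ]⟩
  map_add' f g := by ext θ; simp [mul_add]
  map_smul' c f := by ext θ; simp [mul_left_comm]

/-- The operator `Λ_a = a^{1/2} Λ a^{1/2}` on `C^∞(𝕊)`. -/
def steklovOp (a : PosCircle) : Module.End ℂ (smoothCircle ℂ) :=
  sqrtMulOp a * dnOp * sqrtMulOp a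

/-- The multiplicity of the real number `μ` as an eigenvalue of `Λ_a`
(it is `0` if `μ` is not an eigenvalue). -/
def steklovMult (a : PosCircle) (μ : ℝ) : ℕ :=
  Module.finrank ℂ (Module.End.eigenspace (steklovOp a) (μ : ℂ))

/-- `F` is the entire function that extends `ζ_a(s) - 2 ζ_R(s)`, where, for `Re s > 1`,
`ζ_a(s) = ∑ μ^{-s}` over the positive eigenvalues `μ` of `Λ_a`, each repeated according to its
multiplicity. There is at most one such `F`, by the identity theorem. -/
structure IsSteklovZetaDiff (a : PosCircle) (F : ℂ → ℂ) : Prop where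
  entire : Differentiable ℂ F
  hasSum : ∀ s : ℂ, 1 < s.re →
    HasSum (fun μ : Ioi (0 : ℝ) => (steklovMult a μ : ℂ) * ((μ : ℝ) : ℂ) ^ (-s))
      (2 * riemannZeta s + F s)

open Classical in
/-- The entire function `ζ_a - 2 ζ_R`, for `a` with `(2π)⁻¹ ∫ a⁻¹ = 1`. -/
def steklovZetaDiff (a : PosCircle) : ℂ → ℂ :=
  if h : ∃ F, IsSteklovZetaDiff a F then h.choose else 0

/-- The Steklov zeta function of `a` with `(2π)⁻¹ ∫ a⁻¹ = 1`, continued meromorphically to `ℂ`.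
Its only pole is `s = 1`; there the value of `riemannZeta` is a constant which does not depend on
`a`, so that derivatives of `ζ_a(1)` with respect to a parameter in `a` are those of
`ζ_a - 2 ζ_R` at `1`. -/
def steklovZeta (a : PosCircle) (z : ℂ) : ℂ := 2 * riemannZeta z + steklovZetaDiff a z

end

/-!
For a positive function `a` with mean of `a⁻¹` equal to `1`, let `φ(θ) = ∫_0^θ a⁻¹`. The functions
`e^{inφ}` are an orthonormal basis of `L²(dθ / 2πa)`, in which `a Λ`, conjugate to `Λ_a`, has the
matrix `diag |n| + R`. The operator `-i a ∂_θ` has the matrix `diag n` in this basis, and `-i ∂_θ`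
is `±Λ` on `e^{ikθ}` according to the sign of `k`; hence `R` only involves the Fourier coefficients
`I_{nk}` of `e^{inφ}` at those `k` whose sign is opposite to that of `n`:
`R_{mn} = 2 ∑_{nk < 0} |k| I_{nk} conj(I_{mk})`. There the phase `nφ - kθ` has no stationary point,
and so `R` is a Hermitian matrix that decreases rapidly in both indices, together with its first two
derivatives along a variation of `a` (`nonstationary_phase`, `DensVar.matVar`). Row zero of `R`
vanishes, and eigenvectors of `diag |n| + R` for nonzero eigenvalues come from smooth functions, so
that the multiplicities of `Λ_a` are those of `diag |n| + R` (`Density.steklovMult_eq`).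

When `R` is small in `ℓ¹`, the positive eigenvalues lie within `1/2` of the positive integers. The
trace of `(2πi)⁻¹ ∮ λ^{-z} (λ - diag |n| - R)⁻¹ dλ` over `|λ - n| = 1/2` is compared with that of
the matrix in which the rows and columns `±n` of `R` are cut off, which has the double eigenvalue
`n` and no other near it. The second resolvent identity turns the difference of the traces into a
sum over the entries of `R` in those rows and columns. Summed over `n`, this gives
`∑ μ^{-z} - 2 ζ_R(z) = ∑_p R_p ℓ_p(z)`, where the functionals `ℓ_p(z)` are entire in `z` and grow
polynomially in `p`; the right-hand side (`zetaPert`) is entire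
(`SmallHerm.hasSum_discVal_finrank`, `SmallHerm.hasSum_finrank_cpow`,
`Density.isSteklovZetaDiff`).

All the resolvents on all the circles form elements of one Banach algebra `YZ`, in which they are
smooth functions of `R`. As `R = 0` at `a = 1`, two derivatives of the functional are explicit
(`MatVar.hasDerivAt_zetaPert`). The first one is the sum of `R'_{nn} f'(|n|)` with `f(w) = w^{-z}`;
it vanishes since `R'` has zero diagonal. In the second one, `R''_{nn}` is paired with `f'(|n|)`,
and `|R'_{mn}|²` with the divided difference `f[|m|, |m|, |n|]`. Both are given by the numbers
`|β̂_{n+p}|²`, and symmetrization in `n` and `p` yields the asserted formula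
(`DensVar.second_variation_sum`).
-/

noncomputable section

open scoped BoundedContinuousFunction

/-! ### Diagonal operators and summable matrices on `ℓ²(ℤ)` -/

/-- The Hilbert space `ℓ²(ℤ)` of Fourier coefficient sequences. -/
abbrev HZ : Type := lp (fun _ : ℤ => ℂ) 2

/-- The standard orthonormal basis of `ℓ²(ℤ)`. -/
def ez (i : ℤ) : HZ := lp.single 2 i (1 : ℂ)

theorem inner_ez (i : ℤ) (x : HZ) : inner ℂ (ez i) x = x i := by
  rw [ez, lp.inner_single_left]
  simp

theorem ez_apply (i j : ℤ) : ez i j = if j = i then 1 else 0 := by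
  rw [ez, lp.single_apply]
  by_cases h : j = i
  · subst h; simp
  · simp [h]

theorem norm_ez (i : ℤ) : ‖ez i‖ = 1 := by
  rw [ez, lp.norm_single (by norm_num)]
  simp

theorem hasSum_ez (x : HZ) : HasSum (fun i => x i • ez i) x := by
  have h := lp.hasSum_single (p := 2) (by norm_num) x
  have he : (fun i => x i • ez i) = fun i => lp.single 2 i (x i) := by
    funext i
    rw [ez, ← lp.single_smul]
    simp
  rwa [he]

theorem hasSum_norm_sq (x : HZ) : HasSum (fun i => ‖x i‖ ^ 2) (‖x‖ ^ 2) := by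
  have h := lp.hasSum_norm (p := 2) (by norm_num) x
  simpa using h

theorem norm_coord_le (x : HZ) (i : ℤ) : ‖x i‖ ≤ ‖x‖ :=
  lp.norm_apply_le_norm (by norm_num) x i

theorem memlp_two_of_le {f : ℤ → ℂ} {g : ℤ → ℝ} (hg : Summable fun i => g i ^ 2)
    (h : ∀ i, ‖f i‖ ≤ g i) : Memℓp f 2 := by
  refine memℓp_gen ?_
  simp only [ENNReal.toReal_ofNat, Real.rpow_ofNat]
  exact Summable.of_nonneg_of_le (fun i => by positivity)
    (fun i => pow_le_pow_left₀ (norm_nonneg _) (h i) 2) hg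

/-- The coordinate functional `x ↦ x j` on `ℓ²(ℤ)`. -/
def coordCLM (j : ℤ) : HZ →L[ℂ] ℂ := innerSL ℂ (ez j)

theorem coordCLM_apply (j : ℤ) (x : HZ) : coordCLM j x = x j := inner_ez j x

theorem norm_coordCLM_le (j : ℤ) : ‖coordCLM j‖ ≤ 1 :=
  ContinuousLinearMap.opNorm_le_bound _ zero_le_one fun x => by
    rw [coordCLM_apply, one_mul]; exact norm_coord_le x j

/-- The matrix unit `E_{ij}`, i.e. `x ↦ x_j e_i`. -/
def unitOp (i j : ℤ) : HZ →L[ℂ] HZ := (coordCLM j).smulRight (ez i)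

theorem unitOp_apply (i j : ℤ) (x : HZ) : unitOp i j x = x j • ez i := by
  simp [unitOp, coordCLM_apply]

theorem norm_unitOp_le (i j : ℤ) : ‖unitOp i j‖ ≤ 1 := by
  rw [unitOp, ContinuousLinearMap.norm_smulRight_apply, norm_ez, mul_one]
  exact norm_coordCLM_le j

theorem isCompactOperator_unitOp (i j : ℤ) : IsCompactOperator (unitOp i j) := by
  have h : IsCompactOperator (coordCLM j) :=
    ⟨Metric.closedBall 0 1, isCompact_closedBall 0 1,
      (coordCLM j).continuous.continuousAt.preimage_mem_nhds
        (by rw [map_zero]; exact Metric.closedBall_mem_nhds _ one_pos)⟩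
  exact h.clm_comp ((1 : ℂ →L[ℂ] ℂ).smulRight (ez i))

/-- The diagonal operator on `ℓ²(ℤ)` with a bounded diagonal. -/
def diagOp : (ℤ →ᵇ ℂ) →L[ℂ] (HZ →L[ℂ] HZ) :=
  LinearMap.mkContinuous₂
    (LinearMap.mk₂ ℂ
      (fun (x : ℤ →ᵇ ℂ) (v : HZ) => (⟨fun i => x i * v i,
        memlp_two_of_le (g := fun i => ‖x‖ * ‖v i‖)
          (by simpa only [mul_pow] using (hasSum_norm_sq v).summable.mul_left (‖x‖ ^ 2))
          (fun i => by
            rw [norm_mul]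
            exact mul_le_mul_of_nonneg_right (x.norm_coe_le_norm i) (norm_nonneg _))⟩ : HZ))
      (fun x y v => by
        ext i
        simp only [BoundedContinuousFunction.coe_add, Pi.add_apply, add_mul]
        rfl)
      (fun c x v => by ext i; simp [mul_assoc])
      (fun x v w => by ext i; simp only [lp.coeFn_add, Pi.add_apply, mul_add])
      (fun c x v => by ext i; simp [mul_left_comm]))
    1 (fun x v => by
      rw [one_mul]
      refine lp.norm_le_of_tsum_le (by norm_num) (by positivity) ?_
      have h2 := (hasSum_norm_sq v).mul_left (‖x‖ ^ 2)
      simp only [ENNReal.toReal_ofNat, Real.rpow_ofNat, mul_pow]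
      rw [← h2.tsum_eq]
      have hle : ∀ i, ‖x i * v i‖ ^ 2 ≤ ‖x‖ ^ 2 * ‖v i‖ ^ 2 := fun i => by
        rw [norm_mul, mul_pow]
        exact mul_le_mul_of_nonneg_right
          (pow_le_pow_left₀ (norm_nonneg _) (x.norm_coe_le_norm i) 2) (by positivity)
      exact Summable.tsum_le_tsum hle
        (Summable.of_nonneg_of_le (fun i => by positivity) hle h2.summable) h2.summable)

theorem diagOp_apply (x : ℤ →ᵇ ℂ) (v : HZ) (i : ℤ) : diagOp x v i = x i * v i := rfl

theorem norm_diagOp_le (x : ℤ →ᵇ ℂ) : ‖diagOp x‖ ≤ ‖x‖ := by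
  refine ((diagOp.le_opNorm x).trans
    (mul_le_mul_of_nonneg_right (LinearMap.mkContinuous₂_norm_le _ zero_le_one _)
      (norm_nonneg _))).trans_eq (one_mul _)

theorem diagOp_ez (x : ℤ →ᵇ ℂ) (i : ℤ) : diagOp x (ez i) = x i • ez i := by
  ext j
  rw [diagOp_apply]
  simp only [lp.coeFn_smul, Pi.smul_apply, ez_apply, smul_eq_mul]
  by_cases h : j = i
  · rw [h]
  · simp [h]

/-- A diagonal operator whose diagonal tends to zero is compact. -/
theorem isCompactOperator_diagOp (x : ℤ →ᵇ ℂ) (hx : Tendsto x cofinite (𝓝 0)) :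
    IsCompactOperator (diagOp x) := by
  have hfin : ∀ s : Finset ℤ, IsCompactOperator (∑ i ∈ s, x i • unitOp i i : HZ →L[ℂ] HZ) := by
    intro s
    induction s using Finset.induction_on with
    | empty => simpa using isCompactOperator_zero
    | insert a s ha ih =>
      rw [Finset.sum_insert ha]
      exact ((isCompactOperator_unitOp a a).smul (x a)).add ih
  -- The operator is the norm limit of its finite truncations.
  refine isCompactOperator_of_tendsto (l := (atTop : Filter (Finset ℤ)))
    (F := fun s => ∑ i ∈ s, x i • unitOp i i) ?_ (Eventually.of_forall hfin)
  rw [Metric.tendsto_nhds]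
  intro ε hε
  have h1 : {i | ¬ ‖x i‖ < ε / 2}.Finite := by
    have := (Metric.tendsto_nhds.1 hx) (ε / 2) (half_pos hε)
    rw [Filter.eventually_cofinite] at this
    simpa only [dist_zero_right] using this
  filter_upwards [eventually_ge_atTop h1.toFinset] with s hs
  rw [dist_eq_norm, norm_sub_rev]
  refine lt_of_le_of_lt (ContinuousLinearMap.opNorm_le_bound _ (half_pos hε).le fun v => ?_)
    (half_lt_self hε)
  have hc : ∀ i, (diagOp x - ∑ i ∈ s, x i • unitOp i i) v i = if i ∈ s then 0 else x i * v i := by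
    intro i
    have : (∑ j ∈ s, x j • unitOp j j) v i = ∑ j ∈ s, x j * (v j * ez j i) := by
      rw [sum_apply, ← coordCLM_apply, map_sum]
      refine Finset.sum_congr rfl fun j _ => ?_
      rw [coordCLM_apply]
      simp [unitOp_apply]
    rw [sub_apply, lp.coeFn_sub, Pi.sub_apply, this, diagOp_apply]
    simp only [ez_apply, mul_ite, mul_one, mul_zero, Finset.sum_ite_eq]
    split_ifs <;> simp
  refine lp.norm_le_of_tsum_le (by norm_num) (by positivity) ?_
  simp only [ENNReal.toReal_ofNat, Real.rpow_ofNat]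
  have h2 := (hasSum_norm_sq v).mul_left ((ε / 2) ^ 2)
  have hle : ∀ i, ‖(diagOp x - ∑ i ∈ s, x i • unitOp i i) v i‖ ^ 2 ≤ (ε / 2) ^ 2 * ‖v i‖ ^ 2 := by
    intro i
    rw [hc]
    split_ifs with hi
    · simp; positivity
    · rw [norm_mul, mul_pow]
      have : ‖x i‖ < ε / 2 := by
        by_contra hcon
        exact hi (hs (by simpa using hcon))
      gcongr
  rw [mul_pow, ← h2.tsum_eq]
  exact Summable.tsum_le_tsum hle
    (Summable.of_nonneg_of_le (fun i => by positivity) hle h2.summable) h2.summable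

/-- The operator on `ℓ²(ℤ)` with an absolutely summable matrix. -/
def opMat (M : ℤ × ℤ → ℂ) : HZ →L[ℂ] HZ := ∑' p, M p • unitOp p.1 p.2

theorem summable_smul_of_norm_le {ι V : Type*} [NormedAddCommGroup V] [NormedSpace ℂ V]
    [CompleteSpace V] {M : ι → ℂ} (hM : Summable fun p => ‖M p‖) {U : ι → V}
    (hU : ∀ p, ‖U p‖ ≤ 1) : Summable fun p => M p • U p :=
  Summable.of_norm_bounded hM fun p => by
    rw [norm_smul]; exact mul_le_of_le_one_right (norm_nonneg _) (hU p)

theorem norm_tsum_smul_le {ι V : Type*} [NormedAddCommGroup V] [NormedSpace ℂ V]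
    {M : ι → ℂ} (hM : Summable fun p => ‖M p‖) {U : ι → V}
    (hU : ∀ p, ‖U p‖ ≤ 1) : ‖∑' p, M p • U p‖ ≤ ∑' p, ‖M p‖ :=
  tsum_of_norm_bounded hM.hasSum fun p => by
    rw [norm_smul]; exact mul_le_of_le_one_right (norm_nonneg _) (hU p)

theorem hasSum_opMat {M : ℤ × ℤ → ℂ} (hM : Summable fun p => ‖M p‖) :
    HasSum (fun p => M p • unitOp p.1 p.2) (opMat M) :=
  (summable_smul_of_norm_le hM fun p => norm_unitOp_le p.1 p.2).hasSum

theorem norm_opMat_le {M : ℤ × ℤ → ℂ} (hM : Summable fun p => ‖M p‖) :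
    ‖opMat M‖ ≤ ∑' p, ‖M p‖ :=
  norm_tsum_smul_le hM fun p => norm_unitOp_le p.1 p.2

theorem opMat_apply {M : ℤ × ℤ → ℂ} (hM : Summable fun p => ‖M p‖) (v : HZ) (i : ℤ) :
    HasSum (fun j => M (i, j) * v j) (opMat M v i) := by
  have h1 := ((coordCLM i).comp (ContinuousLinearMap.apply ℂ HZ v)).hasSum (hasSum_opMat hM)
  have hinj : Function.Injective fun j : ℤ => (i, j) := fun a b h => (Prod.ext_iff.1 h).2
  have hval : ∀ p : ℤ × ℤ, ((coordCLM i).comp (ContinuousLinearMap.apply ℂ HZ v))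
      (M p • unitOp p.1 p.2) = M p * (v p.2 * if i = p.1 then 1 else 0) := fun p => by
    simp [coordCLM_apply, unitOp_apply, ez_apply]
  have h2 := (hinj.hasSum_iff (f := fun p => M p * (v p.2 * if i = p.1 then 1 else 0))
    (a := opMat M v i) ?_).2 ?_
  · simpa [Function.comp_def] using h2
  · rintro ⟨a, b⟩ hab
    have : i ≠ a := fun h => hab ⟨b, by rw [h]⟩
    simp [this]
  · have h3 := h1
    simp only [hval] at h3
    simpa [coordCLM_apply] using h3

theorem opMat_ez {M : ℤ × ℤ → ℂ} (hM : Summable fun p => ‖M p‖) (i j : ℤ) :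
    opMat M (ez j) i = M (i, j) := by
  refine (opMat_apply hM (ez j) i).unique ?_
  have := hasSum_ite_eq j (M (i, j))
  refine this.congr_fun fun k => ?_
  rw [ez_apply]
  by_cases h : k = j
  · subst h; simp
  · simp [h]

/-! ### Perturbed resolvents in a Banach algebra -/

section Banach

variable {A : Type*} [NormedRing A]

/-- The perturbed resolvent `(1 - D m)⁻¹ D = (D⁻¹ - m)⁻¹`, written so that it makes sense for a
`D` that is not invertible. -/
def perturb (D m : A) : A := Ring.inverse (1 - D * m) * D

theorem perturb_zero (D : A) : perturb D 0 = D := by simp [perturb]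

variable [CompleteSpace A]

theorem isUnit_one_sub_mul {D m : A} (h : ‖D‖ * ‖m‖ < 1) : IsUnit (1 - D * m) :=
  isUnit_one_sub_of_norm_lt_one ((norm_mul_le _ _).trans_lt h)

theorem perturb_eq_left {D m : A} (h : ‖D‖ * ‖m‖ < 1) :
    perturb D m = D + D * m * perturb D m := by
  have h1 := Ring.mul_inverse_cancel _ (isUnit_one_sub_mul h)
  have h2 : (1 - D * m) * perturb D m = D := by rw [perturb, ← mul_assoc, h1, one_mul]
  rw [sub_mul, one_mul, sub_eq_iff_eq_add] at h2
  exact h2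

theorem perturb_eq_right {D m : A} (h : ‖D‖ * ‖m‖ < 1) :
    perturb D m = D + perturb D m * m * D := by
  have h1 := Ring.inverse_mul_cancel _ (isUnit_one_sub_mul h)
  rw [mul_sub, mul_one, sub_eq_iff_eq_add] at h1
  calc perturb D m = Ring.inverse (1 - D * m) * D := rfl
    _ = (1 + Ring.inverse (1 - D * m) * (D * m)) * D := by rw [← h1]
    _ = _ := by rw [perturb]; noncomm_ring

theorem norm_perturb_le {D m : A} (hD : ‖D‖ ≤ 2) (hm : ‖m‖ ≤ 1 / 4) : ‖perturb D m‖ ≤ 4 := by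
  have h : ‖D‖ * ‖m‖ < 1 := by
    have := mul_le_mul hD hm (norm_nonneg _) zero_le_two
    linarith
  have h1 := perturb_eq_left h
  have h2 : ‖perturb D m‖ ≤ 2 + 2 * (1 / 4) * ‖perturb D m‖ := by
    calc ‖perturb D m‖ = ‖D + D * m * perturb D m‖ := by rw [← h1]
      _ ≤ ‖D‖ + ‖D * m * perturb D m‖ := norm_add_le _ _
      _ ≤ ‖D‖ + ‖D‖ * ‖m‖ * ‖perturb D m‖ := by
        gcongr
        exact (norm_mul_le _ _).trans (by gcongr; exact norm_mul_le _ _)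
      _ ≤ _ := by gcongr
  linarith

/-- The second resolvent identity. -/
theorem perturb_sub_perturb {D m s : A} (hm : ‖D‖ * ‖m‖ < 1) (hs : ‖D‖ * ‖s‖ < 1) :
    perturb D m - perturb D s = perturb D s * (m - s) * perturb D m := by
  have hP := perturb_eq_left hm
  have hQ := perturb_eq_right hs
  set P := perturb D m
  set Q := perturb D s
  have h1 : Q * s * P = Q * s * D + Q * s * D * m * P := by
    calc Q * s * P = Q * s * (D + D * m * P) := by rw [← hP]
      _ = _ := by noncomm_ring
  have h2 : Q * s * D = Q - D := by rw [eq_sub_iff_add_eq, add_comm]; exact hQ.symm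
  have h3 : D * m * P = P - D := by rw [eq_sub_iff_add_eq, add_comm]; exact hP.symm
  have h4 : Q * (m - s) * P = Q * m * P - Q * s * P := by noncomm_ring
  rw [h4, h1, h2, sub_mul, sub_mul, h3]
  abel

variable [NormedAlgebra ℂ A]

theorem hasDerivAt_perturb {D : A} {m : ℝ → A} {m' : A} {t : ℝ} (hm : HasDerivAt m m' t)
    (h : ‖D‖ * ‖m t‖ < 1) :
    HasDerivAt (fun x => perturb D (m x)) (perturb D (m t) * m' * perturb D (m t)) t := by
  obtain ⟨u, hu⟩ := isUnit_one_sub_mul h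
  have h1 : HasDerivAt (fun x => 1 - D * m x) (-(D * m')) t := by
    simpa using (hm.const_mul D).const_sub 1
  have h2 := hasFDerivAt_ringInverse (𝕜 := ℝ) u
  rw [hu] at h2
  have h3 := (h2.comp_hasDerivAt t h1).mul_const D
  refine h3.congr_deriv ?_
  have h4 : (↑u⁻¹ : A) = Ring.inverse (1 - D * m t) := by rw [← hu, Ring.inverse_unit]
  simp only [neg_apply, ContinuousLinearMap.mulLeftRight_apply, h4, perturb]
  noncomm_ring

/-- First and second derivatives at `0` of `t ↦ Ψ_t(P_t Q_t)`, where `P_t` and `Q_t` are the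
resolvents perturbed by `r t` and `s t`, and all of `Ψ`, `r`, `s` vanish at `0`. -/
theorem hasDerivAt_functional_perturb (D : A) {Ψ Ψ₁ Ψ₂ : ℝ → A →L[ℂ] ℂ} {r r₁ r₂ s s₁ s₂ : ℝ → A}
    (hΨ : ∀ t, HasDerivAt Ψ (Ψ₁ t) t) (hΨ₁ : ∀ t, HasDerivAt Ψ₁ (Ψ₂ t) t)
    (hr : ∀ t, HasDerivAt r (r₁ t) t) (hr₁ : ∀ t, HasDerivAt r₁ (r₂ t) t)
    (hs : ∀ t, HasDerivAt s (s₁ t) t) (hs₁ : ∀ t, HasDerivAt s₁ (s₂ t) t)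
    (hΨ0 : Ψ 0 = 0) (hr0 : r 0 = 0) (hs0 : s 0 = 0) :
    let G := fun t => Ψ t (perturb D (r t) * perturb D (s t))
    (∀ᶠ t in 𝓝 0, DifferentiableAt ℝ G t) ∧ HasDerivAt G (Ψ₁ 0 (D * D)) 0 ∧
      HasDerivAt (deriv G)
        (Ψ₂ 0 (D * D) + 2 * Ψ₁ 0 (D * r₁ 0 * D * D + D * (D * s₁ 0 * D))) 0 := by
  intro G
  have happ : ∀ (Φ : ℝ → A →L[ℂ] ℂ) (Φ' : A →L[ℂ] ℂ) (k : ℝ → A) (k' : A) (t : ℝ),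
      HasDerivAt Φ Φ' t → HasDerivAt k k' t →
      HasDerivAt (fun t => Φ t (k t)) (Φ' (k t) + Φ t k') t := by
    intro Φ Φ' k k' t h1 h2
    have hb : IsBoundedBilinearMap ℝ fun q : (A →L[ℂ] ℂ) × A => q.1 q.2 :=
      { add_left := fun _ _ _ => rfl
        smul_left := fun _ _ _ => rfl
        add_right := fun f x y => map_add f x y
        smul_right := fun c f x => by
          simp only
          rw [← Complex.coe_smul c x, map_smul, Complex.coe_smul]
        bound := ⟨1, one_pos, fun f x => by simpa using f.le_opNorm x⟩ }
    have h3 := (hb.hasFDerivAt (Φ t, k t)).comp_hasDerivAt t (h1.prodMk h2)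
    refine h3.congr_deriv ?_
    simp [IsBoundedBilinearMap.deriv, add_comm]
  have hev : ∀ (m m₁ : ℝ → A), (∀ t, HasDerivAt m (m₁ t) t) → m 0 = 0 →
      ∀ᶠ t in 𝓝 0, ‖D‖ * ‖m t‖ < 1 := by
    intro m m₁ hm h0
    have : ContinuousAt (fun t => ‖D‖ * ‖m t‖) 0 :=
      continuousAt_const.mul (hm 0).continuousAt.norm
    exact this.eventually_lt_const (by simp [h0])
  set P := fun t => perturb D (r t) with hP
  set Q := fun t => perturb D (s t) with hQ
  have hPd : ∀ᶠ t in 𝓝 0, HasDerivAt P (P t * r₁ t * P t) t :=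
    (hev r r₁ hr hr0).mono fun t ht => hasDerivAt_perturb (hr t) ht
  have hQd : ∀ᶠ t in 𝓝 0, HasDerivAt Q (Q t * s₁ t * Q t) t :=
    (hev s s₁ hs hs0).mono fun t ht => hasDerivAt_perturb (hs t) ht
  set K₁ := fun t => P t * r₁ t * P t * Q t + P t * (Q t * s₁ t * Q t) with hK₁
  have hG : ∀ᶠ t in 𝓝 0, HasDerivAt G (Ψ₁ t (P t * Q t) + Ψ t (K₁ t)) t := by
    filter_upwards [hPd, hQd] with t h1 h2
    exact happ Ψ (Ψ₁ t) (fun t => P t * Q t) _ t (hΨ t) (h1.mul h2)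
  have hP0 : P 0 = D := by simp [hP, hr0, perturb_zero]
  have hQ0 : Q 0 = D := by simp [hQ, hs0, perturb_zero]
  refine ⟨hG.mono fun t h => h.differentiableAt, ?_, ?_⟩
  · refine hG.self_of_nhds.congr_deriv ?_
    simp [hP0, hQ0, hΨ0]
  · have hP1 := hPd.self_of_nhds
    have hQ1 := hQd.self_of_nhds
    have h1 := happ Ψ₁ (Ψ₂ 0) (fun t => P t * Q t) _ 0 (hΨ₁ 0) (hP1.mul hQ1)
    have h2 := happ Ψ (Ψ₁ 0) K₁ _ 0 (hΨ 0)
      ((((hP1.mul (hr₁ 0)).mul hP1).mul hQ1).add (hP1.mul ((hQ1.mul (hs₁ 0)).mul hQ1)))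
    have h3 := h1.add h2
    refine (h3.congr_of_eventuallyEq (hG.mono fun t h => h.deriv)).congr_deriv ?_
    simp only [hK₁, hΨ0, hP0, hQ0, zero_apply, map_add]
    ring

end Banach

/-! ### The resolvents on the circles `|λ - n| = 1/2` -/

section

/-- The Banach algebra of bounded continuous operator-valued functions of `(n, t)`; the pair
stands for the point `n + e^{it}/2` on the circle of radius `1/2` about `n`. -/
def YZ : Type := (ℕ × ℝ) →ᵇ (HZ →L[ℂ] HZ)

instance : NormedRing YZ := inferInstanceAs (NormedRing ((ℕ × ℝ) →ᵇ (HZ →L[ℂ] HZ)))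

instance : NormedAlgebra ℂ YZ := inferInstanceAs (NormedAlgebra ℂ ((ℕ × ℝ) →ᵇ (HZ →L[ℂ] HZ)))

instance : CompleteSpace YZ := inferInstanceAs (CompleteSpace ((ℕ × ℝ) →ᵇ (HZ →L[ℂ] HZ)))

/-- The value of an element of `YZ` at a point. -/
def evalY (s : ℕ × ℝ) : YZ →L[ℂ] (HZ →L[ℂ] HZ) :=
  LinearMap.mkContinuous
    { toFun := fun K : (ℕ × ℝ) →ᵇ (HZ →L[ℂ] HZ) => K s
      map_add' := fun _ _ => rfl
      map_smul' := fun _ _ => rfl } 1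
    fun K => (one_mul ‖K‖).symm ▸ BoundedContinuousFunction.norm_coe_le_norm
      (K : (ℕ × ℝ) →ᵇ (HZ →L[ℂ] HZ)) s

theorem evalY_mul (s : ℕ × ℝ) (K L : YZ) : evalY s (K * L) = evalY s K * evalY s L := rfl

theorem norm_evalY_le (s : ℕ × ℝ) (K : YZ) : ‖evalY s K‖ ≤ ‖K‖ :=
  BoundedContinuousFunction.norm_coe_le_norm (K : (ℕ × ℝ) →ᵇ (HZ →L[ℂ] HZ)) s

theorem continuous_evalY (K : YZ) : Continuous fun s => evalY s K :=
  BoundedContinuousFunction.continuous (K : (ℕ × ℝ) →ᵇ (HZ →L[ℂ] HZ))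

/-- An element of `YZ` from a bounded continuous function. -/
def mkY (f : ℕ × ℝ → HZ →L[ℂ] HZ) (hf : Continuous f) (C : ℝ) (hC : ∀ s, ‖f s‖ ≤ C) : YZ :=
  BoundedContinuousFunction.ofNormedAddCommGroup f hf C hC

theorem evalY_mkY (f : ℕ × ℝ → HZ →L[ℂ] HZ) (hf : Continuous f) (C : ℝ) (hC : ∀ s, ‖f s‖ ≤ C)
    (s : ℕ × ℝ) : evalY s (mkY f hf C hC) = f s := rfl

theorem norm_mkY_le (f : ℕ × ℝ → HZ →L[ℂ] HZ) (hf : Continuous f) (C : ℝ) (hC : ∀ s, ‖f s‖ ≤ C)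
    (h0 : 0 ≤ C) : ‖mkY f hf C hC‖ ≤ C :=
  BoundedContinuousFunction.norm_ofNormedAddCommGroup_le hf h0 hC

/-- The point `n + e^{it}/2`. -/
def circPt (s : ℕ × ℝ) : ℂ := circleMap s.1 (1 / 2) s.2

theorem continuous_circPt : Continuous circPt := by
  unfold circPt circleMap
  fun_prop

theorem norm_circPt_sub (n : ℕ) (t : ℝ) : ‖circPt (n, t) - n‖ = 1 / 2 := by
  simp [circPt]

theorem half_le_norm_circPt_sub (s : ℕ × ℝ) (k : ℕ) : 1 / 2 ≤ ‖circPt s - k‖ := by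
  obtain ⟨n, t⟩ := s
  have h1 := norm_circPt_sub n t
  by_cases h : n = k
  · rw [← h, h1]
  · have h2 : (1 : ℝ) ≤ ‖((n : ℂ) - k)‖ := by
      have h4 : ((n : ℂ) - k) = (((n : ℤ) - (k : ℤ) : ℤ) : ℂ) := by push_cast; rfl
      rw [h4, Complex.norm_intCast]
      have h3 : (n : ℤ) - k ≠ 0 := sub_ne_zero.2 (by exact_mod_cast h)
      exact_mod_cast Int.one_le_abs h3
    have h3 : ‖((n : ℂ) - k)‖ ≤ ‖circPt (n, t) - k‖ + ‖circPt (n, t) - n‖ := by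
      rw [norm_sub_rev (circPt (n, t)) (n : ℂ)]
      calc ‖((n : ℂ) - k)‖ = ‖(circPt (n, t) - k) + (n - circPt (n, t))‖ := by congr 1; ring
        _ ≤ _ := norm_add_le _ _
    linarith

theorem circPt_sub_ne_zero (s : ℕ × ℝ) (k : ℕ) : circPt s - k ≠ 0 := by
  intro h
  have := half_le_norm_circPt_sub s k
  rw [h, norm_zero] at this
  linarith

theorem norm_inv_circPt_sub_le (s : ℕ × ℝ) (k : ℕ) : ‖(circPt s - k)⁻¹‖ ≤ 2 := by
  rw [norm_inv]
  exact inv_le_of_inv_le₀ two_pos (by simpa using half_le_norm_circPt_sub s k)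

/-- The sequence `i ↦ (λ - |i|)⁻¹` for `λ = n + e^{it}/2`. -/
def invLev (s : ℕ × ℝ) : ℤ →ᵇ ℂ :=
  BoundedContinuousFunction.ofNormedAddCommGroupDiscrete
    (fun i : ℤ => (circPt s - i.natAbs)⁻¹) 2 fun _ => norm_inv_circPt_sub_le s _

theorem invLev_apply (s : ℕ × ℝ) (i : ℤ) : invLev s i = (circPt s - i.natAbs)⁻¹ := rfl

theorem norm_invLev_le (s : ℕ × ℝ) : ‖invLev s‖ ≤ 2 :=
  (BoundedContinuousFunction.norm_le zero_le_two).2 fun _ => norm_inv_circPt_sub_le s _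

theorem norm_invLev_sub_le (s u : ℕ × ℝ) : ‖invLev s - invLev u‖ ≤ 4 * ‖circPt s - circPt u‖ := by
  refine (BoundedContinuousFunction.norm_le (by positivity)).2 fun i => ?_
  rw [BoundedContinuousFunction.sub_apply, invLev_apply, invLev_apply]
  have h1 := circPt_sub_ne_zero s i.natAbs
  have h2 := circPt_sub_ne_zero u i.natAbs
  have h3 := norm_inv_circPt_sub_le s i.natAbs
  have h4 := norm_inv_circPt_sub_le u i.natAbs
  have h5 : (circPt s - i.natAbs)⁻¹ - (circPt u - i.natAbs)⁻¹ =
      (circPt s - i.natAbs)⁻¹ * (circPt u - i.natAbs)⁻¹ * (circPt u - circPt s) := by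
    field_simp
    ring
  rw [h5, norm_mul, norm_mul, norm_sub_rev (circPt u)]
  have := mul_le_mul h3 h4 (norm_nonneg _) zero_le_two
  nlinarith [norm_nonneg (circPt s - circPt u)]

/-- The free resolvent `(λ - Λ)⁻¹` on the circles, where `Λ e_i = |i| e_i`. -/
def DY : YZ :=
  mkY (fun s => diagOp (invLev s))
    (diagOp.continuous.comp (by
      rw [continuous_iff_continuousAt]
      intro u
      rw [ContinuousAt, tendsto_iff_norm_sub_tendsto_zero]
      have h : Tendsto (fun s => 4 * ‖circPt s - circPt u‖) (𝓝 u) (𝓝 0) := by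
        have := (tendsto_iff_norm_sub_tendsto_zero.1 (continuous_circPt.tendsto u)).const_mul 4
        simpa using this
      exact squeeze_zero (fun _ => norm_nonneg _) (fun s => norm_invLev_sub_le s u) h))
    2 fun s => (norm_diagOp_le _).trans (norm_invLev_le s)

theorem evalY_DY (s : ℕ × ℝ) : evalY s DY = diagOp (invLev s) := rfl

theorem norm_DY_le : ‖DY‖ ≤ 2 := norm_mkY_le _ _ _ _ zero_le_two

theorem evalY_DY_ez (s : ℕ × ℝ) (i : ℤ) :
    evalY s DY (ez i) = (circPt s - i.natAbs)⁻¹ • ez i := by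
  rw [evalY_DY, diagOp_ez, invLev_apply]

/-- The matrix position `p` lies in a row or a column of level `n`. -/
def Touches (n : ℕ) (p : ℤ × ℤ) : Prop := p.1.natAbs = n ∨ p.2.natAbs = n

instance (n : ℕ) (p : ℤ × ℤ) : Decidable (Touches n p) :=
  inferInstanceAs (Decidable (_ ∨ _))

/-- The matrix unit at `p` as a constant function on the circles. -/
def unitY (p : ℤ × ℤ) : YZ :=
  mkY (fun _ => unitOp p.1 p.2) continuous_const 1 fun _ => norm_unitOp_le _ _

theorem norm_cutUnit_le (p : ℤ × ℤ) (n : ℕ) :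
    ‖if Touches n p then 0 else unitOp p.1 p.2‖ ≤ 1 := by
  split_ifs
  · simp
  · exact norm_unitOp_le _ _

/-- The matrix unit at `p`, removed on those circles whose level `p` touches. -/
def cutUnitY (p : ℤ × ℤ) : YZ :=
  mkY (fun s : ℕ × ℝ => if Touches s.1 p then 0 else unitOp p.1 p.2)
    ((continuous_of_discreteTopology
      (f := fun n : ℕ => if Touches n p then 0 else unitOp p.1 p.2)).comp continuous_fst)
    1 fun s => norm_cutUnit_le p s.1

theorem norm_unitY_le (p : ℤ × ℤ) : ‖unitY p‖ ≤ 1 := norm_mkY_le _ _ _ _ zero_le_one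

theorem norm_cutUnitY_le (p : ℤ × ℤ) : ‖cutUnitY p‖ ≤ 1 := norm_mkY_le _ _ _ _ zero_le_one

/-- The matrix `M` with the rows and columns of level `n` removed. -/
def cutMat (n : ℕ) (M : ℤ × ℤ → ℂ) (p : ℤ × ℤ) : ℂ := if Touches n p then 0 else M p

theorem norm_cutMat_le (n : ℕ) (M : ℤ × ℤ → ℂ) (p : ℤ × ℤ) : ‖cutMat n M p‖ ≤ ‖M p‖ := by
  unfold cutMat
  split_ifs <;> simp

theorem summable_cutMat {M : ℤ × ℤ → ℂ} (hM : Summable fun p => ‖M p‖) (n : ℕ) :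
    Summable fun p => ‖cutMat n M p‖ :=
  Summable.of_nonneg_of_le (fun _ => norm_nonneg _) (norm_cutMat_le n M) hM

/-- The operator with matrix `M`, as a constant function on the circles. -/
def opY (M : ℤ × ℤ → ℂ) : YZ := ∑' p, M p • unitY p

/-- On the circle about `n`, the operator with matrix `cutMat n M`. -/
def cutY (M : ℤ × ℤ → ℂ) : YZ := ∑' p, M p • cutUnitY p

variable {M : ℤ × ℤ → ℂ}

theorem norm_opY_le (hM : Summable fun p => ‖M p‖) : ‖opY M‖ ≤ ∑' p, ‖M p‖ :=
  norm_tsum_smul_le hM norm_unitY_le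

theorem norm_cutY_le (hM : Summable fun p => ‖M p‖) : ‖cutY M‖ ≤ ∑' p, ‖M p‖ :=
  norm_tsum_smul_le hM norm_cutUnitY_le

theorem evalY_opY (hM : Summable fun p => ‖M p‖) (s : ℕ × ℝ) : evalY s (opY M) = opMat M := by
  have h := (evalY s).hasSum (summable_smul_of_norm_le hM norm_unitY_le).hasSum
  refine h.unique ((hasSum_opMat hM).congr_fun fun p => ?_)
  rw [map_smul, unitY, evalY_mkY]

theorem evalY_cutY (hM : Summable fun p => ‖M p‖) (s : ℕ × ℝ) :
    evalY s (cutY M) = opMat (cutMat s.1 M) := by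
  have h := (evalY s).hasSum (summable_smul_of_norm_le hM norm_cutUnitY_le).hasSum
  refine h.unique ((hasSum_opMat (summable_cutMat hM s.1)).congr_fun fun p => ?_)
  rw [map_smul, cutUnitY, evalY_mkY, cutMat]
  split_ifs <;> simp

end

/-! ### Contour integrals over the circles -/

section Contour

variable {E F : Type*} [NormedAddCommGroup E] [NormedSpace ℂ E] [NormedAddCommGroup F]
  [NormedSpace ℂ F]

/-- The contour integral `(2πi)⁻¹ ∮ f(λ) g(λ) dλ` over the circle `|λ - n| = 1/2`, where `g` is
given as a function of the angle. -/
def circAvg (n : ℕ) (f : ℂ → ℂ) (g : ℝ → E) : E :=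
  (2 * π * Complex.I : ℂ)⁻¹ •
    ∫ t in (0 : ℝ)..2 * π, (deriv (circleMap n (1 / 2)) t * f (circPt (n, t))) • g t

variable {n : ℕ} {f : ℂ → ℂ} {g g₁ g₂ : ℝ → E}

theorem continuous_circWeight (hf : Continuous fun t : ℝ => f (circPt (n, t))) :
    Continuous fun t : ℝ => deriv (circleMap n (1 / 2)) t * f (circPt (n, t)) := by
  refine Continuous.mul ?_ hf
  have h : deriv (circleMap n (1 / 2)) = fun t => circleMap 0 (1 / 2) t * Complex.I :=
    funext fun t => deriv_circleMap _ _ t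
  rw [h]
  fun_prop

theorem circAvg_add (hf : Continuous fun t : ℝ => f (circPt (n, t))) (h₁ : Continuous g₁)
    (h₂ : Continuous g₂) :
    circAvg n f (fun t => g₁ t + g₂ t) = circAvg n f g₁ + circAvg n f g₂ := by
  have hw := continuous_circWeight hf
  have h := intervalIntegral.integral_add (μ := MeasureTheory.volume)
    ((hw.smul h₁).intervalIntegrable 0 (2 * π)) ((hw.smul h₂).intervalIntegrable 0 (2 * π))
  rw [circAvg, circAvg, circAvg, ← smul_add]
  refine congrArg _ (Eq.trans ?_ h)
  simp only [smul_add, Pi.smul_apply']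

theorem circAvg_smul (c : ℂ) (g : ℝ → E) :
    circAvg n f (fun t => c • g t) = c • circAvg n f g := by
  rw [circAvg, circAvg, smul_comm c]
  refine congrArg _ ?_
  rw [← intervalIntegral.integral_smul]
  simp only [smul_comm _ c]

theorem norm_circAvg_le {B C : ℝ} (hB : 0 ≤ B) (hf : ∀ t, ‖f (circPt (n, t))‖ ≤ C)
    (hg : ∀ t, ‖g t‖ ≤ B) : ‖circAvg n f g‖ ≤ C * B := by
  have hC : 0 ≤ C := (norm_nonneg _).trans (hf 0)
  have h := intervalIntegral.norm_integral_le_of_norm_le_const (a := 0) (b := 2 * π)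
    (C := 1 / 2 * C * B)
    (f := fun t => (deriv (circleMap n (1 / 2)) t * f (circPt (n, t))) • g t) (fun t _ => by
      rw [norm_smul, norm_mul]
      have : ‖deriv (circleMap n (1 / 2)) t‖ = 1 / 2 := by
        rw [deriv_circleMap]
        simp
      rw [this]
      gcongr
      · exact hf t
      · exact hg t)
  rw [circAvg, norm_smul]
  have h2 : ‖(2 * π * Complex.I : ℂ)⁻¹‖ = (2 * π)⁻¹ := by
    simp [abs_of_pos Real.pi_pos]
  rw [h2, sub_zero, abs_of_pos Real.two_pi_pos] at *
  calc (2 * π)⁻¹ * ‖∫ t in (0 : ℝ)..2 * π,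
        (deriv (circleMap n (1 / 2)) t * f (circPt (n, t))) • g t‖
      ≤ (2 * π)⁻¹ * (1 / 2 * C * B * (2 * π)) := by gcongr
    _ = 1 / 2 * (C * B) := by field_simp
    _ ≤ C * B := by nlinarith [mul_nonneg hC hB]

theorem ContinuousLinearMap.map_circAvg [CompleteSpace E] [CompleteSpace F] (L : E →L[ℂ] F)
    (hf : Continuous fun t : ℝ => f (circPt (n, t))) (hg : Continuous g) :
    L (circAvg n f g) = circAvg n f (fun t => L (g t)) := by
  rw [circAvg, circAvg, map_smul, ← ContinuousLinearMap.intervalIntegral_comp_comm]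
  · simp only [map_smul]
  · exact ((continuous_circWeight hf).smul hg).intervalIntegrable _ _

theorem circAvg_eq_circleIntegral (h : ℂ → ℂ) :
    circAvg n f (fun t => h (circPt (n, t))) =
      (2 * π * Complex.I : ℂ)⁻¹ * ∮ z in C(n, 1 / 2), f z * h z := by
  rw [circAvg, circleIntegral, smul_eq_mul]
  congr 1
  refine intervalIntegral.integral_congr fun t _ => ?_
  simp [circPt, mul_assoc]

theorem circAvg_inv_of_mem (hf : ∀ z ∈ Metric.closedBall (n : ℂ) (1 / 2), DifferentiableAt ℂ f z)
    {w : ℂ} (hw : w ∈ Metric.ball (n : ℂ) (1 / 2)) :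
    circAvg n f (fun t => (circPt (n, t) - w)⁻¹) = f w := by
  rw [circAvg_eq_circleIntegral fun z => (z - w)⁻¹]
  have h := Complex.two_pi_I_inv_smul_circleIntegral_sub_inv_smul_of_differentiable_on_off_countable
    (s := ∅) (f := f) countable_empty hw
    (fun z hz => (hf z hz).continuousAt.continuousWithinAt)
    (fun z hz => hf z (Metric.ball_subset_closedBall hz.1))
  rw [smul_eq_mul] at h
  rw [← h]
  congr 1
  simp only [smul_eq_mul, mul_comm]

theorem circAvg_inv_of_notMem
    (hf : ∀ z ∈ Metric.closedBall (n : ℂ) (1 / 2), DifferentiableAt ℂ f z)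
    {w : ℂ} (hw : w ∉ Metric.closedBall (n : ℂ) (1 / 2)) :
    circAvg n f (fun t => (circPt (n, t) - w)⁻¹) = 0 := by
  rw [circAvg_eq_circleIntegral fun z => (z - w)⁻¹]
  have hd : ∀ z ∈ Metric.closedBall (n : ℂ) (1 / 2),
      DifferentiableAt ℂ (fun z => f z * (z - w)⁻¹) z := fun z hz =>
    (hf z hz).mul ((differentiableAt_id.sub_const w).inv
      (sub_ne_zero.2 fun h => hw (h ▸ hz)))
  rw [Complex.circleIntegral_eq_zero_of_differentiable_on_off_countable (by norm_num)
    countable_empty (fun z hz => (hd z hz).continuousAt.continuousWithinAt)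
    (fun z hz => hd z (Metric.ball_subset_closedBall hz.1)), mul_zero]

theorem continuous_comp_circPt
    (hf : ∀ z ∈ Metric.closedBall (n : ℂ) (1 / 2), DifferentiableAt ℂ f z) :
    Continuous fun t : ℝ => f (circPt (n, t)) := by
  rw [continuous_iff_continuousAt]
  intro t
  have h1 : circPt (n, t) ∈ Metric.closedBall (n : ℂ) (1 / 2) := by
    rw [mem_closedBall_iff_norm, norm_circPt_sub]
  have h2 : ContinuousAt (fun t : ℝ => circPt (n, t)) t := by
    have := continuous_circPt
    fun_prop
  exact ContinuousAt.comp (f := fun t : ℝ => circPt (n, t)) (hf _ h1).continuousAt h2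

/-- The operator `(2πi)⁻¹ ∮ f(λ) K(λ) dλ` for an operator-valued function `K` on the circles. -/
def contourOp (n : ℕ) (f : ℂ → ℂ) (K : YZ) : HZ →L[ℂ] HZ := circAvg n f fun t => evalY (n, t) K

theorem continuous_evalY_circ (n : ℕ) (K : YZ) : Continuous fun t : ℝ => evalY (n, t) K :=
  (continuous_evalY K).comp (by fun_prop)

theorem contourOp_apply (hf : Continuous fun t : ℝ => f (circPt (n, t))) (K : YZ) (v : HZ) :
    contourOp n f K v = circAvg n f fun t => evalY (n, t) K v :=
  (ContinuousLinearMap.apply ℂ HZ v).map_circAvg hf (continuous_evalY_circ n K)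

theorem contourOp_apply_apply (hf : Continuous fun t : ℝ => f (circPt (n, t))) (K : YZ) (v : HZ)
    (i : ℤ) : contourOp n f K v i = circAvg n f fun t => evalY (n, t) K v i := by
  have h := (coordCLM i).map_circAvg hf
    ((ContinuousLinearMap.apply ℂ HZ v).continuous.comp (continuous_evalY_circ n K))
  rw [← coordCLM_apply, contourOp_apply hf]
  refine h.trans ?_
  simp only [coordCLM_apply]
  rfl

end Contour

/-! ### Eigenvectors of `Λ + M` -/

section

variable {M : ℤ × ℤ → ℂ}

/-- The eigenspace at `μ` of the unbounded operator `Λ + M` on `ℓ²(ℤ)`, where `Λ e_i = |i| e_i`. -/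
def eigM (M : ℤ × ℤ → ℂ) (μ : ℝ) : Submodule ℂ HZ where
  carrier := {w | ∀ i : ℤ, (i.natAbs : ℂ) * w i + opMat M w i = μ * w i}
  add_mem' := fun {v w} hv hw i => by
    have h1 := hv i
    have h2 := hw i
    simp only [map_add, lp.coeFn_add, Pi.add_apply]
    linear_combination h1 + h2
  zero_mem' := fun i => by simp
  smul_mem' := fun c w hw i => by
    have h1 := hw i
    simp only [map_smul, lp.coeFn_smul, Pi.smul_apply, smul_eq_mul]
    linear_combination c * h1

theorem mem_eigM {μ : ℝ} {w : HZ} :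
    w ∈ eigM M μ ↔ ∀ i : ℤ, (i.natAbs : ℂ) * w i + opMat M w i = μ * w i := Iff.rfl

/-- A Hermitian matrix with a small absolute sum of its entries. -/
structure SmallHerm (M : ℤ × ℤ → ℂ) : Prop where
  summable : Summable fun p => ‖M p‖
  small : ∑' p, ‖M p‖ ≤ 1 / 4
  herm : ∀ i j, M (i, j) = starRingEnd ℂ (M (j, i))

namespace SmallHerm

theorem norm_opMat_le (hM : SmallHerm M) : ‖opMat M‖ ≤ 1 / 4 :=
  (_root_.norm_opMat_le hM.summable).trans hM.small

theorem norm_opY_le (hM : SmallHerm M) : ‖opY M‖ ≤ 1 / 4 :=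
  (_root_.norm_opY_le hM.summable).trans hM.small

theorem norm_cutY_le (hM : SmallHerm M) : ‖cutY M‖ ≤ 1 / 4 :=
  (_root_.norm_cutY_le hM.summable).trans hM.small

theorem cutMat (hM : SmallHerm M) (n : ℕ) : SmallHerm (cutMat n M) where
  summable := summable_cutMat hM.summable n
  small := ((summable_cutMat hM.summable n).tsum_le_tsum (norm_cutMat_le n M) hM.summable).trans
    hM.small
  herm := fun i j => by
    have h : Touches n (i, j) ↔ Touches n (j, i) := or_comm
    by_cases h' : Touches n (i, j)
    · rw [_root_.cutMat, _root_.cutMat, if_pos h', if_pos (h.1 h'), map_zero]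
    · rw [_root_.cutMat, _root_.cutMat, if_neg h', if_neg (h.not.1 h'), hM.herm i j]

theorem opMat_inner (hM : SmallHerm M) (v w : HZ) :
    inner ℂ (opMat M v) w = inner ℂ v (opMat M w) := by
  have hs : IsSelfAdjoint (opMat M) := by
    have h1 := hasSum_opMat hM.summable
    have hadj : ∀ p : ℤ × ℤ, star (M p • unitOp p.1 p.2) = M p.swap • unitOp p.2 p.1 := by
      rintro ⟨i, j⟩
      rw [ContinuousLinearMap.star_eq_adjoint, eq_comm, ContinuousLinearMap.eq_adjoint_iff]
      intro x y
      simp only [smul_apply, unitOp_apply, Prod.swap, inner_smul_left, inner_smul_right, inner_ez,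
        ← inner_conj_symm x (ez i)]
      rw [hM.herm j i]
      simp [mul_comm]
    have h2 := h1.star
    simp only [hadj] at h2
    have h3 := (Equiv.prodComm ℤ ℤ).hasSum_iff.2 h1
    exact h2.unique (by simpa [Function.comp_def] using h3)
  exact hs.isSymmetric v w

/-- Off its own level, an eigenvector can only be small; so if it vanishes wherever `|i|` is near
the eigenvalue then it is zero. -/
theorem eq_zero_of_mem_eigM (hM : SmallHerm M) {μ : ℝ} {w : HZ} (hw : w ∈ eigM M μ)
    (h : ∀ i : ℤ, w i ≠ 0 → 1 / 2 ≤ |μ - i.natAbs|) : w = 0 := by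
  have h1 : ‖w‖ ≤ 2 * ‖opMat M w‖ := by
    refine lp.norm_le_of_tsum_le (by norm_num) (by positivity) ?_
    simp only [ENNReal.toReal_ofNat, Real.rpow_ofNat]
    have h2 := (hasSum_norm_sq (opMat M w)).mul_left (2 ^ 2)
    rw [mul_pow, ← h2.tsum_eq]
    refine (hasSum_norm_sq w).summable.tsum_le_tsum (fun i => ?_) h2.summable
    rw [← mul_pow]
    refine pow_le_pow_left₀ (norm_nonneg _) ?_ 2
    by_cases h0 : w i = 0
    · rw [h0, norm_zero]; positivity
    · have h3 : opMat M w i = ((μ - i.natAbs : ℝ) : ℂ) * w i := by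
        have := hw i
        push_cast
        linear_combination this
      rw [h3, norm_mul, Complex.norm_real, Real.norm_eq_abs]
      nlinarith [h i h0, norm_nonneg (w i)]
  have h2 : ‖opMat M w‖ ≤ 1 / 4 * ‖w‖ :=
    (ContinuousLinearMap.le_opNorm _ _).trans
      (mul_le_mul_of_nonneg_right hM.norm_opMat_le (norm_nonneg _))
  have h3 := norm_nonneg w
  exact norm_eq_zero.1 (by linarith)

/-- The resolvent acts on an eigenvector by `(λ - μ)⁻¹`. -/
theorem perturb_apply_of_mem_eigM (hM : SmallHerm M) {μ : ℝ} {w : HZ} (hw : w ∈ eigM M μ)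
    (s : ℕ × ℝ) : (circPt s - μ) • evalY s (perturb DY (opY M)) w = w := by
  have hsm : ‖DY‖ * ‖opY M‖ < 1 := by
    have := mul_le_mul norm_DY_le hM.norm_opY_le (norm_nonneg _) zero_le_two
    linarith
  have h1 := congrArg (evalY s) (perturb_eq_right hsm)
  rw [map_add, evalY_mul, evalY_mul, evalY_opY hM.summable] at h1
  set P := evalY s (perturb DY (opY M))
  have h2 : (circPt s - μ) • evalY s DY w = w - evalY s DY (opMat M w) := by
    ext i
    have h3 := circPt_sub_ne_zero s i.natAbs
    simp only [evalY_DY, lp.coeFn_smul, lp.coeFn_sub, Pi.smul_apply, Pi.sub_apply, diagOp_apply,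
      invLev_apply, smul_eq_mul]
    have h4 := hw i
    field_simp
    linear_combination h4
  have h3 : evalY s DY ((circPt s - μ) • w + opMat M w) = w := by
    rw [map_add, map_smul, h2]; abel
  -- Apply `P = D + P m D` to `(λ - μ) w + m w`, which `D` sends to `w`; the terms `P m w` cancel.
  have h4 : ∀ v, P v = evalY s DY v + P (opMat M (evalY s DY v)) := fun v => by
    conv_lhs => rw [h1]
    rfl
  have h5 := h4 ((circPt s - μ) • w + opMat M w)
  rw [h3, map_add, map_smul] at h5
  exact add_right_cancel h5

end SmallHerm

end

/-! ### The compact resolvent and the eigenvector expansion -/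

section

variable {M : ℤ × ℤ → ℂ}

theorem norm_inv_one_add_natAbs_le (i : ℤ) : ‖(1 + (i.natAbs : ℂ))⁻¹‖ ≤ 1 := by
  rw [norm_inv]
  have : ‖(1 + (i.natAbs : ℂ))‖ = 1 + i.natAbs := by
    rw [← Nat.cast_one, ← Nat.cast_add, Complex.norm_natCast]; simp
  rw [this]
  exact inv_le_one_of_one_le₀ (by simp)

/-- The sequence `i ↦ (1 + |i|)⁻¹`. -/
def invOneAdd : ℤ →ᵇ ℂ :=
  BoundedContinuousFunction.ofNormedAddCommGroupDiscrete
    (fun i : ℤ => (1 + (i.natAbs : ℂ))⁻¹) 1 norm_inv_one_add_natAbs_le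

theorem invOneAdd_apply (i : ℤ) : invOneAdd i = (1 + (i.natAbs : ℂ))⁻¹ := rfl

theorem one_add_natAbs_ne_zero (i : ℤ) : (1 + (i.natAbs : ℂ)) ≠ 0 := by
  rw [add_comm]; exact Nat.cast_add_one_ne_zero _

theorem tendsto_invOneAdd : Tendsto invOneAdd cofinite (𝓝 0) := by
  rw [tendsto_zero_iff_norm_tendsto_zero]
  have h1 : ∀ i : ℤ, ‖invOneAdd i‖ = (1 + |(i : ℝ)|)⁻¹ := fun i => by
    rw [invOneAdd_apply, norm_inv, ← Nat.cast_one, ← Nat.cast_add, Complex.norm_natCast]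
    simp
  simp only [h1]
  refine Tendsto.inv_tendsto_atTop (tendsto_atTop_add_const_left _ _ ?_)
  exact (tendsto_norm_cocompact_atTop (E := ℝ)).comp Int.tendsto_coe_cofinite

/-- The resolvent `(1 + Λ + M)⁻¹`. -/
def resolventT (M : ℤ × ℤ → ℂ) : HZ →L[ℂ] HZ := perturb (diagOp invOneAdd) (-opMat M)

namespace SmallHerm

theorem norm_invOneAdd_mul_lt (hM : SmallHerm M) : ‖diagOp invOneAdd‖ * ‖-opMat M‖ < 1 := by
  have h1 : ‖diagOp invOneAdd‖ ≤ 1 := (norm_diagOp_le _).trans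
    ((BoundedContinuousFunction.norm_le zero_le_one).2 norm_inv_one_add_natAbs_le)
  have h2 := hM.norm_opMat_le
  rw [norm_neg]
  nlinarith [norm_nonneg (opMat M), norm_nonneg (diagOp invOneAdd)]

theorem resolventT_apply (hM : SmallHerm M) (v : HZ) (i : ℤ) :
    (1 + (i.natAbs : ℂ)) * resolventT M v i = v i - opMat M (resolventT M v) i := by
  have h : resolventT M v = diagOp invOneAdd (v - opMat M (resolventT M v)) := by
    have h1 := congrArg (fun K : HZ →L[ℂ] HZ => K v) (perturb_eq_left hM.norm_invOneAdd_mul_lt)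
    refine h1.trans ?_
    rw [map_sub]
    simp [resolventT, sub_eq_add_neg]
  have h2 : resolventT M v i = (1 + (i.natAbs : ℂ))⁻¹ * (v i - opMat M (resolventT M v) i) := by
    conv_lhs => rw [h]
    rfl
  rw [h2, mul_inv_cancel_left₀ (one_add_natAbs_ne_zero i)]

theorem resolventT_of_mem_eigM (hM : SmallHerm M) {μ : ℝ} {w : HZ} (hw : w ∈ eigM M μ) :
    (1 + μ : ℂ) • resolventT M w = w := by
  have h1 := perturb_eq_right hM.norm_invOneAdd_mul_lt
  have h4 : ∀ v, resolventT M v =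
      diagOp invOneAdd v - resolventT M (opMat M (diagOp invOneAdd v)) := fun v => by
    have h := congrArg (fun K : HZ →L[ℂ] HZ => K v) h1
    refine h.trans ?_
    simp [resolventT, sub_eq_add_neg]
  have h3 : diagOp invOneAdd ((1 + μ : ℂ) • w - opMat M w) = w := by
    ext i
    rw [diagOp_apply, invOneAdd_apply]
    have h5 := one_add_natAbs_ne_zero i
    simp only [lp.coeFn_smul, lp.coeFn_sub, Pi.smul_apply, Pi.sub_apply, smul_eq_mul]
    field_simp
    linear_combination -(hw i)
  have h5 := h4 ((1 + μ : ℂ) • w - opMat M w)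
  rw [h3, map_sub, map_smul] at h5
  exact sub_left_inj.1 h5

theorem resolventT_isSymmetric (hM : SmallHerm M) :
    (resolventT M : HZ →ₗ[ℂ] HZ).IsSymmetric := by
  intro v w
  -- Write `v = (1 + Λ + M) x` and `w = (1 + Λ + M) y`, coordinatewise.
  set x := resolventT M v with hx
  set y := resolventT M w with hy
  change inner ℂ x w = inner ℂ v y
  have h1 := (lp.hasSum_inner (𝕜 := ℂ) x (w - opMat M y))
  have h2 := (lp.hasSum_inner (𝕜 := ℂ) (v - opMat M x) y)
  have h3 : inner ℂ x (w - opMat M y) = inner ℂ (v - opMat M x) y := by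
    refine h1.unique (h2.congr_fun fun i => ?_)
    have h4 : (w - opMat M y) i = (1 + (i.natAbs : ℂ)) * y i := by
      rw [hM.resolventT_apply w i]; rfl
    have h5 : (v - opMat M x) i = (1 + (i.natAbs : ℂ)) * x i := by
      rw [hM.resolventT_apply v i]; rfl
    rw [h4, h5]
    simp
    ring
  rw [inner_sub_right, inner_sub_left, hM.opMat_inner] at h3
  exact sub_left_inj.1 h3

theorem isCompactOperator_resolventT (M : ℤ × ℤ → ℂ) : IsCompactOperator (resolventT M) := by
  have h1 := isCompactOperator_diagOp invOneAdd tendsto_invOneAdd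
  exact h1.clm_comp (Ring.inverse (1 - diagOp invOneAdd * -opMat M))

theorem eigenspace_resolventT_le (hM : SmallHerm M) (ν : ℂ) :
    Module.End.eigenspace (resolventT M : HZ →ₗ[ℂ] HZ) ν ≤ ⨆ μ, eigM M μ := by
  intro v hv
  rw [Module.End.mem_eigenspace_iff] at hv
  have hv' : resolventT M v = ν • v := hv
  by_cases h0 : v = 0
  · rw [h0]; exact Submodule.zero_mem _
  have hν : ν ≠ 0 := by
    rintro rfl
    rw [zero_smul] at hv'
    refine h0 ?_
    ext i
    have := hM.resolventT_apply v i
    rw [hv'] at this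
    simpa using this.symm
  have hreal : starRingEnd ℂ ν = ν := hM.resolventT_isSymmetric.conj_eigenvalue_eq_self
    (Module.End.hasEigenvalue_of_hasEigenvector
      ⟨Module.End.mem_eigenspace_iff.2 hv, h0⟩)
  obtain ⟨r, rfl⟩ := Complex.conj_eq_iff_real.1 hreal
  have hr : r ≠ 0 := by exact_mod_cast hν
  refine Submodule.mem_iSup_of_mem (r⁻¹ - 1) fun i => ?_
  have h1 := hM.resolventT_apply v i
  rw [hv', map_smul] at h1
  simp only [lp.coeFn_smul, Pi.smul_apply, smul_eq_mul] at h1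
  push_cast
  field_simp
  linear_combination h1

theorem finiteDimensional_eigM (hM : SmallHerm M) (μ : ℝ) : FiniteDimensional ℂ (eigM M μ) := by
  by_cases h : (1 + μ : ℂ) = 0
  · have : eigM M μ = ⊥ := (Submodule.eq_bot_iff _).2 fun w hw => by
      rw [← hM.resolventT_of_mem_eigM hw, h, zero_smul]
    rw [this]
    infer_instance
  · have h1 := ContinuousLinearMap.finite_dimensional_eigenspace (isCompactOperator_resolventT M)
      (1 + μ : ℂ)⁻¹ (inv_ne_zero h)
    refine Submodule.finiteDimensional_of_le (S₂ := Module.End.eigenspace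
      (resolventT M : HZ →ₗ[ℂ] HZ) (1 + μ : ℂ)⁻¹) fun w hw => ?_
    rw [Module.End.mem_eigenspace_iff]
    change resolventT M w = _
    rw [eq_inv_smul_iff₀ h, hM.resolventT_of_mem_eigM hw]

theorem orthogonalFamily_eigM (hM : SmallHerm M) :
    OrthogonalFamily ℂ (fun μ => eigM M μ) fun μ => (eigM M μ).subtypeₗᵢ := by
  intro μ ν hne v w
  have hv := v.2
  have hw := w.2
  have h1 := hM.resolventT_of_mem_eigM hv
  have h2 := hM.resolventT_of_mem_eigM hw
  have h3 := hM.resolventT_isSymmetric v w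
  change inner ℂ (resolventT M v) (w : HZ) = inner ℂ (v : HZ) (resolventT M w) at h3
  have h4 : (1 + μ : ℂ) * inner ℂ (resolventT M v) (resolventT M w) =
      (1 + ν : ℂ) * inner ℂ (resolventT M v) (resolventT M w) := by
    have h5 : inner ℂ (v : HZ) (resolventT M w) =
        (1 + μ : ℂ) * inner ℂ (resolventT M v) (resolventT M w) := by
      conv_lhs => rw [← h1, inner_smul_left]
      simp
    have h6 : inner ℂ (resolventT M v) (w : HZ) =
        (1 + ν : ℂ) * inner ℂ (resolventT M v) (resolventT M w) := by
      conv_lhs => rw [← h2, inner_smul_right]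
    rw [← h5, ← h6, h3]
  have h5 : inner ℂ (resolventT M v) (resolventT M w) = 0 := by
    have h6 : ((μ : ℂ) - ν) * inner ℂ (resolventT M v) (resolventT M w) = 0 := by
      linear_combination h4
    refine (mul_eq_zero.1 h6).resolve_left (sub_ne_zero.2 fun h => hne ?_)
    exact_mod_cast h
  change inner ℂ (v : HZ) (w : HZ) = 0
  rw [← h1, ← h2, inner_smul_left, inner_smul_right, h5]
  simp

theorem isHilbertSum_eigM (hM : SmallHerm M) :
    IsHilbertSum ℂ (fun μ => eigM M μ) fun μ => (eigM M μ).subtypeₗᵢ := by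
  have : ∀ μ, FiniteDimensional ℂ (eigM M μ) := hM.finiteDimensional_eigM
  have : ∀ μ, CompleteSpace (eigM M μ) := fun μ => FiniteDimensional.complete ℂ _
  refine IsHilbertSum.mkInternal _ hM.orthogonalFamily_eigM ?_
  have h1 := ContinuousLinearMap.orthogonalComplement_iSup_eigenspaces_eq_bot
    (isCompactOperator_resolventT M) hM.resolventT_isSymmetric
  have h2 : (⨆ μ, eigM M μ)ᗮ = ⊥ := by
    rw [eq_bot_iff, ← h1]
    exact Submodule.orthogonal_le (iSup_le hM.eigenspace_resolventT_le)
  rw [Submodule.topologicalClosure_eq_top_iff.2 h2]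

/-- The orthogonal projection to an eigenspace. -/
def eigProj (hM : SmallHerm M) (μ : ℝ) : HZ →L[ℂ] HZ :=
  haveI := hM.finiteDimensional_eigM μ
  (eigM M μ).starProjection

theorem eigProj_mem (hM : SmallHerm M) (μ : ℝ) (v : HZ) : hM.eigProj μ v ∈ eigM M μ := by
  have := hM.finiteDimensional_eigM μ
  exact Submodule.starProjection_apply_mem _ v

theorem eigProj_of_mem (hM : SmallHerm M) {μ : ℝ} {v : HZ} (hv : v ∈ eigM M μ) :
    hM.eigProj μ v = v := by
  have := hM.finiteDimensional_eigM μ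
  exact Submodule.starProjection_eq_self_iff.2 hv

/-- The eigenvector expansion of a vector. -/
theorem hasSum_eigProj (hM : SmallHerm M) (v : HZ) : HasSum (fun μ => hM.eigProj μ v) v := by
  have hH := hM.isHilbertSum_eigM
  have h1 := hH.hasSum_linearIsometryEquiv_symm (hH.linearIsometryEquiv v)
  rw [LinearIsometryEquiv.symm_apply_apply] at h1
  refine h1.congr_fun fun μ => ?_
  have := hM.finiteDimensional_eigM μ
  have h2 := (hM.eigProj μ).hasSum h1
  refine h2.unique ?_
  refine (hasSum_ite_eq μ ((eigM M μ).subtypeₗᵢ (hH.linearIsometryEquiv v μ))).congr_fun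
    fun ν => ?_
  by_cases h : ν = μ
  · subst h
    simp only [if_true]
    exact hM.eigProj_of_mem (Submodule.coe_mem _)
  · rw [if_neg h]
    refine (Submodule.starProjection_apply_eq_zero_iff _).2 ?_
    intro u hu
    exact hM.orthogonalFamily_eigM (Ne.symm h) ⟨u, hu⟩ (hH.linearIsometryEquiv v ν)

theorem inner_eigProj_self (hM : SmallHerm M) (μ : ℝ) (v : HZ) :
    inner ℂ v (hM.eigProj μ v) = ((‖hM.eigProj μ v‖ ^ 2 : ℝ) : ℂ) := by
  have := hM.finiteDimensional_eigM μ
  have h : inner ℂ (v - hM.eigProj μ v) (hM.eigProj μ v) = 0 :=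
    Submodule.starProjection_inner_eq_zero v _ (hM.eigProj_mem μ v)
  rw [inner_sub_left, sub_eq_zero] at h
  rw [h, inner_self_eq_norm_sq_to_K]
  push_cast
  rfl

/-- The trace of the projection to an eigenspace is its dimension. -/
theorem hasSum_norm_eigProj (hM : SmallHerm M) (μ : ℝ) :
    HasSum (fun m => ‖hM.eigProj μ (ez m)‖ ^ 2) (Module.finrank ℂ (eigM M μ)) := by
  have := hM.finiteDimensional_eigM μ
  set b := stdOrthonormalBasis ℂ (eigM M μ)
  have h1 : ∀ m, ‖hM.eigProj μ (ez m)‖ ^ 2 = ∑ j, ‖(b j : HZ) m‖ ^ 2 := fun m => by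
    have h2 := b.sum_sq_norm_inner_right ((eigM M μ).orthogonalProjectionOnto (ez m))
    have h3 : ‖hM.eigProj μ (ez m)‖ = ‖(eigM M μ).orthogonalProjectionOnto (ez m)‖ := rfl
    rw [h3, ← h2]
    refine Finset.sum_congr rfl fun j _ => ?_
    rw [← inner_ez, norm_inner_symm (ez m), Submodule.inner_orthogonalProjectionOnto_eq_of_mem_left]
  simp only [h1]
  have h4 := hasSum_sum (s := Finset.univ) fun j _ => hasSum_norm_sq (b j : HZ)
  have h5 : ∀ j, ‖(b j : HZ)‖ ^ 2 = 1 := fun j => by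
    rw [Submodule.norm_coe, b.norm_eq_one, one_pow]
  simpa [h5] using h4

end SmallHerm

end

/-! ### Matrix entries of contour integrals -/

theorem exists_bound_circ {n : ℕ} {f : ℂ → ℂ} (hf : Continuous fun t : ℝ => f (circPt (n, t))) :
    ∃ C, ∀ t : ℝ, ‖f (circPt (n, t))‖ ≤ C := by
  have hp : Function.Periodic (fun t : ℝ => f (circPt (n, t))) (2 * π) := fun t => by
    simp only [circPt, periodic_circleMap _ _ t]
  obtain ⟨C, hC⟩ := (hp.isBounded_of_continuous Real.two_pi_pos.ne' hf).exists_norm_le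
  exact ⟨C, fun t => hC _ (mem_range_self t)⟩

/-- The matrix entries of `contourOp n f K`, as continuous functionals of `K`. -/
def contourFun (n : ℕ) (f : ℂ → ℂ) (hf : Continuous fun t : ℝ => f (circPt (n, t))) (i j : ℤ) :
    YZ →L[ℂ] ℂ :=
  LinearMap.mkContinuousOfExistsBound
    { toFun := fun K => circAvg n f fun t => evalY (n, t) K (ez i) j
      map_add' := fun K L => by
        rw [← circAvg_add hf]
        · simp
        · exact ((coordCLM j).continuous.comp
            ((ContinuousLinearMap.apply ℂ HZ (ez i)).continuous.comp
              (continuous_evalY_circ n K))).congr fun t => coordCLM_apply j _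
        · exact ((coordCLM j).continuous.comp
            ((ContinuousLinearMap.apply ℂ HZ (ez i)).continuous.comp
              (continuous_evalY_circ n L))).congr fun t => coordCLM_apply j _
      map_smul' := fun c K => by
        rw [RingHom.id_apply, smul_eq_mul, ← smul_eq_mul, ← circAvg_smul]
        simp }
    (by
      obtain ⟨C, hC⟩ := exists_bound_circ hf
      refine ⟨C, fun K => norm_circAvg_le (norm_nonneg _) hC fun t => ?_⟩
      refine (norm_coord_le _ j).trans ((ContinuousLinearMap.le_opNorm _ _).trans ?_)
      rw [norm_ez, mul_one]
      exact norm_evalY_le _ _)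

section

variable {n : ℕ} {f : ℂ → ℂ} (hf : Continuous fun t : ℝ => f (circPt (n, t)))

theorem contourFun_apply (i j : ℤ) (K : YZ) :
    contourFun n f hf i j K = circAvg n f fun t => evalY (n, t) K (ez i) j := rfl

theorem contourFun_eq_contourOp (i j : ℤ) (K : YZ) :
    contourFun n f hf i j K = contourOp n f K (ez i) j := by
  rw [contourOp_apply_apply hf]; rfl

theorem norm_evalY_entry_le (s : ℕ × ℝ) (K : YZ) (i j : ℤ) : ‖evalY s K (ez i) j‖ ≤ ‖K‖ := by
  refine (norm_coord_le _ j).trans ((ContinuousLinearMap.le_opNorm _ _).trans ?_)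
  rw [norm_ez, mul_one]
  exact norm_evalY_le _ _

theorem norm_contourFun_le {C : ℝ} (hC : ∀ t : ℝ, ‖f (circPt (n, t))‖ ≤ C) (i j : ℤ) :
    ‖contourFun n f hf i j‖ ≤ C :=
  ContinuousLinearMap.opNorm_le_bound _ ((norm_nonneg _).trans (hC 0)) fun _ =>
    norm_circAvg_le (norm_nonneg _) hC fun _ => norm_evalY_entry_le _ _ _ _

include hf in
theorem hasSum_circAvg {ι : Type*} [Countable ι] {g : ι → ℝ → ℂ} {G : ℝ → ℂ} {b : ι → ℝ}
    (hg : ∀ m, Continuous (g m)) (hb : Summable b) (hgb : ∀ m t, ‖g m t‖ ≤ b m)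
    (hG : ∀ t, HasSum (fun m => g m t) (G t)) :
    HasSum (fun m => circAvg n f (g m)) (circAvg n f G) := by
  have hw := continuous_circWeight hf
  refine HasSum.const_smul _ ?_
  refine intervalIntegral.hasSum_integral_of_dominated_convergence
    (fun m t => ‖deriv (circleMap n (1 / 2)) t * f (circPt (n, t))‖ * b m)
    (fun m => (hw.smul (hg m)).aestronglyMeasurable) (fun m => ?_) ?_ ?_ ?_
  · refine Eventually.of_forall fun t _ => ?_
    rw [norm_smul]
    exact mul_le_mul_of_nonneg_left (hgb m t) (norm_nonneg _)
  · exact Eventually.of_forall fun t _ => hb.mul_left _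
  · simp only [tsum_mul_left]
    exact (hw.norm.mul continuous_const).intervalIntegrable _ _
  · exact Eventually.of_forall fun t _ => (hG t).const_smul _

end

/-! ### The trace of the difference of two resolvents -/

section

variable {M S : ℤ × ℤ → ℂ}

namespace SmallHerm

/-- The resolvent `(λ - Λ - M)⁻¹` on the circles. -/
abbrev _root_.resY (M : ℤ × ℤ → ℂ) : YZ := perturb DY (opY M)

theorem norm_DY_mul_lt {m : YZ} (hm : ‖m‖ ≤ 1 / 4) : ‖DY‖ * ‖m‖ < 1 := by
  have := mul_le_mul norm_DY_le hm (norm_nonneg _) zero_le_two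
  linarith

theorem norm_resY_le (hM : SmallHerm M) : ‖resY M‖ ≤ 4 := norm_perturb_le norm_DY_le hM.norm_opY_le

/-- On the circle about `n`, cutting `M` pointwise or globally gives the same resolvent. -/
theorem evalY_perturb_cutY (hM : SmallHerm M) (n : ℕ) (t : ℝ) :
    evalY (n, t) (perturb DY (cutY M)) = evalY (n, t) (resY (_root_.cutMat n M)) := by
  have h1 := congrArg (evalY (n, t)) (perturb_eq_left (norm_DY_mul_lt hM.norm_cutY_le))
  have h2 := congrArg (evalY (n, t)) (perturb_eq_left (norm_DY_mul_lt (hM.cutMat n).norm_opY_le))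
  rw [map_add, evalY_mul, evalY_mul, evalY_cutY hM.summable] at h1
  rw [map_add, evalY_mul, evalY_mul, evalY_opY (hM.cutMat n).summable] at h2
  set x := evalY (n, t) (perturb DY (cutY M))
  set y := evalY (n, t) (resY (_root_.cutMat n M))
  set m := opMat (_root_.cutMat n M)
  have h3 : x - y = evalY (n, t) DY * m * (x - y) := by
    rw [mul_sub]
    conv_lhs => rw [h1, h2]
    abel
  have h4 : ‖x - y‖ ≤ 2 * (1 / 4) * ‖x - y‖ := by
    calc ‖x - y‖ = ‖evalY (n, t) DY * m * (x - y)‖ := by rw [← h3]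
      _ ≤ ‖evalY (n, t) DY‖ * ‖m‖ * ‖x - y‖ :=
        (norm_mul_le _ _).trans (mul_le_mul_of_nonneg_right (norm_mul_le _ _) (norm_nonneg _))
      _ ≤ _ := by
        gcongr
        · exact (norm_evalY_le _ _).trans norm_DY_le
        · exact (hM.cutMat n).norm_opMat_le
  have h5 := norm_nonneg (x - y)
  exact sub_eq_zero.1 (norm_eq_zero.1 (by linarith))

/-- The column sums of the absolute values of a matrix. -/
def _root_.colSum (M : ℤ × ℤ → ℂ) (m : ℤ) : ℝ := ∑' k, ‖M (k, m)‖

theorem _root_.summable_swap_norm (hM : Summable fun p => ‖M p‖) :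
    Summable fun p : ℤ × ℤ => ‖M p.swap‖ := (Equiv.prodComm ℤ ℤ).summable_iff.2 hM

theorem _root_.summable_colSum (hM : Summable fun p => ‖M p‖) : Summable (colSum M) :=
  (summable_swap_norm hM).prod

theorem _root_.summable_col (hM : Summable fun p => ‖M p‖) (m : ℤ) :
    Summable fun k => ‖M (k, m)‖ :=
  (summable_swap_norm hM).prod_factor m

theorem _root_.tsum_colSum (hM : Summable fun p => ‖M p‖) : ∑' m, colSum M m = ∑' p, ‖M p‖ := by
  rw [← (Equiv.prodComm ℤ ℤ).tsum_eq fun p => ‖M p‖]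
  exact ((summable_swap_norm hM).tsum_prod' fun m => summable_col hM m).symm

theorem _root_.norm_opMat_ez_le (hM : Summable fun p => ‖M p‖) (m : ℤ) :
    ‖opMat M (ez m)‖ ≤ colSum M m := by
  have h := hasSum_ez (opMat M (ez m))
  simp only [opMat_ez hM] at h
  rw [← h.tsum_eq]
  refine tsum_of_norm_bounded (summable_col hM m).hasSum fun k => ?_
  rw [norm_smul, norm_ez, mul_one]

theorem norm_resY_entry_le (hM : SmallHerm M) (s : ℕ × ℝ) (j m : ℤ) :
    ‖evalY s (resY M) (ez m) j‖ ≤ (if m = j then 2 else 0) + 8 * colSum M m := by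
  have h1 := congrArg (evalY s) (perturb_eq_right (norm_DY_mul_lt hM.norm_opY_le))
  rw [map_add, evalY_mul, evalY_mul, evalY_opY hM.summable] at h1
  have h2 : evalY s (resY M) (ez m) = (circPt s - m.natAbs)⁻¹ • ez m +
      (circPt s - m.natAbs)⁻¹ • evalY s (resY M) (opMat M (ez m)) := by
    conv_lhs => rw [h1]
    change evalY s DY (ez m) + evalY s (resY M) (opMat M (evalY s DY (ez m))) = _
    rw [evalY_DY_ez, map_smul, map_smul]
  rw [h2]
  have h3 := norm_inv_circPt_sub_le s m.natAbs
  simp only [lp.coeFn_add, lp.coeFn_smul, Pi.add_apply, Pi.smul_apply]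
  refine (norm_add_le _ _).trans (add_le_add ?_ ?_)
  · rw [norm_smul, ez_apply]
    by_cases h : m = j
    · simpa [h] using h3
    · simp [h, Ne.symm h]
  · rw [norm_smul]
    have h4 : ‖evalY s (resY M) (opMat M (ez m)) j‖ ≤ 4 * colSum M m := by
      refine (norm_coord_le _ j).trans ((ContinuousLinearMap.le_opNorm _ _).trans ?_)
      exact mul_le_mul ((norm_evalY_le _ _).trans hM.norm_resY_le)
        (norm_opMat_ez_le hM.summable m) (norm_nonneg _) (by norm_num)
    have := mul_le_mul h3 h4 (norm_nonneg _) zero_le_two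
    linarith

theorem hasSum_entry_bound (hM : SmallHerm M) (j : ℤ) :
    HasSum (fun m => (if m = j then 2 else 0) + 8 * colSum M m) (2 + 8 * ∑' p, ‖M p‖) := by
  have h := (hasSum_ite_eq j (2 : ℝ)).add ((summable_colSum hM.summable).hasSum.mul_left 8)
  rwa [tsum_colSum hM.summable] at h

variable {n : ℕ} {f : ℂ → ℂ} (hf : Continuous fun t : ℝ => f (circPt (n, t)))

theorem evalY_conj_unitY (K L : YZ) (p : ℤ × ℤ) (s : ℕ × ℝ) (m : ℤ) :
    evalY s (L * unitY p * K) (ez m) m =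
      evalY s K (ez m) p.2 * evalY s L (ez p.1) m := by
  rw [evalY_mul, evalY_mul]
  change evalY s L (unitOp p.1 p.2 (evalY s K (ez m))) m = _
  rw [unitOp_apply, map_smul]
  simp

theorem norm_contourFun_conj_le (hM : SmallHerm M) (hS : SmallHerm S) {C : ℝ}
    (hC : ∀ t : ℝ, ‖f (circPt (n, t))‖ ≤ C) (p : ℤ × ℤ) (m : ℤ) :
    ‖contourFun n f hf m m (resY S * unitY p * resY M)‖ ≤
      C * (((if m = p.2 then 2 else 0) + 8 * colSum M m) * 4) := by
  rw [contourFun_apply]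
  have h0 : 0 ≤ (if m = p.2 then 2 else 0) + 8 * colSum M m :=
    (norm_nonneg _).trans (hM.norm_resY_entry_le (0, 0) p.2 m)
  refine norm_circAvg_le (by positivity) hC fun t => ?_
  rw [evalY_conj_unitY, norm_mul]
  exact mul_le_mul (hM.norm_resY_entry_le _ _ _)
    ((norm_evalY_entry_le _ _ _ _).trans hS.norm_resY_le) (norm_nonneg _) h0

theorem continuous_evalY_entry (n : ℕ) (K : YZ) (i j : ℤ) :
    Continuous fun t : ℝ => evalY (n, t) K (ez i) j :=
  ((coordCLM j).continuous.comp ((ContinuousLinearMap.apply ℂ HZ (ez i)).continuous.comp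
    (continuous_evalY_circ n K))).congr fun _ => coordCLM_apply j _

/-- The trace of `Q E_p P` is an entry of `P Q`. -/
theorem hasSum_contourFun_conj (hM : SmallHerm M) (hS : SmallHerm S) (p : ℤ × ℤ) :
    HasSum (fun m => contourFun n f hf m m (resY S * unitY p * resY M))
      (contourFun n f hf p.1 p.2 (resY M * resY S)) := by
  simp only [contourFun_apply]
  refine hasSum_circAvg hf (b := fun m => ((if m = p.2 then 2 else 0) + 8 * colSum M m) * 4)
    (fun m => continuous_evalY_entry _ _ _ _) ((hM.hasSum_entry_bound p.2).summable.mul_right 4)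
    (fun m t => ?_) fun t => ?_
  · have h0 : 0 ≤ (if m = p.2 then 2 else 0) + 8 * colSum M m :=
      (norm_nonneg _).trans (hM.norm_resY_entry_le (0, 0) p.2 m)
    rw [evalY_conj_unitY, norm_mul]
    exact mul_le_mul (hM.norm_resY_entry_le _ _ _)
      ((norm_evalY_entry_le _ _ _ _).trans hS.norm_resY_le) (norm_nonneg _) h0
  · have h1 := ((coordCLM p.2).comp (evalY (n, t) (resY M))).hasSum
      (hasSum_ez (evalY (n, t) (resY S) (ez p.1)))
    refine (h1.congr_fun fun m => ?_).trans_eq ?_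
    · rw [evalY_conj_unitY]
      simp [coordCLM_apply, mul_comm]
    · rw [ContinuousLinearMap.comp_apply, coordCLM_apply, evalY_mul]; rfl

/-- The trace of the difference of two perturbed resolvents. -/
theorem hasSum_contourFun_sub (hM : SmallHerm M) (hS : SmallHerm S) :
    HasSum (fun m => contourFun n f hf m m (resY M - resY S))
      (∑' p, (M p - S p) * contourFun n f hf p.1 p.2 (resY M * resY S)) := by
  obtain ⟨C, hC⟩ := exists_bound_circ hf
  have hC0 : 0 ≤ C := (norm_nonneg _).trans (hC 0)
  have hMS : Summable fun p => ‖M p - S p‖ :=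
    Summable.of_nonneg_of_le (fun _ => norm_nonneg _) (fun p => norm_sub_le _ _)
      (hM.summable.add hS.summable)
  have hop : opY M - opY S = ∑' p, (M p - S p) • unitY p := by
    rw [opY, opY, ← (summable_smul_of_norm_le hM.summable norm_unitY_le).tsum_sub
      (summable_smul_of_norm_le hS.summable norm_unitY_le)]
    simp only [sub_smul]
  have hPQ : HasSum (fun p => (M p - S p) • (resY S * unitY p * resY M)) (resY M - resY S) := by
    rw [resY, resY, perturb_sub_perturb (norm_DY_mul_lt hM.norm_opY_le)
      (norm_DY_mul_lt hS.norm_opY_le), hop]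
    have h := ((summable_smul_of_norm_le hMS norm_unitY_le).hasSum.mul_left
      (perturb DY (opY S))).mul_right (perturb DY (opY M))
    refine h.congr_fun fun p => ?_
    rw [mul_smul_comm, smul_mul_assoc]
  have hm : ∀ m, HasSum (fun p => (M p - S p) *
      contourFun n f hf m m (resY S * unitY p * resY M))
      (contourFun n f hf m m (resY M - resY S)) := fun m => by
    refine ((contourFun n f hf m m).hasSum hPQ).congr_fun fun p => ?_
    simp
  have hsum : Summable fun q : (ℤ × ℤ) × ℤ => (M q.1 - S q.1) *
      contourFun n f hf q.2 q.2 (resY S * unitY q.1 * resY M) := by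
    have hb : ∀ p : ℤ × ℤ, HasSum (fun m => ‖M p - S p‖ *
        (C * (((if m = p.2 then 2 else 0) + 8 * colSum M m) * 4)))
        (‖M p - S p‖ * (C * ((2 + 8 * ∑' p, ‖M p‖) * 4))) := fun p =>
      (((hM.hasSum_entry_bound p.2).mul_right 4).mul_left C).mul_left _
    have hs2 : Summable fun q : (ℤ × ℤ) × ℤ => ‖M q.1 - S q.1‖ *
        (C * (((if q.2 = q.1.2 then 2 else 0) + 8 * colSum M q.2) * 4)) := by
      refine (summable_prod_of_nonneg fun q => ?_).2 ⟨fun p => (hb p).summable, ?_⟩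
      · have h0 : 0 ≤ (if q.2 = q.1.2 then 2 else 0) + 8 * colSum M q.2 :=
          (norm_nonneg _).trans (hM.norm_resY_entry_le (0, 0) q.1.2 q.2)
        simp only [Pi.zero_apply]
        positivity
      · simp only [(hb _).tsum_eq]
        exact hMS.mul_right _
    refine Summable.of_norm_bounded hs2 fun q => ?_
    rw [norm_mul]
    exact mul_le_mul_of_nonneg_left (norm_contourFun_conj_le hf hM hS hC q.1 q.2) (norm_nonneg _)
  have h1 := hsum.hasSum.prod_fiberwise fun p =>
    (hasSum_contourFun_conj hf hM hS p).mul_left (M p - S p)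
  rw [h1.tsum_eq]
  have h2 := (Equiv.prodComm ℤ (ℤ × ℤ)).hasSum_iff.2 hsum.hasSum
  exact h2.prod_fiberwise fun m => hm m

end SmallHerm

end

/-! ### The trace formula on a disc -/

section

variable {M : ℤ × ℤ → ℂ}

/-- The value `f μ` if `|μ - n| < 1/2`, and `0` otherwise. -/
def discVal (n : ℕ) (f : ℂ → ℂ) (μ : ℝ) : ℂ := if |μ - n| < 1 / 2 then f μ else 0

theorem exists_circPt_eq {n : ℕ} {μ : ℝ} (h : |μ - n| = 1 / 2) : ∃ t : ℝ, circPt (n, t) = μ := by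
  rcases (abs_eq (by norm_num)).1 h with h | h
  · refine ⟨0, ?_⟩
    have : (μ : ℂ) = n + (1 / 2 : ℝ) := by rw [← h]; push_cast; ring
    rw [this]
    simp [circPt, circleMap]
  · refine ⟨π, ?_⟩
    have : (μ : ℂ) = n - (1 / 2 : ℝ) := by
      have h2 : μ = n - 1 / 2 := by linarith
      rw [h2]; push_cast; ring
    rw [this]
    simp [circPt, circleMap]
    ring

theorem ofReal_sub_natCast_norm (μ : ℝ) (n : ℕ) : ‖(μ : ℂ) - n‖ = |μ - n| := by
  rw [← Complex.ofReal_natCast, ← Complex.ofReal_sub, Complex.norm_real, Real.norm_eq_abs]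

namespace SmallHerm

section

variable {n : ℕ} {f : ℂ → ℂ}

/-- On an eigenvector the contour integral of the resolvent is a scalar Cauchy integral. An
eigenvalue `μ` on the circle itself is impossible, since `(λ - μ) P(λ) w = w` there. -/
theorem contourOp_of_mem_eigM (hM : SmallHerm M)
    (hf : ∀ z ∈ Metric.closedBall (n : ℂ) (1 / 2), DifferentiableAt ℂ f z) {μ : ℝ} {w : HZ}
    (hw : w ∈ eigM M μ) : contourOp n f (resY M) w = discVal n f μ • w := by
  by_cases h0 : w = 0
  · rw [h0, map_zero, smul_zero]
  have hne : ∀ t : ℝ, circPt (n, t) - μ ≠ 0 := fun t h => by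
    have h1 := hM.perturb_apply_of_mem_eigM hw (n, t)
    rw [h, zero_smul] at h1
    exact h0 h1.symm
  have h1 : ∀ t : ℝ, evalY (n, t) (resY M) w = (circPt (n, t) - μ)⁻¹ • w := fun t => by
    rw [eq_inv_smul_iff₀ (hne t)]
    exact hM.perturb_apply_of_mem_eigM hw (n, t)
  have hcont : Continuous fun t : ℝ => (circPt (n, t) - μ)⁻¹ :=
    Continuous.inv₀ ((continuous_circPt.comp (by fun_prop)).sub continuous_const) hne
  have hfc := continuous_comp_circPt hf
  have h2 := (ContinuousLinearMap.toSpanSingleton ℂ w).map_circAvg hfc hcont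
  rw [contourOp_apply hfc]
  simp only [h1]
  simp only [ContinuousLinearMap.toSpanSingleton_apply] at h2
  rw [← h2]
  congr 1
  rw [discVal]
  split_ifs with h
  · exact circAvg_inv_of_mem hf (by rwa [mem_ball_iff_norm, ofReal_sub_natCast_norm])
  · refine circAvg_inv_of_notMem hf fun h3 => ?_
    rw [mem_closedBall_iff_norm, ofReal_sub_natCast_norm] at h3
    obtain ⟨t, ht⟩ := exists_circPt_eq (le_antisymm h3 (not_lt.1 h))
    exact hne t (by rw [ht, sub_self])

theorem hasSum_discVal_mul (hM : SmallHerm M)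
    (hf : ∀ z ∈ Metric.closedBall (n : ℂ) (1 / 2), DifferentiableAt ℂ f z) (m : ℤ) :
    HasSum (fun μ => discVal n f μ * ((‖hM.eigProj μ (ez m)‖ ^ 2 : ℝ) : ℂ))
      (contourFun n f (continuous_comp_circPt hf) m m (resY M)) := by
  have h1 := ((coordCLM m).comp (contourOp n f (resY M))).hasSum (hM.hasSum_eigProj (ez m))
  rw [ContinuousLinearMap.comp_apply, coordCLM_apply, ← contourFun_eq_contourOp] at h1
  refine h1.congr_fun fun μ => ?_
  rw [ContinuousLinearMap.comp_apply, hM.contourOp_of_mem_eigM hf (hM.eigProj_mem μ _), map_smul,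
    coordCLM, innerSL_apply_apply, hM.inner_eigProj_self, smul_eq_mul]

end

theorem touches_left {n : ℕ} {i j : ℤ} (h : i.natAbs = n) : Touches n (i, j) := Or.inl h

theorem touches_right {n : ℕ} {i j : ℤ} (h : j.natAbs = n) : Touches n (i, j) := Or.inr h

theorem opMat_cutMat_apply_eq_zero (hM : SmallHerm M) {n : ℕ} {i : ℤ} (h : i.natAbs = n) (v : HZ) :
    opMat (_root_.cutMat n M) v i = 0 := by
  refine (opMat_apply (hM.cutMat n).summable v i).unique ?_
  simp [_root_.cutMat, touches_left h]

theorem opMat_cutMat_ez (hM : SmallHerm M) {n : ℕ} {i : ℤ} (h : i.natAbs = n) :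
    opMat (_root_.cutMat n M) (ez i) = 0 := by
  ext j
  rw [opMat_ez (hM.cutMat n).summable, _root_.cutMat, if_pos (touches_right h)]
  rfl

theorem ez_mem_eigM_cutMat (hM : SmallHerm M) {n : ℕ} {i : ℤ} (h : i.natAbs = n) :
    ez i ∈ eigM (_root_.cutMat n M) n := fun j => by
  rw [hM.opMat_cutMat_ez h, ez_apply]
  by_cases hj : j = i
  · rw [hj, h]; simp
  · simp [hj]

/-- Once the rows and columns of level `n` are cut, the eigenvectors with eigenvalue near `n` live
on level `n`. -/
theorem apply_eq_zero_of_mem_eigM_cutMat (hM : SmallHerm M) {n : ℕ} {μ : ℝ} (hμ : |μ - n| < 1 / 2)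
    {w : HZ} (hw : w ∈ eigM (_root_.cutMat n M) μ) {m : ℤ} (hm : m.natAbs ≠ n) : w m = 0 := by
  set s : Finset ℤ := {(n : ℤ), -(n : ℤ)} with hs
  have hmem : ∀ i : ℤ, i ∈ s ↔ i.natAbs = n := fun i => by
    simp only [hs, Finset.mem_insert, Finset.mem_singleton]
    omega
  set w' : HZ := w - ∑ i ∈ s, w i • ez i with hw'
  have hc : ∀ i, w' i = if i ∈ s then 0 else w i := by
    intro i
    have : (∑ j ∈ s, w j • ez j) i = ∑ j ∈ s, w j * ez j i := by
      rw [← coordCLM_apply, map_sum]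
      refine Finset.sum_congr rfl fun j _ => ?_
      rw [map_smul, coordCLM_apply, smul_eq_mul]
    rw [hw', lp.coeFn_sub, Pi.sub_apply, this]
    simp only [ez_apply, mul_ite, mul_one, mul_zero, Finset.sum_ite_eq]
    split_ifs <;> simp
  have hop : opMat (_root_.cutMat n M) w' = opMat (_root_.cutMat n M) w := by
    rw [hw', map_sub, map_sum, Finset.sum_eq_zero, sub_zero]
    intro i hi
    rw [map_smul, hM.opMat_cutMat_ez ((hmem i).1 hi), smul_zero]
  have h1 : w' ∈ eigM (_root_.cutMat n M) μ := fun i => by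
    rw [hop, hc]
    split_ifs with hi
    · rw [hM.opMat_cutMat_apply_eq_zero ((hmem i).1 hi)]
      simp
    · exact hw i
  have h2 : w' = 0 := (hM.cutMat n).eq_zero_of_mem_eigM h1 fun i hi => by
    rw [hc] at hi
    have hin : i.natAbs ≠ n := fun h => hi (if_pos ((hmem i).2 h))
    have h3 : (1 : ℝ) ≤ |(n : ℝ) - i.natAbs| := by
      have h4 : ((n : ℤ) - i.natAbs) ≠ 0 := by omega
      exact_mod_cast Int.one_le_abs h4
    have h5 := abs_sub_abs_le_abs_sub ((n : ℝ) - i.natAbs) ((n : ℝ) - μ)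
    rw [abs_sub_comm (n : ℝ) μ] at h5
    have h6 : ((n : ℝ) - i.natAbs) - (n - μ) = μ - i.natAbs := by ring
    rw [h6] at h5
    linarith
  have h3 := hc m
  rw [h2, if_neg fun h => hm ((hmem m).1 h)] at h3
  exact h3.symm

theorem contourFun_cutMat (hM : SmallHerm M) {n : ℕ} {f : ℂ → ℂ}
    (hf : ∀ z ∈ Metric.closedBall (n : ℂ) (1 / 2), DifferentiableAt ℂ f z) (m : ℤ) :
    contourFun n f (continuous_comp_circPt hf) m m (resY (_root_.cutMat n M)) =
      if m.natAbs = n then f n else 0 := by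
  split_ifs with h
  · rw [contourFun_eq_contourOp, (hM.cutMat n).contourOp_of_mem_eigM hf (hM.ez_mem_eigM_cutMat h)]
    simp [discVal, ez_apply]
  · refine ((hM.cutMat n).hasSum_discVal_mul hf m).unique ?_
    refine hasSum_zero.congr_fun fun μ => ?_
    rw [discVal]
    split_ifs with hμ
    · rw [← (hM.cutMat n).inner_eigProj_self, inner_ez,
        hM.apply_eq_zero_of_mem_eigM_cutMat hμ ((hM.cutMat n).eigProj_mem μ _) h, mul_zero]
    · rw [zero_mul]

/-- The product of the resolvents of `Λ + M` and of `Λ + cutMat n M` on the circle about `n`. -/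
def _root_.pairY (M : ℤ × ℤ → ℂ) : YZ := resY M * perturb DY (cutY M)

/-- The contribution of the circle about `n` to the perturbation of `∑ f`. -/
def _root_.circTerm (M : ℤ × ℤ → ℂ) (n : ℕ) (f : ℂ → ℂ)
    (hf : Continuous fun t : ℝ => f (circPt (n, t))) : ℂ :=
  ∑' p, (if Touches n p then M p else 0) * contourFun n f hf p.1 p.2 (pairY M)

theorem hasSum_level {n : ℕ} (hn : n ≠ 0) (c : ℂ) :
    HasSum (fun m : ℤ => if m.natAbs = n then c else 0) (2 * c) := by
  have h := hasSum_sum_of_ne_finset_zero (L := .unconditional ℤ)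
    (s := ({(n : ℤ), -(n : ℤ)} : Finset ℤ))
    (f := fun m : ℤ => if m.natAbs = n then c else 0) fun m hm => if_neg fun h => hm (by
      simp only [Finset.mem_insert, Finset.mem_singleton]; omega)
  rw [Finset.sum_pair (by omega)] at h
  simpa [two_mul] using h

/-- The trace of `(2πi)⁻¹ ∮ f(λ) (λ - Λ - M)⁻¹ dλ`: the cut matrix leaves the two eigenvectors
`e_{±n}` untouched and contributes `2 f(n)`, the rest is the trace of a difference of resolvents. -/
theorem hasSum_contourFun_diag (hM : SmallHerm M) {n : ℕ} (hn : n ≠ 0) {f : ℂ → ℂ}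
    (hf : ∀ z ∈ Metric.closedBall (n : ℂ) (1 / 2), DifferentiableAt ℂ f z) :
    HasSum (fun m => contourFun n f (continuous_comp_circPt hf) m m (resY M))
      (2 * f n + circTerm M n f (continuous_comp_circPt hf)) := by
  have h1 := hasSum_contourFun_sub (continuous_comp_circPt hf) hM (hM.cutMat n)
  have h2 := (hasSum_level hn (f n)).add h1
  have h3 : (∑' p, (M p - _root_.cutMat n M p) * contourFun n f (continuous_comp_circPt hf) p.1 p.2
      (resY M * resY (_root_.cutMat n M))) = circTerm M n f (continuous_comp_circPt hf) := by
    refine tsum_congr fun p => ?_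
    congr 1
    · rw [_root_.cutMat]
      split_ifs <;> simp
    · simp only [contourFun_apply, pairY, evalY_mul, hM.evalY_perturb_cutY]
  rw [h3] at h2
  refine h2.congr_fun fun m => ?_
  rw [map_sub, hM.contourFun_cutMat hf, add_sub_cancel]

/-- Fubini for an absolutely convergent double series, with named row and column sums. -/
theorem _root_.HasSum.swap_fiberwise {α β : Type*} {F : α × β → ℂ} (hF : Summable F) {g : α → ℂ}
    (hg : ∀ a, HasSum (fun b => F (a, b)) (g a)) {h : β → ℂ}
    (hh : ∀ b, HasSum (fun a => F (a, b)) (h b)) {c : ℂ} (hc : HasSum g c) : HasSum h c := by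
  have h1 : HasSum g (∑' q, F q) := hF.hasSum.prod_fiberwise hg
  rw [hc.unique h1]
  have h2 : HasSum (fun q : β × α => F q.swap) (∑' q, F q) :=
    (Equiv.prodComm β α).hasSum_iff.2 hF.hasSum
  exact h2.prod_fiberwise hh

/-- The diagonal entries of the spectral projections of the disc `|λ - n| < 1/2`. -/
def discWeight (hM : SmallHerm M) (n : ℕ) (q : ℤ × ℝ) : ℝ :=
  if |q.2 - n| < 1 / 2 then ‖hM.eigProj q.2 (ez q.1)‖ ^ 2 else 0

theorem discWeight_nonneg (hM : SmallHerm M) (n : ℕ) (q : ℤ × ℝ) : 0 ≤ hM.discWeight n q := by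
  unfold discWeight
  split_ifs <;> positivity

theorem hasSum_discWeight (hM : SmallHerm M) (n : ℕ) (m : ℤ) :
    HasSum (fun μ => hM.discWeight n (m, μ))
      (contourFun n (fun _ => 1) continuous_const m m (resY M)).re := by
  have h := Complex.hasSum_re (hM.hasSum_discVal_mul (n := n) (f := fun _ => 1)
    (fun z _ => differentiableAt_const 1) m)
  refine h.congr_fun fun μ => ?_
  simp only [discVal, discWeight]
  split_ifs
  · rw [one_mul, Complex.ofReal_re]
  · simp

theorem summable_discWeight (hM : SmallHerm M) {n : ℕ} (hn : n ≠ 0) :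
    Summable (hM.discWeight n) := by
  refine (summable_prod_of_nonneg (hM.discWeight_nonneg n)).2
    ⟨fun m => (hM.hasSum_discWeight n m).summable, ?_⟩
  simp only [(hM.hasSum_discWeight n _).tsum_eq]
  exact (Complex.hasSum_re (hM.hasSum_contourFun_diag hn (f := fun _ => 1)
    fun z _ => differentiableAt_const 1)).summable

/-- Absolute convergence of the double sum over basis vectors and eigenvalues. For `f = 1` the
terms are nonnegative, so that convergence follows from that of the iterated sum. -/
theorem summable_discVal_mul (hM : SmallHerm M) {n : ℕ} (hn : n ≠ 0) {f : ℂ → ℂ}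
    (hf : ∀ z ∈ Metric.closedBall (n : ℂ) (1 / 2), DifferentiableAt ℂ f z) :
    Summable fun q : ℤ × ℝ => discVal n f q.2 * ((‖hM.eigProj q.2 (ez q.1)‖ ^ 2 : ℝ) : ℂ) := by
  obtain ⟨C, hC⟩ : ∃ C, ∀ z ∈ Metric.closedBall (n : ℂ) (1 / 2), ‖f z‖ ≤ C :=
    (isCompact_closedBall _ _).exists_bound_of_continuousOn fun z hz =>
      (hf z hz).continuousAt.continuousWithinAt
  refine Summable.of_norm_bounded ((hM.summable_discWeight hn).mul_left C) fun q => ?_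
  simp only [discVal, discWeight]
  split_ifs with h
  · rw [norm_mul, Complex.norm_real, Real.norm_of_nonneg (by positivity)]
    refine mul_le_mul_of_nonneg_right (hC _ ?_) (by positivity)
    rw [mem_closedBall_iff_norm, ofReal_sub_natCast_norm]
    exact h.le
  · simp

/-- The trace formula on the disc `|λ - n| < 1/2`. -/
theorem hasSum_discVal_finrank (hM : SmallHerm M) {n : ℕ} (hn : n ≠ 0) {f : ℂ → ℂ}
    (hf : ∀ z ∈ Metric.closedBall (n : ℂ) (1 / 2), DifferentiableAt ℂ f z) :
    HasSum (fun μ => discVal n f μ * (Module.finrank ℂ (eigM M μ) : ℂ))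
      (2 * f n + circTerm M n f (continuous_comp_circPt hf)) := by
  have h3 : ∀ μ, HasSum (fun m => discVal n f μ * ((‖hM.eigProj μ (ez m)‖ ^ 2 : ℝ) : ℂ))
      (discVal n f μ * (Module.finrank ℂ (eigM M μ) : ℂ)) := fun μ => by
    have h4 := Complex.hasSum_ofReal.2 (hM.hasSum_norm_eigProj μ)
    rw [Complex.ofReal_natCast] at h4
    exact h4.mul_left _
  have h5 := hM.hasSum_contourFun_diag hn hf
  have h6 := hM.hasSum_discVal_mul hf
  have h7 := hM.summable_discVal_mul hn hf
  exact HasSum.swap_fiberwise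
    (F := fun q : ℤ × ℝ => discVal n f q.2 * ((‖hM.eigProj q.2 (ez q.1)‖ ^ 2 : ℝ) : ℂ)) h7
    (g := fun m => contourFun n f (continuous_comp_circPt hf) m m (resY M)) h6
    (h := fun μ => discVal n f μ * (Module.finrank ℂ (eigM M μ) : ℂ)) h3
    (c := 2 * f n + circTerm M n f (continuous_comp_circPt hf)) h5

end SmallHerm

end

/-! ### The entire part of the zeta function of `Λ + M` -/

section

theorem mem_slitPlane_of_mem_closedBall {n : ℕ} (hn : n ≠ 0) {w : ℂ}
    (hw : w ∈ Metric.closedBall (n : ℂ) (1 / 2)) : w ∈ Complex.slitPlane := by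
  rw [mem_closedBall_iff_norm] at hw
  refine Or.inl ?_
  have h1 : |(w - n).re| ≤ 1 / 2 := (Complex.abs_re_le_norm _).trans hw
  have h2 : (1 : ℝ) ≤ n := by exact_mod_cast Nat.one_le_iff_ne_zero.2 hn
  rw [Complex.sub_re, Complex.natCast_re] at h1
  have := (abs_le.1 h1).1
  linarith

theorem differentiableAt_cpow_neg {n : ℕ} (hn : n ≠ 0) (z w : ℂ)
    (hw : w ∈ Metric.closedBall (n : ℂ) (1 / 2)) : DifferentiableAt ℂ (fun w => w ^ (-z)) w :=
  differentiableAt_id.cpow_const (mem_slitPlane_of_mem_closedBall hn hw)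

theorem continuous_cpow_circPt {n : ℕ} (hn : n ≠ 0) (z : ℂ) :
    Continuous fun t : ℝ => circPt (n, t) ^ (-z) :=
  continuous_comp_circPt (differentiableAt_cpow_neg hn z)

theorem circPt_mem_slitPlane {n : ℕ} (hn : n ≠ 0) (t : ℝ) : circPt (n, t) ∈ Complex.slitPlane :=
  mem_slitPlane_of_mem_closedBall hn (by rw [mem_closedBall_iff_norm, norm_circPt_sub])

theorem norm_circPt_cpow_le {n : ℕ} (hn : n ≠ 0) {z : ℂ} {K : ℕ} (hK : ‖z‖ ≤ K) (t : ℝ) :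
    ‖circPt (n, t) ^ (-z)‖ ≤ rexp (π * K) * (2 * n) ^ K := by
  have hne := Complex.slitPlane_ne_zero (circPt_mem_slitPlane hn t)
  have h1n : (1 : ℝ) ≤ n := by exact_mod_cast Nat.one_le_iff_ne_zero.2 hn
  have h1 := norm_circPt_sub n t
  have h2 : ‖circPt (n, t)‖ ≤ 2 * n := by
    have := norm_sub_norm_le (circPt (n, t)) n
    rw [h1, Complex.norm_natCast] at this
    linarith
  have h3 : 1 / 2 ≤ ‖circPt (n, t)‖ := by
    have := norm_sub_norm_le (n : ℂ) (circPt (n, t))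
    rw [norm_sub_rev, h1, Complex.norm_natCast] at this
    linarith
  have hpos : 0 < ‖circPt (n, t)‖ := by linarith
  rw [Complex.norm_cpow_of_ne_zero hne, div_eq_mul_inv, ← Real.exp_neg, mul_comm]
  refine mul_le_mul ?_ ?_ (by positivity) (by positivity)
  · rw [Real.exp_le_exp, Complex.neg_im, mul_neg, neg_neg]
    refine (le_abs_self _).trans ?_
    rw [abs_mul]
    exact mul_le_mul (Complex.abs_arg_le_pi _) ((Complex.abs_im_le_norm z).trans hK) (abs_nonneg _)
      Real.pi_pos.le
  · rw [← Real.rpow_natCast, Complex.neg_re]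
    have hre := abs_le.1 ((Complex.abs_re_le_norm z).trans hK)
    rcases le_total 0 z.re with h | h
    · rw [Real.rpow_neg hpos.le, ← Real.inv_rpow hpos.le]
      have h4 : ‖circPt (n, t)‖⁻¹ ≤ 2 * n := by
        have : ‖circPt (n, t)‖⁻¹ ≤ 2 := inv_le_of_inv_le₀ two_pos (by simpa using h3)
        linarith
      exact (Real.rpow_le_rpow (by positivity) h4 h).trans
        (Real.rpow_le_rpow_of_exponent_le (by linarith) hre.2)
    · exact (Real.rpow_le_rpow hpos.le h2 (by linarith)).trans
        (Real.rpow_le_rpow_of_exponent_le (by linarith) (by linarith))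

/-- The functional `K ↦ (2πi)⁻¹ ∮ λ^{-z} K(λ)_{ji} dλ` on the circle about `n ≥ 1`. -/
def zetaFun (z : ℂ) (n : ℕ) (i j : ℤ) : YZ →L[ℂ] ℂ :=
  if hn : n ≠ 0 then contourFun n (fun w => w ^ (-z)) (continuous_cpow_circPt hn z) i j else 0

theorem zetaFun_of_ne {n : ℕ} (hn : n ≠ 0) (z : ℂ) (i j : ℤ) : zetaFun z n i j =
    contourFun n (fun w => w ^ (-z)) (continuous_cpow_circPt hn z) i j := dif_pos hn

theorem norm_zetaFun_le {z : ℂ} {K : ℕ} (hK : ‖z‖ ≤ K) (n : ℕ) (i j : ℤ) :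
    ‖zetaFun z n i j‖ ≤ rexp (π * K) * (2 * n) ^ K := by
  by_cases hn : n ≠ 0
  · rw [zetaFun_of_ne hn]
    exact norm_contourFun_le _ (norm_circPt_cpow_le hn hK) i j
  · rw [zetaFun, dif_neg hn, norm_zero]
    positivity

theorem differentiable_circAvg_cpow {n : ℕ} (hn : n ≠ 0) {g : ℝ → ℂ} (hg : Continuous g) :
    Differentiable ℂ fun z : ℂ => circAvg n (fun w => w ^ (-z)) g := by
  intro z₀
  simp only [circAvg]
  suffices h : DifferentiableAt ℂ (fun z : ℂ => ∫ t in (0 : ℝ)..2 * π,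
      (deriv (circleMap n (1 / 2)) t * circPt (n, t) ^ (-z)) • g t) z₀ from
    h.const_smul (2 * π * Complex.I : ℂ)⁻¹
  have hlog : Continuous fun t : ℝ => Complex.log (circPt (n, t)) := by
    rw [continuous_iff_continuousAt]
    intro t
    have h2 : ContinuousAt (fun t : ℝ => circPt (n, t)) t := by
      have := continuous_circPt
      fun_prop
    exact h2.clog (circPt_mem_slitPlane hn t)
  have hder : Continuous fun t : ℝ => deriv (circleMap (n : ℂ) (1 / 2)) t := by
    simpa using continuous_circWeight (n := n) (f := fun _ => 1) continuous_const
  have hF : ∀ z : ℂ, Continuous fun t : ℝ =>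
      (deriv (circleMap n (1 / 2)) t * circPt (n, t) ^ (-z)) • g t := fun z =>
    (hder.mul (continuous_cpow_circPt hn z)).smul hg
  have hF' : ∀ z : ℂ, Continuous fun t : ℝ => (deriv (circleMap n (1 / 2)) t *
      (circPt (n, t) ^ (-z) * Complex.log (circPt (n, t)) * -1)) • g t := fun z =>
    (hder.mul (((continuous_cpow_circPt hn z).mul hlog).mul continuous_const)).smul hg
  -- A bound for the derivative on the ball of radius one about `z₀`.
  obtain ⟨K, hK⟩ := exists_nat_ge (‖z₀‖ + 1)
  obtain ⟨C, hC⟩ := isCompact_Icc (a := (0 : ℝ)) (b := 2 * π) |>.exists_bound_of_continuousOn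
    (((hder.norm.mul hlog.norm).mul hg.norm).continuousOn)
  refine (intervalIntegral.hasDerivAt_integral_of_dominated_loc_of_deriv_le
    (s := Metric.ball z₀ 1)
    (F := fun z t => (deriv (circleMap n (1 / 2)) t * circPt (n, t) ^ (-z)) • g t)
    (F' := fun z t => (deriv (circleMap n (1 / 2)) t *
      (circPt (n, t) ^ (-z) * Complex.log (circPt (n, t)) * -1)) • g t)
    (bound := fun _ => rexp (π * K) * (2 * n) ^ K * C)
    (Metric.ball_mem_nhds z₀ one_pos)
    (Eventually.of_forall fun z => (hF z).aestronglyMeasurable)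
    ((hF z₀).intervalIntegrable _ _) (hF' z₀).aestronglyMeasurable
    (Eventually.of_forall fun t ht z hz => ?_) intervalIntegrable_const
    (Eventually.of_forall fun t _ z _ => ?_)).2.differentiableAt
  · rw [uIoc_of_le Real.two_pi_pos.le] at ht
    have h1 : ‖deriv (circleMap (n : ℂ) (1 / 2)) t‖ * ‖Complex.log (circPt (n, t))‖ * ‖g t‖ ≤ C :=
      (le_abs_self _).trans (hC t (Ioc_subset_Icc_self ht))
    have hz' : ‖z‖ ≤ K := by
      have h2 : ‖z - z₀‖ < 1 := mem_ball_iff_norm.1 hz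
      have h3 := norm_sub_norm_le z z₀
      linarith
    have h2 := norm_circPt_cpow_le hn hz' t
    simp only [norm_smul, norm_mul, norm_neg, norm_one, mul_one]
    calc _ = ‖circPt (n, t) ^ (-z)‖ * (‖deriv (circleMap (n : ℂ) (1 / 2)) t‖ *
          ‖Complex.log (circPt (n, t))‖ * ‖g t‖) := by ring
      _ ≤ _ := mul_le_mul h2 h1 (by positivity) (by positivity)
  · have hne := Complex.slitPlane_ne_zero (circPt_mem_slitPlane hn t)
    exact (((hasDerivAt_neg z).const_cpow (Or.inl hne)).const_mul _).smul_const _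

theorem differentiable_zetaFun (n : ℕ) (i j : ℤ) (K : YZ) :
    Differentiable ℂ fun z => zetaFun z n i j K := by
  by_cases hn : n ≠ 0
  · simp only [zetaFun_of_ne hn, contourFun_apply]
    exact differentiable_circAvg_cpow hn (SmallHerm.continuous_evalY_entry n K i j)
  · simp only [zetaFun, dif_neg hn]
    exact differentiable_const _

/-- The levels of the row and of the column of a matrix position. -/
def levels (p : ℤ × ℤ) : Finset ℕ := {p.1.natAbs, p.2.natAbs}

theorem mem_levels {p : ℤ × ℤ} {n : ℕ} : n ∈ levels p ↔ Touches n p := by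
  simp [levels, Touches, eq_comm]

theorem card_levels_le (p : ℤ × ℤ) : (levels p).card ≤ 2 := Finset.card_le_two

/-- The sum of `zetaFun` over the circles that a matrix position touches. -/
def levelFun (z : ℂ) (p : ℤ × ℤ) : YZ →L[ℂ] ℂ := ∑ n ∈ levels p, zetaFun z n p.1 p.2

/-- The polynomial weight `(1 + |i|)(1 + |j|)`. -/
def posWeight (p : ℤ × ℤ) : ℝ := (1 + |(p.1 : ℝ)|) * (1 + |(p.2 : ℝ)|)

theorem one_le_posWeight (p : ℤ × ℤ) : 1 ≤ posWeight p := by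
  have h1 := abs_nonneg (p.1 : ℝ)
  have h2 := abs_nonneg (p.2 : ℝ)
  unfold posWeight
  nlinarith [mul_nonneg h1 h2]

theorem le_posWeight_of_mem_levels {p : ℤ × ℤ} {n : ℕ} (h : n ∈ levels p) :
    (n : ℝ) ≤ posWeight p := by
  have h1 := abs_nonneg (p.1 : ℝ)
  have h2 := abs_nonneg (p.2 : ℝ)
  unfold posWeight
  rcases mem_levels.1 h with h | h
  · rw [← h, Nat.cast_natAbs, Int.cast_abs]
    nlinarith [mul_nonneg h1 h2]
  · rw [← h, Nat.cast_natAbs, Int.cast_abs]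
    nlinarith [mul_nonneg h1 h2]

theorem norm_zetaFun_le_posWeight {z : ℂ} {K : ℕ} (hK : ‖z‖ ≤ K) {p : ℤ × ℤ} {n : ℕ}
    (h : n ∈ levels p) (i j : ℤ) :
    ‖zetaFun z n i j‖ ≤ rexp (π * K) * 2 ^ K * posWeight p ^ K := by
  refine (norm_zetaFun_le hK n i j).trans ?_
  rw [mul_pow, ← mul_assoc]
  gcongr
  exact le_posWeight_of_mem_levels h

theorem sum_levels_norm_le {z : ℂ} {K : ℕ} (hK : ‖z‖ ≤ K) (p : ℤ × ℤ) :
    ∑ n ∈ levels p, ‖zetaFun z n p.1 p.2‖ ≤ 2 * (rexp (π * K) * 2 ^ K) * posWeight p ^ K := by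
  refine (Finset.sum_le_card_nsmul _ _ _ fun n hn => norm_zetaFun_le_posWeight hK hn _ _).trans ?_
  rw [nsmul_eq_mul, mul_assoc 2]
  have h0 : 0 ≤ posWeight p := zero_le_one.trans (one_le_posWeight p)
  refine mul_le_mul_of_nonneg_right ?_ (by positivity)
  exact_mod_cast card_levels_le p

theorem norm_levelFun_le {z : ℂ} {K : ℕ} (hK : ‖z‖ ≤ K) (p : ℤ × ℤ) :
    ‖levelFun z p‖ ≤ 2 * (rexp (π * K) * 2 ^ K) * posWeight p ^ K :=
  (norm_sum_le _ _).trans (sum_levels_norm_le hK p)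

/-- A matrix whose entries decrease faster than any power of the position. -/
def RapidMat (M : ℤ × ℤ → ℂ) : Prop := ∀ K : ℕ, Summable fun p => ‖M p‖ * posWeight p ^ K

variable {M : ℤ × ℤ → ℂ}

/-- The entire function `∑ μ^{-z} - 2 ζ(z)`, the sum over the positive eigenvalues of `Λ + M`. -/
def zetaPert (M : ℤ × ℤ → ℂ) (z : ℂ) : ℂ := ∑' p, M p * levelFun z p (pairY M)

theorem differentiable_zetaPert (hR : RapidMat M) : Differentiable ℂ (zetaPert M) := by
  intro z₀
  obtain ⟨K, hK⟩ := exists_nat_gt ‖z₀‖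
  have hs := ((hR K).mul_right (2 * (rexp (π * K) * 2 ^ K))).mul_right ‖pairY M‖
  have h := Complex.differentiableOn_tsum_of_summable_norm
    (F := fun (p : ℤ × ℤ) (z : ℂ) => M p * levelFun z p (pairY M)) (U := Metric.ball 0 K) hs
    (fun p => Differentiable.differentiableOn (by
      simp only [levelFun, sum_apply]
      exact (Differentiable.fun_sum fun n _ =>
        differentiable_zetaFun n p.1 p.2 (pairY M)).const_mul _))
    Metric.isOpen_ball fun p z hz => by
      have hz' : ‖z‖ ≤ K := (mem_ball_zero_iff.1 hz).le
      rw [norm_mul]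
      calc ‖M p‖ * ‖levelFun z p (pairY M)‖
          ≤ ‖M p‖ * (‖levelFun z p‖ * ‖pairY M‖) := by
            gcongr; exact ContinuousLinearMap.le_opNorm _ _
        _ ≤ ‖M p‖ * ((2 * (rexp (π * K) * 2 ^ K) * posWeight p ^ K) * ‖pairY M‖) := by
            gcongr; exact norm_levelFun_le hz' p
        _ = _ := by ring
  exact h.differentiableAt (Metric.isOpen_ball.mem_nhds (mem_ball_zero_iff.2 hK))

end

/-! ### The zeta function on the half-plane of convergence -/

section

variable {M : ℤ × ℤ → ℂ}

/-- The contribution of the circle about `n` to `zetaPert M z`. -/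
def zetaTerm (M : ℤ × ℤ → ℂ) (z : ℂ) (n : ℕ) : ℂ :=
  ∑' p, (if Touches n p then M p else 0) * zetaFun z n p.1 p.2 (pairY M)

theorem circTerm_eq_zetaTerm {n : ℕ} (hn : n ≠ 0) (z : ℂ) :
    circTerm M n (fun w => w ^ (-z)) (continuous_comp_circPt (differentiableAt_cpow_neg hn z)) =
      zetaTerm M z n := by
  simp only [circTerm, zetaTerm, zetaFun_of_ne hn]

/-- The sum over matrix positions that defines `zetaPert`, rearranged as a sum over circles. -/
theorem hasSum_zetaTerm (hR : RapidMat M) (z : ℂ) : HasSum (zetaTerm M z) (zetaPert M z) := by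
  obtain ⟨K, hK⟩ := exists_nat_ge ‖z‖
  set F : (ℤ × ℤ) × ℕ → ℂ := fun q =>
    (if Touches q.2 q.1 then M q.1 else 0) * zetaFun z q.2 q.1.1 q.1.2 (pairY M) with hF
  have hout : ∀ p : ℤ × ℤ, ∀ n ∉ levels p, F (p, n) = 0 := fun p n hn => by
    simp only [hF]
    rw [if_neg (mem_levels.not.1 hn), zero_mul]
  have hfin : ∀ p : ℤ × ℤ, HasSum (fun n => F (p, n)) (M p * levelFun z p (pairY M)) := fun p => by
    have h := hasSum_sum_of_ne_finset_zero (L := .unconditional ℕ) (hout p)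
    rw [levelFun, sum_apply, Finset.mul_sum]
    convert h using 1
    exact Finset.sum_congr rfl fun n hn => by simp only [hF]; rw [if_pos (mem_levels.1 hn)]
  have hfin' : ∀ p : ℤ × ℤ, HasSum (fun n => ‖F (p, n)‖) (∑ n ∈ levels p, ‖F (p, n)‖) := fun p =>
    hasSum_sum_of_ne_finset_zero fun n hn => by rw [hout p n hn, norm_zero]
  have hsum : Summable F := by
    refine Summable.of_norm ((summable_prod_of_nonneg fun _ => norm_nonneg _).2
      ⟨fun p => (hfin' p).summable, ?_⟩)
    simp only [(hfin' _).tsum_eq]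
    refine Summable.of_nonneg_of_le (fun p => Finset.sum_nonneg fun _ _ => norm_nonneg _)
      (fun p => ?_) (((hR K).mul_right (2 * (rexp (π * K) * 2 ^ K))).mul_right ‖pairY M‖)
    calc ∑ n ∈ levels p, ‖F (p, n)‖
        ≤ ∑ n ∈ levels p, ‖M p‖ * (‖zetaFun z n p.1 p.2‖ * ‖pairY M‖) := by
          refine Finset.sum_le_sum fun n _ => ?_
          simp only [hF]
          rw [norm_mul]
          refine mul_le_mul ?_ (ContinuousLinearMap.le_opNorm _ _) (norm_nonneg _) (norm_nonneg _)
          split_ifs <;> simp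
      _ = ‖M p‖ * (∑ n ∈ levels p, ‖zetaFun z n p.1 p.2‖) * ‖pairY M‖ := by
          rw [Finset.mul_sum, Finset.sum_mul]
          exact Finset.sum_congr rfl fun _ _ => by ring
      _ ≤ ‖M p‖ * (2 * (rexp (π * K) * 2 ^ K) * posWeight p ^ K) * ‖pairY M‖ := by
          gcongr
          exact sum_levels_norm_le hK p
      _ = _ := by ring
  have h1 : HasSum (fun p => M p * levelFun z p (pairY M)) (∑' q, F q) :=
    hsum.hasSum.prod_fiberwise hfin
  have hinj : ∀ n : ℕ, Function.Injective fun p : ℤ × ℤ => (p, n) := fun n a b h =>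
    (Prod.ext_iff.1 h).1
  have h3 : ∀ n, HasSum (fun p => F (p, n)) (zetaTerm M z n) := fun n =>
    (hsum.comp_injective (hinj n)).hasSum
  exact HasSum.swap_fiberwise (F := F) hsum (g := fun p => M p * levelFun z p (pairY M)) hfin
    (h := zetaTerm M z) h3 (c := zetaPert M z) h1.summable.hasSum

namespace SmallHerm

theorem norm_pairY_le (hM : SmallHerm M) : ‖pairY M‖ ≤ 16 := by
  refine (norm_mul_le _ _).trans ?_
  have := mul_le_mul hM.norm_resY_le (norm_perturb_le norm_DY_le hM.norm_cutY_le) (norm_nonneg _)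
    (by norm_num)
  linarith

/-- There are at most six eigenvalues in the disc `|λ - n| < 1/2`. -/
theorem exists_hasSum_disc_finrank (hM : SmallHerm M) {n : ℕ} (hn : n ≠ 0) :
    ∃ c ≤ 6, HasSum (fun μ : ℝ => if |μ - n| < 1 / 2 then (Module.finrank ℂ (eigM M μ) : ℝ) else 0)
      c := by
  have h := hM.hasSum_discVal_finrank hn (f := fun _ => 1) fun _ _ => differentiableAt_const 1
  refine ⟨_, ?_, (Complex.hasSum_re h).congr_fun fun μ => ?_⟩
  · refine (Complex.re_le_norm _).trans ((norm_add_le _ _).trans ?_)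
    have h1 : ‖circTerm M n (fun _ => 1) continuous_const‖ ≤ (∑' p, ‖M p‖) * 16 := by
      refine tsum_of_norm_bounded (hM.summable.hasSum.mul_right 16) fun p => ?_
      rw [norm_mul]
      refine mul_le_mul (by split_ifs <;> simp) ?_ (norm_nonneg _) (norm_nonneg _)
      refine (ContinuousLinearMap.le_opNorm _ _).trans ?_
      have h2 := norm_contourFun_le (n := n) (f := fun _ => 1) continuous_const (C := 1)
        (fun t => by simp) p.1 p.2
      have := mul_le_mul h2 hM.norm_pairY_le (norm_nonneg _) zero_le_one
      linarith
    have h2 : ‖(2 * 1 : ℂ)‖ = 2 := by simp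
    rw [h2]
    have := hM.small
    linarith
  · rw [discVal]
    split_ifs <;> simp

/-- If row zero of `M` vanishes, then every positive eigenvalue lies near a positive integer. -/
theorem eigM_eq_bot_of_pos (hM : SmallHerm M) (h0 : ∀ j, M (0, j) = 0) {μ : ℝ} (hμ : 0 < μ)
    (h : ∀ n : ℕ, n ≠ 0 → 1 / 2 ≤ |μ - n|) : eigM M μ = ⊥ := by
  refine (Submodule.eq_bot_iff _).2 fun w hw => hM.eq_zero_of_mem_eigM hw fun i hi => ?_
  refine h _ fun h1 => hi ?_
  rw [Int.natAbs_eq_zero] at h1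
  subst h1
  have h2 := hw 0
  have h3 : opMat M w 0 = 0 := (opMat_apply hM.summable w 0).unique (by simp [h0, hasSum_zero])
  rw [h3] at h2
  have h4 : (μ : ℂ) ≠ 0 := by exact_mod_cast hμ.ne'
  simpa [h4] using h2

theorem norm_discVal_cpow_le {n : ℕ} (hn : n ≠ 0) {z : ℂ} (hz : 0 ≤ z.re) (μ : ℝ) :
    ‖discVal n (fun w => w ^ (-z)) μ‖ ≤
      (if |μ - n| < 1 / 2 then 1 else 0) * (2 ^ z.re * (n : ℝ) ^ (-z.re)) := by
  have h1n : (1 : ℝ) ≤ n := by exact_mod_cast Nat.one_le_iff_ne_zero.2 hn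
  rw [discVal]
  split_ifs with h
  · have h1 := (abs_lt.1 h).1
    have hpos : 0 < μ := by linarith
    rw [one_mul, Complex.norm_cpow_eq_rpow_re_of_pos hpos, Complex.neg_re, Real.rpow_neg hpos.le,
      Real.rpow_neg (by positivity), ← Real.inv_rpow hpos.le, ← Real.inv_rpow (by positivity),
      ← Real.mul_rpow zero_le_two (by positivity)]
    refine Real.rpow_le_rpow (by positivity) ?_ hz
    rw [← div_eq_mul_inv, inv_le_comm₀ hpos (by positivity), inv_div]
    linarith
  · simp

theorem hasSum_two_mul_zeta {z : ℂ} (hz : 1 < z.re) :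
    HasSum (fun n : ℕ => if n ≠ 0 then 2 * (n : ℂ) ^ (-z) else 0) (2 * riemannZeta z) := by
  rw [zeta_eq_tsum_one_div_nat_cpow hz]
  refine ((Complex.summable_one_div_nat_cpow.2 hz).hasSum.mul_left 2).congr_fun fun n => ?_
  have hz0 : z ≠ 0 := by
    rintro rfl
    simp at hz
    linarith
  split_ifs with hn
  · rw [Complex.cpow_neg, one_div]
  · rw [not_not.1 hn]
    simp [Complex.zero_cpow hz0]

/-- The zeta function of `Λ + M` on the half-plane of convergence. -/
theorem hasSum_finrank_cpow (hM : SmallHerm M) (hR : RapidMat M) (h0 : ∀ j, M (0, j) = 0) {z : ℂ}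
    (hz : 1 < z.re) :
    HasSum (fun μ : Ioi (0 : ℝ) => (Module.finrank ℂ (eigM M μ) : ℂ) * ((μ : ℝ) : ℂ) ^ (-z))
      (2 * riemannZeta z + zetaPert M z) := by
  have hzr : 0 ≤ z.re := by linarith
  set F : ℕ × ℝ → ℂ := fun q => if q.1 ≠ 0 then
    discVal q.1 (fun w => w ^ (-z)) q.2 * (Module.finrank ℂ (eigM M q.2) : ℂ) else 0 with hF
  have hrow : ∀ n, HasSum (fun μ => F (n, μ))
      ((if n ≠ 0 then 2 * (n : ℂ) ^ (-z) else 0) + zetaTerm M z n) := fun n => by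
    simp only [hF]
    by_cases hn : n ≠ 0
    · simp only [if_pos hn]
      rw [← circTerm_eq_zetaTerm hn]
      exact hM.hasSum_discVal_finrank hn (differentiableAt_cpow_neg hn z)
    · simp only [if_neg hn]
      simp [zetaTerm, zetaFun, hn]
  -- Each disc holds at most six eigenvalues, all of size at least `n / 2`.
  have hsum : Summable F := by
    choose! c hc6 hc using fun n (hn : n ≠ 0) => hM.exists_hasSum_disc_finrank (n := n) hn
    set G : ℕ × ℝ → ℝ := fun q => if q.1 ≠ 0 then
      (if |q.2 - q.1| < 1 / 2 then (Module.finrank ℂ (eigM M q.2) : ℝ) else 0) *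
        (2 ^ z.re * (q.1 : ℝ) ^ (-z.re)) else 0 with hG
    have hGrow : ∀ n, HasSum (fun μ => G (n, μ))
        (if n ≠ 0 then c n * (2 ^ z.re * (n : ℝ) ^ (-z.re)) else 0) := fun n => by
      simp only [hG]
      split_ifs with hn
      · exact (hc n hn).mul_right _
      · exact hasSum_zero
    have hG0 : ∀ q, 0 ≤ G q := fun q => by
      simp only [hG]
      split_ifs <;> positivity
    have hGs : Summable G := by
      refine (summable_prod_of_nonneg hG0).2 ⟨fun n => (hGrow n).summable, ?_⟩
      refine Summable.of_nonneg_of_le (fun n => tsum_nonneg fun μ => hG0 (n, μ)) (fun n => ?_)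
        ((Real.summable_nat_rpow.2 (by linarith : -z.re < -1)).mul_left (6 * 2 ^ z.re))
      rw [(hGrow n).tsum_eq]
      split_ifs with hn
      · rw [mul_assoc]
        exact mul_le_mul_of_nonneg_right (hc6 n hn) (by positivity)
      · positivity
    refine Summable.of_norm_bounded hGs fun q => ?_
    simp only [hF, hG]
    by_cases hn : q.1 ≠ 0
    · rw [if_pos hn, if_pos hn, norm_mul, Complex.norm_natCast]
      refine (mul_le_mul_of_nonneg_right (norm_discVal_cpow_le hn hzr q.2)
        (Nat.cast_nonneg _)).trans_eq ?_
      split_ifs <;> ring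
    · rw [if_neg hn, if_neg hn, norm_zero]
  -- The discs are disjoint and contain all the positive eigenvalues.
  have hcol : ∀ μ : ℝ, HasSum (fun n => F (n, μ)) ((Ioi (0 : ℝ)).indicator
      (fun μ => (Module.finrank ℂ (eigM M μ) : ℂ) * (μ : ℂ) ^ (-z)) μ) := fun μ => by
    simp only [hF]
    by_cases hμ : ∃ n : ℕ, n ≠ 0 ∧ |μ - n| < 1 / 2
    · obtain ⟨n, hn, h⟩ := hμ
      have h1n : (1 : ℝ) ≤ n := by exact_mod_cast Nat.one_le_iff_ne_zero.2 hn
      have hpos : 0 < μ := by linarith [(abs_lt.1 h).1]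
      rw [indicator_of_mem (mem_Ioi.2 hpos)]
      have h2 := hasSum_single (L := .unconditional ℕ) (f := fun k : ℕ => if k ≠ 0 then
        discVal k (fun w => w ^ (-z)) μ * (Module.finrank ℂ (eigM M μ) : ℂ) else 0) n fun k hk => by
          have hnk : ¬ |μ - k| < 1 / 2 := fun h3 => by
            have h4 : |((n : ℤ) - (k : ℤ) : ℤ)| < 1 := by
              have h5 : |(n : ℝ) - k| < 1 := by
                rw [abs_lt] at h h3 ⊢
                constructor <;> linarith
              exact_mod_cast h5
            have h5 := Int.abs_lt_one_iff.1 h4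
            exact hk (by omega)
          simp only [discVal, if_neg hnk, zero_mul, ite_self]
      simp only [if_pos hn] at h2
      rw [discVal, if_pos h, mul_comm] at h2
      exact h2
    · push Not at hμ
      have h1 : ∀ n : ℕ, (if n ≠ 0 then discVal n (fun w => w ^ (-z)) μ *
          (Module.finrank ℂ (eigM M μ) : ℂ) else 0) = 0 := fun n => by
        split_ifs with hn
        · rw [discVal, if_neg (not_lt.2 (hμ n hn)), zero_mul]
        · rfl
      simp only [h1]
      have h2 : (Ioi (0 : ℝ)).indicator
          (fun μ => (Module.finrank ℂ (eigM M μ) : ℂ) * (μ : ℂ) ^ (-z)) μ = 0 := by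
        by_cases hpos : 0 < μ
        · rw [indicator_of_mem (mem_Ioi.2 hpos), hM.eigM_eq_bot_of_pos h0 hpos hμ]
          simp
        · rw [indicator_of_notMem (by simpa using hpos)]
      rw [h2]
      exact hasSum_zero
  have h1 := HasSum.swap_fiberwise hsum hrow hcol
    ((hasSum_two_mul_zeta hz).add (hasSum_zetaTerm hR z))
  exact hasSum_subtype_iff_indicator.2 h1

end SmallHerm

end

/-! ### Variation of the zeta function with the matrix -/

/-- A twice differentiable variation `R t` of the zero matrix, with first and second derivatives
`R₁ t` and `R₂ t`, all of which decrease rapidly, uniformly in `t`. -/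
structure MatVar (R R₁ R₂ : ℝ → ℤ × ℤ → ℂ) : Prop where
  zero : ∀ p, R 0 p = 0
  hasDerivAt : ∀ p t, HasDerivAt (fun t => R t p) (R₁ t p) t
  hasDerivAt₁ : ∀ p t, HasDerivAt (fun t => R₁ t p) (R₂ t p) t
  bound : ∀ K : ℕ, ∃ b : ℤ × ℤ → ℝ, Summable b ∧ ∀ t p, ‖R t p‖ * posWeight p ^ K ≤ b p ∧
    ‖R₁ t p‖ * posWeight p ^ K ≤ b p ∧ ‖R₂ t p‖ * posWeight p ^ K ≤ b p

namespace MatVar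

variable {R R₁ R₂ : ℝ → ℤ × ℤ → ℂ}

/-- Termwise differentiation of `∑ R t p • U p`, where `U` grows at most polynomially. -/
theorem hasDerivAt_tsum_smul (h : MatVar R R₁ R₂) {V : Type*} [NormedAddCommGroup V]
    [NormedSpace ℂ V] [CompleteSpace V] {U : ℤ × ℤ → V} {C : ℝ} {K : ℕ}
    (hU : ∀ p, ‖U p‖ ≤ C * posWeight p ^ K) :
    (∀ t, HasDerivAt (fun t => ∑' p, R t p • U p) (∑' p, R₁ t p • U p) t) ∧
      ∀ t, HasDerivAt (fun t => ∑' p, R₁ t p • U p) (∑' p, R₂ t p • U p) t := by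
  obtain ⟨b, hb, hbR⟩ := h.bound K
  have hC : 0 ≤ C := by
    have h1 := (norm_nonneg _).trans (hU 0)
    refine nonneg_of_mul_nonneg_left h1 (by have := one_le_posWeight 0; positivity)
  have key : ∀ (c : ℂ) (p : ℤ × ℤ), ‖c‖ * posWeight p ^ K ≤ b p → ‖c • U p‖ ≤ C * b p := by
    intro c p hc
    rw [norm_smul]
    calc ‖c‖ * ‖U p‖ ≤ ‖c‖ * (C * posWeight p ^ K) := by gcongr; exact hU p
      _ = C * (‖c‖ * posWeight p ^ K) := by ring
      _ ≤ C * b p := by gcongr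
  refine ⟨fun t => ?_, fun t => ?_⟩
  · exact hasDerivAt_tsum (y₀ := 0) (hb.mul_left C)
      (fun p t => (h.hasDerivAt p t).smul_const (U p))
      (fun p t => key _ _ (hbR t p).2.1)
      (Summable.of_norm_bounded (hb.mul_left C) fun p => key _ _ (hbR 0 p).1) t
  · exact hasDerivAt_tsum (y₀ := 0) (hb.mul_left C)
      (fun p t => (h.hasDerivAt₁ p t).smul_const (U p))
      (fun p t => key _ _ (hbR t p).2.2)
      (Summable.of_norm_bounded (hb.mul_left C) fun p => key _ _ (hbR 0 p).2.1) t

theorem summable_norm (h : MatVar R R₁ R₂) (t : ℝ) : Summable fun p => ‖R t p‖ := by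
  obtain ⟨b, hb, hbR⟩ := h.bound 0
  exact Summable.of_nonneg_of_le (fun _ => norm_nonneg _) (fun p => by simpa using (hbR t p).1) hb

theorem summable_norm₁ (h : MatVar R R₁ R₂) (t : ℝ) : Summable fun p => ‖R₁ t p‖ := by
  obtain ⟨b, hb, hbR⟩ := h.bound 0
  exact Summable.of_nonneg_of_le (fun _ => norm_nonneg _) (fun p => by simpa using (hbR t p).2.1) hb

theorem rapidMat (h : MatVar R R₁ R₂) (t : ℝ) : RapidMat (R t) := fun K => by
  obtain ⟨b, hb, hbR⟩ := h.bound K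
  refine Summable.of_nonneg_of_le (fun p => ?_) (fun p => (hbR t p).1) hb
  have := one_le_posWeight p
  positivity

/-- The entries are small in `ℓ¹` near `t = 0`. -/
theorem eventually_small (h : MatVar R R₁ R₂) : ∀ᶠ t in 𝓝 0, ∑' p, ‖R t p‖ ≤ 1 / 4 := by
  obtain ⟨b, hb, hbR⟩ := h.bound 0
  have hle : ∀ t, ∑' p, ‖R t p‖ ≤ (∑' p, b p) * |t| := fun t => by
    rw [← tsum_mul_right]
    refine (h.summable_norm t).tsum_le_tsum (fun p => ?_) (hb.mul_right _)
    have h1 := Convex.norm_image_sub_le_of_norm_hasDerivWithin_le (s := univ) (C := b p) (x := 0)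
      (y := t) (fun t _ => (h.hasDerivAt p t).hasDerivWithinAt)
      (fun t _ => by simpa using (hbR t p).2.1) convex_univ (mem_univ _) (mem_univ _)
    simpa [h.zero] using h1
  have hc : ContinuousAt (fun t : ℝ => (∑' p, b p) * |t|) 0 := by fun_prop
  have h2 := hc.eventually_le_const (u := 1 / 4) (by simp)
  exact h2.mono fun t ht => (hle t).trans ht

/-- The first two derivatives of the zeta function along a variation of the zero matrix. Here
`zetaPert (R t) z` is a functional that is linear in `R t`, applied to a product of two perturbed
resolvents, so that the second derivative only involves first derivatives of these resolvents. -/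
theorem hasDerivAt_zetaPert (h : MatVar R R₁ R₂) (z : ℂ) :
    (∀ᶠ t in 𝓝 0, DifferentiableAt ℝ (fun t => zetaPert (R t) z) t) ∧
    HasDerivAt (fun t => zetaPert (R t) z) (∑' p, R₁ 0 p * levelFun z p (DY * DY)) 0 ∧
    HasDerivAt (deriv fun t => zetaPert (R t) z)
      ((∑' p, R₂ 0 p * levelFun z p (DY * DY)) + 2 * ∑' p, R₁ 0 p * levelFun z p
        (DY * opY (R₁ 0) * DY * DY + DY * (DY * cutY (R₁ 0) * DY))) 0 := by
  obtain ⟨K, hK⟩ := exists_nat_ge ‖z‖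
  have hΨ := h.hasDerivAt_tsum_smul (norm_levelFun_le hK)
  have hr := h.hasDerivAt_tsum_smul (U := unitY) (C := 1) (K := 0)
    (by simpa using norm_unitY_le)
  have hs := h.hasDerivAt_tsum_smul (U := cutUnitY) (C := 1) (K := 0)
    (by simpa using norm_cutUnitY_le)
  have hmain := hasDerivAt_functional_perturb DY hΨ.1 hΨ.2 hr.1 hr.2 hs.1 hs.2
    (by
      simp only [h.zero]
      exact (tsum_congr fun p => zero_smul ℂ (levelFun z p)).trans tsum_zero)
    (by simp only [h.zero, zero_smul, tsum_zero])
    (by simp only [h.zero, zero_smul, tsum_zero])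
  have hsum : ∀ (c : ℝ → ℤ × ℤ → ℂ) (t : ℝ) (k : YZ),
      (∃ b : ℤ × ℤ → ℝ, Summable b ∧ ∀ p, ‖c t p‖ * posWeight p ^ K ≤ b p) →
      (∑' p, c t p • levelFun z p) k = ∑' p, c t p * levelFun z p k := by
    rintro c t k ⟨b, hb, hbc⟩
    have hS : Summable fun p => c t p • levelFun z p := by
      refine Summable.of_norm_bounded (hb.mul_left (2 * (rexp (π * K) * 2 ^ K))) fun p => ?_
      rw [norm_smul]
      calc ‖c t p‖ * ‖levelFun z p‖
          ≤ ‖c t p‖ * (2 * (rexp (π * K) * 2 ^ K) * posWeight p ^ K) := by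
            gcongr; exact norm_levelFun_le hK p
        _ = 2 * (rexp (π * K) * 2 ^ K) * (‖c t p‖ * posWeight p ^ K) := by ring
        _ ≤ _ := by gcongr; exact hbc p
    exact ((ContinuousLinearMap.apply ℂ ℂ k).map_tsum hS).trans (tsum_congr fun p => by simp)
  obtain ⟨b, hb, hbR⟩ := h.bound K
  have e0 : (fun t => (∑' p, R t p • levelFun z p)
      (perturb DY (∑' p, R t p • unitY p) * perturb DY (∑' p, R t p • cutUnitY p))) =
      fun t => zetaPert (R t) z :=
    funext fun t => hsum R t _ ⟨b, hb, fun p => (hbR t p).1⟩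
  rw [e0] at hmain
  rw [hsum R₁ 0 _ ⟨b, hb, fun p => (hbR 0 p).2.1⟩, hsum R₁ 0 _ ⟨b, hb, fun p => (hbR 0 p).2.1⟩,
    hsum R₂ 0 _ ⟨b, hb, fun p => (hbR 0 p).2.2⟩] at hmain
  exact hmain

end MatVar

/-! ### Evaluation of the contour functionals at the free resolvent -/

/-- Cauchy's formula for the derivatives of `f h` at the centre of the circle. -/
theorem circAvg_inv_pow {n : ℕ} {f h : ℂ → ℂ}
    (hfh : DifferentiableOn ℂ (fun w => f w * h w) (Metric.closedBall (n : ℂ) (1 / 2))) (k : ℕ) :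
    circAvg n f (fun t => h (circPt (n, t)) * (circPt (n, t) - n)⁻¹ ^ (k + 1)) =
      iteratedDeriv k (fun w => f w * h w) n / k.factorial := by
  rw [circAvg_eq_circleIntegral fun w => h w * (w - n)⁻¹ ^ (k + 1)]
  have h1 := hfh.circleIntegral_one_div_sub_center_pow_smul (by norm_num : (0 : ℝ) < 1 / 2) k
  have h2 : (∮ w in C((n : ℂ), 1 / 2), f w * (h w * (w - n)⁻¹ ^ (k + 1))) =
      ∮ w in C((n : ℂ), 1 / 2), (1 / (w - n) ^ (k + 1)) • (f w * h w) := by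
    congr 1
    funext w
    rw [smul_eq_mul, one_div, inv_pow]
    ring
  rw [h2, h1, smul_eq_mul]
  have := Complex.two_pi_I_ne_zero
  field_simp

theorem deriv_cpow_neg {w : ℂ} (z : ℂ) (hw : w ∈ Complex.slitPlane) :
    HasDerivAt (fun w => w ^ (-z)) (-z * w ^ (-z - 1)) w := by
  simpa using (hasDerivAt_id w).cpow_const (c := -z) hw

theorem natCast_mem_slitPlane {a : ℕ} (ha : a ≠ 0) : (a : ℂ) ∈ Complex.slitPlane :=
  Complex.natCast_mem_slitPlane.2 ha

theorem iteratedDeriv_two_cpow_neg {a : ℕ} (z : ℂ) (ha : a ≠ 0) :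
    iteratedDeriv 2 (fun w : ℂ => w ^ (-z)) a = z * (z + 1) * (a : ℂ) ^ (-z - 2) := by
  have hs := natCast_mem_slitPlane ha
  rw [iteratedDeriv_succ, iteratedDeriv_one]
  have h1 : deriv (fun w : ℂ => w ^ (-z)) =ᶠ[𝓝 (a : ℂ)] fun w => -z * w ^ (-(z + 1)) := by
    filter_upwards [Complex.isOpen_slitPlane.mem_nhds hs] with w hw
    rw [(deriv_cpow_neg z hw).deriv]
    ring_nf
  rw [h1.deriv_eq, ((deriv_cpow_neg (z + 1) hs).const_mul (-z)).deriv]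
  ring_nf

/-- The divided difference `f[a, a, b]` of `f(w) = w^{-z}`. -/
def divDiff (z : ℂ) (a b : ℕ) : ℂ :=
  if a = b then z * (z + 1) * (a : ℂ) ^ (-z - 2) / 2 else
    (-z * (a : ℂ) ^ (-z - 1) * (a - b) - (a : ℂ) ^ (-z) + (b : ℂ) ^ (-z)) / (a - b) ^ 2

theorem sub_ne_zero_of_mem_closedBall {n k : ℕ} (h : n ≠ k) {w : ℂ}
    (hw : w ∈ Metric.closedBall (n : ℂ) (1 / 2)) : w - k ≠ 0 := by
  rw [mem_closedBall_iff_norm] at hw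
  intro h0
  have h1 : (1 : ℝ) ≤ |(n : ℝ) - k| := by
    have : (1 : ℤ) ≤ |(n : ℤ) - k| := Int.one_le_abs (by omega)
    exact_mod_cast this
  rw [sub_eq_zero.1 h0, norm_sub_rev, show (n : ℂ) - k = ((n - k : ℝ) : ℂ) by push_cast; rfl,
    Complex.norm_real, Real.norm_eq_abs] at hw
  linarith

/-- The residues of `w^{-z} (w - b)⁻¹ (w - a)⁻²` at `a` and `b` add up to the divided difference. -/
theorem sum_circAvg_divDiff (z : ℂ) {a b : ℕ} (ha : a ≠ 0) (hb : b ≠ 0) :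
    ∑ n ∈ ({a, b} : Finset ℕ), circAvg n (fun w => w ^ (-z))
      (fun t => (circPt (n, t) - b)⁻¹ * (circPt (n, t) - a)⁻¹ ^ 2) = divDiff z a b := by
  have hd : ∀ {n : ℕ}, n ≠ 0 → DifferentiableOn ℂ (fun w : ℂ => w ^ (-z))
      (Metric.closedBall (n : ℂ) (1 / 2)) := fun hn w hw =>
    (differentiableAt_cpow_neg hn z w hw).differentiableWithinAt
  by_cases hab : a = b
  · subst hab
    have h := circAvg_inv_pow (h := fun _ => 1) (by simpa using hd ha) 2
    simp only [one_mul, mul_one] at h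
    rw [iteratedDeriv_two_cpow_neg z ha] at h
    simp only [Finset.pair_eq_singleton, Finset.sum_singleton, divDiff, if_true]
    rw [show (2 : ℂ) = (Nat.factorial 2 : ℕ) by norm_num] at *
    rw [← h]
    congr 1
    funext t
    ring
  · have hab' : (a : ℂ) - b ≠ 0 := sub_ne_zero.2 (by exact_mod_cast hab)
    have hba' : (b : ℂ) - a ≠ 0 := sub_ne_zero.2 (by exact_mod_cast Ne.symm hab)
    rw [Finset.sum_pair hab, divDiff, if_neg hab]
    have h1 := circAvg_inv_pow (f := fun w => w ^ (-z)) (h := fun w => (w - b)⁻¹) (n := a)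
      ((hd ha).mul ((differentiableOn_id.sub_const _).inv fun w hw =>
        sub_ne_zero_of_mem_closedBall hab hw)) 1
    have h2 := circAvg_inv_pow (f := fun w => w ^ (-z)) (h := fun w => ((w - a)⁻¹) ^ 2) (n := b)
      ((hd hb).mul (((differentiableOn_id.sub_const _).inv fun w hw =>
        sub_ne_zero_of_mem_closedBall (Ne.symm hab) hw).pow 2)) 0
    have h3 := ((deriv_cpow_neg z (natCast_mem_slitPlane ha)).fun_mul
      (((hasDerivAt_id (a : ℂ)).sub_const (b : ℂ)).fun_inv hab')).deriv
    simp only [id_eq] at h3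
    rw [iteratedDeriv_one, h3] at h1
    rw [h1]
    have h4 : circAvg b (fun w => w ^ (-z))
        (fun t => (circPt (b, t) - b)⁻¹ * (circPt (b, t) - a)⁻¹ ^ 2) =
        (b : ℂ) ^ (-z) * ((b : ℂ) - a)⁻¹ ^ 2 := by
      simp only [iteratedDeriv_zero, Nat.factorial_zero, Nat.cast_one, div_one] at h2
      rw [← h2]
      congr 1
      funext t
      ring
    rw [h4]
    have e1 : ((b : ℂ) - a)⁻¹ ^ 2 = ((a : ℂ) - b)⁻¹ ^ 2 := by
      rw [← neg_sub (a : ℂ) b, inv_neg, neg_sq]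
    rw [e1]
    simp only [Nat.factorial_one, Nat.cast_one, div_one]
    field_simp
    ring

theorem evalY_DY_entry (s : ℕ × ℝ) (v : HZ) (j : ℤ) :
    evalY s DY v j = (circPt s - j.natAbs)⁻¹ * v j := by
  rw [evalY_DY, diagOp_apply, invLev_apply]

theorem levelFun_DY_mul_DY_diag (z : ℂ) {i : ℤ} (hi : i ≠ 0) :
    levelFun z (i, i) (DY * DY) = -z * (i.natAbs : ℂ) ^ (-z - 1) := by
  have hn : i.natAbs ≠ 0 := Int.natAbs_ne_zero.2 hi
  have hs := natCast_mem_slitPlane hn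
  simp only [levelFun, levels, Finset.pair_eq_singleton, Finset.sum_singleton]
  rw [zetaFun_of_ne hn, contourFun_apply]
  have h := circAvg_inv_pow (f := fun w => w ^ (-z)) (h := fun _ => 1) (n := i.natAbs)
    (fun w hw => by
      simpa using (differentiableAt_cpow_neg hn z w hw).differentiableWithinAt) 1
  simp only [mul_one, iteratedDeriv_one, (deriv_cpow_neg z hs).deriv, Nat.factorial_one,
    Nat.cast_one, div_one, one_mul] at h
  rw [← h]
  congr 1
  funext t
  rw [evalY_mul]
  change evalY _ DY (evalY _ DY (ez i)) i = _
  rw [evalY_DY_entry, evalY_DY_entry, ez_apply, if_pos rfl]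
  ring

theorem levelFun_DY_mul_DY_of_ne (z : ℂ) {i j : ℤ} (hij : i ≠ j) :
    levelFun z (i, j) (DY * DY) = 0 := by
  rw [levelFun, sum_apply]
  refine Finset.sum_eq_zero fun n _ => ?_
  by_cases hn : n ≠ 0
  · rw [zetaFun_of_ne hn, contourFun_apply]
    have : (fun t => evalY (n, t) (DY * DY) (ez i) j) = fun t => (0 : ℂ) • (1 : ℂ) := by
      funext t
      rw [evalY_mul]
      change evalY _ DY (evalY _ DY (ez i)) j = _
      rw [evalY_DY_entry, evalY_DY_entry, ez_apply, if_neg hij.symm]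
      simp
    rw [this, circAvg_smul, zero_smul]
  · rw [zetaFun, dif_neg hn, zero_apply]

/-- The second-order term at a position of nonzero levels; the cut matrix does not contribute,
since the position touches the levels of the circles. -/
theorem levelFun_second (z : ℂ) {N : ℤ × ℤ → ℂ} (hN : Summable fun p => ‖N p‖) {i j : ℤ}
    (hi : i ≠ 0) (hj : j ≠ 0) :
    levelFun z (i, j) (DY * opY N * DY * DY + DY * (DY * cutY N * DY)) =
      N (j, i) * divDiff z i.natAbs j.natAbs := by
  have ha := Int.natAbs_ne_zero.2 hi
  have hb := Int.natAbs_ne_zero.2 hj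
  rw [← sum_circAvg_divDiff z ha hb, Finset.mul_sum, levelFun, sum_apply]
  refine Finset.sum_congr rfl fun n hn => ?_
  have hn0 : n ≠ 0 := by
    simp only [Finset.mem_insert, Finset.mem_singleton] at hn
    rcases hn with rfl | rfl <;> assumption
  rw [zetaFun_of_ne hn0, contourFun_apply]
  refine Eq.trans ?_ (circAvg_smul (N (j, i)) _)
  congr 1
  funext t
  have e1 : evalY (n, t) DY (evalY (n, t) DY (ez i)) =
      ((circPt (n, t) - i.natAbs)⁻¹ ^ 2) • ez i := by
    rw [evalY_DY_ez, map_smul, evalY_DY_ez, smul_smul, sq]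
  have e2 : evalY (n, t) (DY * opY N * DY * DY) (ez i) j =
      N (j, i) * ((circPt (n, t) - j.natAbs)⁻¹ * (circPt (n, t) - i.natAbs)⁻¹ ^ 2) := by
    rw [evalY_mul, evalY_mul, evalY_mul]
    change evalY _ DY (evalY _ (opY N) (evalY _ DY (evalY _ DY (ez i)))) j = _
    rw [e1, evalY_DY_entry, evalY_opY hN, map_smul, lp.coeFn_smul, Pi.smul_apply, opMat_ez hN,
      smul_eq_mul]
    ring
  have e3 : evalY (n, t) (DY * (DY * cutY N * DY)) (ez i) j = 0 := by
    rw [evalY_mul, evalY_mul, evalY_mul]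
    change evalY _ DY (evalY _ DY (evalY _ (cutY N) (evalY _ DY (ez i)))) j = _
    rw [evalY_DY_entry, evalY_DY_entry, evalY_DY_ez, map_smul, evalY_cutY hN, lp.coeFn_smul,
      Pi.smul_apply, opMat_ez (summable_cutMat hN n), cutMat, if_pos]
    · simp
    · exact (mem_levels (p := (i, j)).1 hn).symm
  rw [map_add, add_apply, lp.coeFn_add, Pi.add_apply, e2, e3, add_zero, smul_eq_mul]

/-! ### Families of smooth functions with uniform bounds, and nonstationary phase -/

section Families

variable {P Q : Type*} {𝕜 : Type*} [RCLike 𝕜]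

/-- A family of `2π`-periodic functions, `k` times differentiable, whose derivatives up to the
order `k` are bounded uniformly in the parameter. -/
def BddFam (k : ℕ) : (P → ℝ → 𝕜) → Prop :=
  Nat.rec (fun g => (∃ C, ∀ p x, ‖g p x‖ ≤ C) ∧ (∀ p, Function.Periodic (g p) (2 * π)) ∧
      ∀ p, Continuous (g p))
    (fun _ B g => ((∃ C, ∀ p x, ‖g p x‖ ≤ C) ∧ (∀ p, Function.Periodic (g p) (2 * π)) ∧
      ∀ p, Continuous (g p)) ∧ (∀ p, Differentiable ℝ (g p)) ∧ B fun p => deriv (g p)) k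

theorem BddFam.zero_le {k : ℕ} {g : P → ℝ → 𝕜} (h : BddFam k g) : BddFam 0 g := by
  cases k with
  | zero => exact h
  | succ k => exact h.1

theorem BddFam.of_succ {k : ℕ} {g : P → ℝ → 𝕜} (h : BddFam (k + 1) g) : BddFam k g := by
  induction k generalizing g with
  | zero => exact h.1
  | succ k ih => exact ⟨h.1, h.2.1, ih h.2.2⟩

theorem BddFam.comp {k : ℕ} {g : P → ℝ → 𝕜} (h : BddFam k g) (φ : Q → P) :
    BddFam k fun q => g (φ q) := by
  induction k generalizing g with
  | zero =>
    obtain ⟨⟨C, hC⟩, h2, h3⟩ := h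
    exact ⟨⟨C, fun q => hC (φ q)⟩, fun q => h2 (φ q), fun q => h3 (φ q)⟩
  | succ k ih =>
    obtain ⟨⟨⟨C, hC⟩, h2, h3⟩, h4, h5⟩ := h
    exact ⟨⟨⟨C, fun q => hC (φ q)⟩, fun q => h2 (φ q), fun q => h3 (φ q)⟩, fun q => h4 (φ q), ih h5⟩

theorem BddFam.add {k : ℕ} {f g : P → ℝ → 𝕜} (hf : BddFam k f) (hg : BddFam k g) :
    BddFam k fun p x => f p x + g p x := by
  have h0 : ∀ {f g : P → ℝ → 𝕜}, BddFam 0 f → BddFam 0 g → BddFam 0 fun p x => f p x + g p x := by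
    rintro f g ⟨⟨C, hC⟩, h2, h3⟩ ⟨⟨D, hD⟩, h4, h5⟩
    exact ⟨⟨C + D, fun p x => (norm_add_le _ _).trans (add_le_add (hC p x) (hD p x))⟩,
      fun p x => by simp only [h2 p x, h4 p x], fun p => (h3 p).add (h5 p)⟩
  induction k generalizing f g with
  | zero => exact h0 hf hg
  | succ k ih =>
    refine ⟨h0 hf.zero_le hg.zero_le, fun p => (hf.2.1 p).add (hg.2.1 p), ?_⟩
    have e : (fun p => deriv fun x => f p x + g p x) = fun p x => deriv (f p) x + deriv (g p) x :=
      funext fun p => funext fun x => deriv_fun_add (hf.2.1 p x) (hg.2.1 p x)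
    rw [e]
    exact ih hf.2.2 hg.2.2

theorem BddFam.mul {k : ℕ} {f g : P → ℝ → 𝕜} (hf : BddFam k f) (hg : BddFam k g) :
    BddFam k fun p x => f p x * g p x := by
  have h0 : ∀ {f g : P → ℝ → 𝕜}, BddFam 0 f → BddFam 0 g → BddFam 0 fun p x => f p x * g p x := by
    rintro f g ⟨⟨C, hC⟩, h2, h3⟩ ⟨⟨D, hD⟩, h4, h5⟩
    exact ⟨⟨C * D, fun p x => (norm_mul_le _ _).trans (mul_le_mul (hC p x) (hD p x) (norm_nonneg _)
      ((norm_nonneg _).trans (hC p x)))⟩,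
      fun p x => by simp only [h2 p x, h4 p x], fun p => (h3 p).mul (h5 p)⟩
  induction k generalizing f g with
  | zero => exact h0 hf hg
  | succ k ih =>
    refine ⟨h0 hf.zero_le hg.zero_le, fun p => (hf.2.1 p).mul (hg.2.1 p), ?_⟩
    have e : (fun p => deriv fun x => f p x * g p x) =
        fun p x => deriv (f p) x * g p x + f p x * deriv (g p) x :=
      funext fun p => funext fun x => deriv_fun_mul (hf.2.1 p x) (hg.2.1 p x)
    rw [e]
    exact (ih hf.2.2 hg.of_succ).add (ih hf.of_succ hg.2.2)

theorem BddFam.const {c : P → 𝕜} {C : ℝ} (hc : ∀ p, ‖c p‖ ≤ C) (k : ℕ) :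
    BddFam k fun p (_ : ℝ) => c p := by
  have h0 : ∀ {c : P → 𝕜} {C : ℝ}, (∀ p, ‖c p‖ ≤ C) → BddFam 0 fun p (_ : ℝ) => c p :=
    fun hc => ⟨⟨_, fun p _ => hc p⟩, fun p x => rfl, fun p => continuous_const⟩
  induction k generalizing c C with
  | zero => exact h0 hc
  | succ k ih =>
    refine ⟨h0 hc, fun p => differentiable_const _, ?_⟩
    simp only [deriv_const']
    exact ih (c := fun _ => 0) (C := 0) fun p => by simp

theorem BddFam.inv {k : ℕ} {f : P → ℝ → ℝ} (hf : BddFam k f) {c : ℝ} (hc : 0 < c)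
    (hcf : ∀ p x, c ≤ |f p x|) : BddFam k fun p x => (f p x)⁻¹ := by
  have hne : ∀ p x, f p x ≠ 0 := fun p x h0 => by
    have := hcf p x
    rw [h0, abs_zero] at this
    linarith
  have h0 : BddFam 0 f → BddFam 0 fun p x => (f p x)⁻¹ := by
    rintro ⟨⟨C, hC⟩, h2, h3⟩
    exact ⟨⟨c⁻¹, fun p x => by
      rw [norm_inv]
      exact inv_anti₀ hc (hcf p x)⟩, fun p x => by simp only [h2 p x],
      fun p => (h3 p).inv₀ (hne p)⟩
  induction k with
  | zero => exact h0 hf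
  | succ k ih =>
    refine ⟨h0 hf.zero_le, fun p => (hf.2.1 p).inv (hne p), ?_⟩
    have e : (fun p => deriv fun x => (f p x)⁻¹) =
        fun p x => (-1 : ℝ) * (deriv (f p) x * ((f p x)⁻¹ * (f p x)⁻¹)) := by
      funext p x
      rw [((hf.2.1 p x).hasDerivAt.fun_inv (hne p x)).deriv]
      have := hne p x
      field_simp
    rw [e]
    have h1 := ih hf.of_succ
    exact (BddFam.const (P := P) (c := fun _ => (-1 : ℝ)) (C := 1) (fun _ => by simp) k).mul
      (BddFam.mul hf.2.2 (h1.mul h1))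

theorem BddFam.ofReal {k : ℕ} {f : P → ℝ → ℝ} (hf : BddFam k f) :
    BddFam k fun p x => (f p x : ℂ) := by
  have h0 : ∀ {f : P → ℝ → ℝ}, BddFam 0 f → BddFam 0 fun p x => (f p x : ℂ) := by
    rintro f ⟨⟨C, hC⟩, h2, h3⟩
    exact ⟨⟨C, fun p x => by simpa using hC p x⟩, fun p x => by simp only [h2 p x],
      fun p => Complex.continuous_ofReal.comp (h3 p)⟩
  induction k generalizing f with
  | zero => exact h0 hf
  | succ k ih =>
    refine ⟨h0 hf.zero_le, fun p x => (hf.2.1 p x).hasDerivAt.ofReal_comp.differentiableAt, ?_⟩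
    have e : (fun p => deriv fun x => (f p x : ℂ)) = fun p x => ((deriv (f p) x : ℝ) : ℂ) :=
      funext fun p => funext fun x => (hf.2.1 p x).hasDerivAt.ofReal_comp.deriv
    rw [e]
    exact ih hf.2.2

/-- A family of smooth `2π`-periodic functions, all of whose derivatives are bounded uniformly in
the parameter. -/
def SmoothFam (g : P → ℝ → 𝕜) : Prop := ∀ k, BddFam k g

namespace SmoothFam

variable {f g : P → ℝ → 𝕜}

theorem add (hf : SmoothFam f) (hg : SmoothFam g) : SmoothFam fun p x => f p x + g p x :=
  fun k => (hf k).add (hg k)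

theorem mul (hf : SmoothFam f) (hg : SmoothFam g) : SmoothFam fun p x => f p x * g p x :=
  fun k => (hf k).mul (hg k)

theorem const {c : P → 𝕜} {C : ℝ} (hc : ∀ p, ‖c p‖ ≤ C) : SmoothFam fun p (_ : ℝ) => c p :=
  BddFam.const hc

theorem const_mul (c : 𝕜) (hf : SmoothFam f) : SmoothFam fun p x => c * f p x :=
  (const (c := fun _ => c) fun _ => le_rfl).mul hf

theorem comp (hf : SmoothFam f) (φ : Q → P) : SmoothFam fun q => f (φ q) := fun k => (hf k).comp φ

theorem inv {f : P → ℝ → ℝ} (hf : SmoothFam f) {c : ℝ} (hc : 0 < c) (hcf : ∀ p x, c ≤ |f p x|) :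
    SmoothFam fun p x => (f p x)⁻¹ := fun k => (hf k).inv hc hcf

theorem ofReal {f : P → ℝ → ℝ} (hf : SmoothFam f) : SmoothFam fun p x => (f p x : ℂ) :=
  fun k => (hf k).ofReal

theorem deriv (hf : SmoothFam f) : SmoothFam fun p => deriv (f p) := fun k => (hf (k + 1)).2.2

theorem bound (hf : SmoothFam f) : ∃ C, 0 ≤ C ∧ ∀ p x, ‖f p x‖ ≤ C := by
  obtain ⟨C, hC⟩ := (hf 0).1
  exact ⟨max C 0, le_max_right _ _, fun p x => (hC p x).trans (le_max_left _ _)⟩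

theorem periodic (hf : SmoothFam f) (p : P) : Function.Periodic (f p) (2 * π) := (hf 0).2.1 p

theorem continuous (hf : SmoothFam f) (p : P) : Continuous (f p) := (hf 0).2.2 p

theorem differentiable (hf : SmoothFam f) (p : P) : Differentiable ℝ (f p) := (hf 1).2.1 p

/-- The primitives of a family with mean zero. -/
theorem primitive {g : P → ℝ → ℝ} (hg : SmoothFam g)
    (h0 : ∀ p, ∫ x in (0 : ℝ)..2 * π, g p x = 0) :
    SmoothFam fun p x => ∫ y in (0 : ℝ)..x, g p y := by
  have hd : ∀ p x, HasDerivAt (fun x => ∫ y in (0 : ℝ)..x, g p y) (g p x) x := fun p x =>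
    intervalIntegral.integral_hasDerivAt_right ((hg.continuous p).intervalIntegrable _ _)
      ((hg.continuous p).stronglyMeasurableAtFilter _ _) (hg.continuous p).continuousAt
  have hper : ∀ p, Function.Periodic (fun x => ∫ y in (0 : ℝ)..x, g p y) (2 * π) := fun p x => by
    have h1 := (hg.periodic p).intervalIntegral_add_eq x 0
    rw [zero_add, h0] at h1
    have h2 := intervalIntegral.integral_add_adjacent_intervals (μ := MeasureTheory.volume)
      ((hg.continuous p).intervalIntegrable 0 x)
      ((hg.continuous p).intervalIntegrable x (x + 2 * π))
    simp only
    rw [← h2, h1, add_zero]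
  obtain ⟨C, hC0, hC⟩ := hg.bound
  have hz : BddFam 0 fun p x => ∫ y in (0 : ℝ)..x, g p y := by
    refine ⟨⟨C * (2 * π), fun p x => ?_⟩, hper,
      fun p => continuous_iff_continuousAt.2 fun x => (hd p x).continuousAt⟩
    obtain ⟨y, hy, hxy⟩ := (hper p).exists_mem_Ico₀ Real.two_pi_pos x
    simp only
    rw [hxy]
    refine (intervalIntegral.norm_integral_le_of_norm_le_const fun t _ => hC p t).trans ?_
    rw [sub_zero, abs_of_nonneg hy.1]
    gcongr
    exact hy.2.le
  intro k
  cases k with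
  | zero => exact hz
  | succ k =>
    refine ⟨hz, fun p x => (hd p x).differentiableAt, ?_⟩
    have e : (fun p => _root_.deriv fun x => ∫ y in (0 : ℝ)..x, g p y) = g :=
      funext fun p => funext fun x => (hd p x).deriv
    rw [e]
    exact hg k

end SmoothFam

/-- Nonstationary phase: if `Θ' = N F` with `|F|` bounded below, then `∫ g e^{iΘ}` decreases
faster than any power of `N`. -/
theorem nonstationary_phase {Θ F : P → ℝ → ℝ} {N : P → ℝ} {c : ℝ} (hc : 0 < c)
    (hN : ∀ p, 0 ≤ N p) (hF : SmoothFam F) (hcF : ∀ p x, c ≤ |F p x|)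
    (hΘ : ∀ p x, HasDerivAt (Θ p) (N p * F p x) x)
    (hper : ∀ p, Complex.exp (Complex.I * Θ p (2 * π)) = Complex.exp (Complex.I * Θ p 0))
    (M : ℕ) {g : P → ℝ → ℂ} (hg : SmoothFam g) :
    ∃ C, ∀ p, N p ^ M * ‖∫ x in (0 : ℝ)..2 * π, g p x * Complex.exp (Complex.I * Θ p x)‖ ≤ C := by
  induction M generalizing g with
  | zero =>
    obtain ⟨C, hC0, hC⟩ := hg.bound
    refine ⟨C * |2 * π - 0|, fun p => ?_⟩
    rw [pow_zero, one_mul]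
    refine intervalIntegral.norm_integral_le_of_norm_le_const fun x _ => ?_
    rw [norm_mul, mul_comm Complex.I, Complex.norm_exp_ofReal_mul_I, mul_one]
    exact hC p x
  | succ M ih =>
    -- Integrate by parts: `g e^{iΘ} = (i N)⁻¹ (g / F) (e^{iΘ})'`.
    have hFi := (hF.inv hc hcF).ofReal
    have hgF := hg.mul hFi
    obtain ⟨C, hC⟩ := ih hgF.deriv
    refine ⟨C, fun p => (le_of_eq ?_).trans (hC p)⟩
    set G : ℝ → ℂ := fun x => g p x * ((F p x)⁻¹ : ℝ) with hG
    set E : ℝ → ℂ := fun x => Complex.exp (Complex.I * Θ p x) with hE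
    have hEd : ∀ x, HasDerivAt E (E x * (Complex.I * (N p * F p x : ℝ))) x := fun x =>
      ((hΘ p x).ofReal_comp.const_mul Complex.I).cexp
    have hGd : ∀ x, HasDerivAt G (_root_.deriv G x) x := fun x =>
      (hgF.differentiable p x).hasDerivAt
    have hEc : Continuous E := continuous_iff_continuousAt.2 fun x => (hEd x).continuousAt
    have hparts := intervalIntegral.integral_mul_deriv_eq_deriv_mul (a := 0) (b := 2 * π)
      (fun x _ => hGd x) (fun x _ => hEd x) ((hgF.deriv.continuous p).intervalIntegrable _ _)
      ((hEc.mul (continuous_const.mul (Complex.continuous_ofReal.comp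
        (continuous_const.mul (hF.continuous p))))).intervalIntegrable _ _)
    have hGp : G (2 * π) = G 0 := by simpa [hG] using hgF.periodic p 0
    have hEp : E (2 * π) = E 0 := hper p
    rw [hGp, hEp, sub_self, zero_sub] at hparts
    have hne : ∀ x, (F p x : ℂ) ≠ 0 := fun x h0 => by
      have h1 := hcF p x
      rw [Complex.ofReal_eq_zero.1 h0, abs_zero] at h1
      linarith
    have h1 : ∀ x, G x * (E x * (Complex.I * (N p * F p x : ℝ))) =
        Complex.I * N p * (g p x * E x) := fun x => by
      have := hne x
      simp only [hG]
      push_cast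
      field_simp
    simp only [h1, intervalIntegral.integral_const_mul] at hparts
    have h2 := congrArg norm hparts
    rw [norm_neg, norm_mul, norm_mul, Complex.norm_I, one_mul, Complex.norm_real, Real.norm_eq_abs,
      abs_of_nonneg (hN p)] at h2
    rw [pow_succ, mul_assoc, h2]

end Families

/-! ### Variations of the density -/

/-- A twice differentiable variation `η t` of the constant density `1` on the circle, with first
and second derivatives `η₁ t` and `η₂ t`, defined for all `t ∈ ℝ` with uniform bounds. -/
structure DensVar (η η₁ η₂ : ℝ → ℝ → ℝ) : Prop where
  smooth : SmoothFam η
  smooth₁ : SmoothFam η₁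
  smooth₂ : SmoothFam η₂
  lower : ∃ c, 0 < c ∧ ∀ t x, c ≤ η t x
  hasDerivAt : ∀ t x, HasDerivAt (fun t => η t x) (η₁ t x) t
  hasDerivAt₁ : ∀ t x, HasDerivAt (fun t => η₁ t x) (η₂ t x) t
  integral : ∀ t, ∫ x in (0 : ℝ)..2 * π, η t x = 2 * π
  zero : ∀ x, η 0 x = 1

/-- Integration over `[0, x]` of continuous functions on the circle. -/
def integralCLM (x : ℝ) : C(AddCircle (2 * π), ℝ) →L[ℝ] ℝ :=
  LinearMap.mkContinuous
    { toFun := fun f => ∫ y in (0 : ℝ)..x, f (y : AddCircle (2 * π))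
      map_add' := fun f g => by
        simp only [ContinuousMap.add_apply]
        exact intervalIntegral.integral_add
          ((f.continuous.comp (AddCircle.continuous_mk' _)).intervalIntegrable _ _)
          ((g.continuous.comp (AddCircle.continuous_mk' _)).intervalIntegrable _ _)
      map_smul' := fun c f => by
        simp only [ContinuousMap.smul_apply, RingHom.id_apply]
        exact intervalIntegral.integral_smul c _ } |x - 0| fun f =>
    (intervalIntegral.norm_integral_le_of_norm_le_const fun y _ => f.norm_coe_le_norm _).trans_eq
      (mul_comm _ _)

/-- `g` is the derivative of `f`, as continuous functions on the circle. -/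
def IsPrimitive (f g : C(AddCircle (2 * π), ℝ)) : Prop :=
  ∀ x : ℝ, f (x : AddCircle (2 * π)) = f 0 + integralCLM x g

theorem IsPrimitive.hasDerivAt {f g : C(AddCircle (2 * π), ℝ)} (h : IsPrimitive f g) (x : ℝ) :
    HasDerivAt (fun x : ℝ => f (x : AddCircle (2 * π))) (g (x : AddCircle (2 * π))) x := by
  have hc : Continuous fun x : ℝ => g (x : AddCircle (2 * π)) :=
    g.continuous.comp (AddCircle.continuous_mk' _)
  have h1 : HasDerivAt (fun x => ∫ y in (0 : ℝ)..x, g (y : AddCircle (2 * π)))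
      (g (x : AddCircle (2 * π))) x :=
    intervalIntegral.integral_hasDerivAt_right (hc.intervalIntegrable _ _)
      (hc.stronglyMeasurableAtFilter _ _) hc.continuousAt
  have e : (fun x : ℝ => f (x : AddCircle (2 * π))) =
      fun x => f 0 + ∫ y in (0 : ℝ)..x, g (y : AddCircle (2 * π)) := funext fun x => h x
  rw [e]
  exact h1.const_add (f 0)

theorem hasDerivAt_eval {f : ℝ → C(AddCircle (2 * π), ℝ)} {f' : C(AddCircle (2 * π), ℝ)} {t : ℝ}
    (h : HasDerivAt f f' t) (y : AddCircle (2 * π)) : HasDerivAt (fun t => f t y) (f' y) t := by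
  have L := (ContinuousMap.evalCLM ℝ y : C(AddCircle (2 * π), ℝ) →L[ℝ] ℝ).hasFDerivAt (x := f t)
  exact L.comp_hasDerivAt t h

/-- Differentiation in a parameter commutes with differentiation on the circle. -/
theorem IsPrimitive.deriv {f g : ℝ → C(AddCircle (2 * π), ℝ)} (h : ∀ t, IsPrimitive (f t) (g t))
    (hf : Differentiable ℝ f) (hg : Differentiable ℝ g) (t : ℝ) :
    IsPrimitive (deriv f t) (deriv g t) := fun x => by
  have he : ∀ (y : AddCircle (2 * π)),
      HasDerivAt (fun t => f t y) (_root_.deriv f t y) t := hasDerivAt_eval (hf t).hasDerivAt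
  have hi := (integralCLM x).hasFDerivAt.comp_hasDerivAt t (hg t).hasDerivAt
  have h1 := (he 0).add hi
  refine (he x).unique (h1.congr_of_eventuallyEq (Eventually.of_forall fun t => h t x))

theorem smoothFam_of_isPrimitive {P : Type*} {U : ℕ → P → C(AddCircle (2 * π), ℝ)}
    (hbd : ∀ m, ∃ C, ∀ p, ‖U m p‖ ≤ C) (hrel : ∀ m p, IsPrimitive (U m p) (U (m + 1) p)) (m : ℕ) :
    SmoothFam fun p (x : ℝ) => U m p (x : AddCircle (2 * π)) := by
  have h0 : ∀ m, BddFam 0 fun p (x : ℝ) => U m p (x : AddCircle (2 * π)) := fun m => by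
    obtain ⟨C, hC⟩ := hbd m
    exact ⟨⟨C, fun p x => ((U m p).norm_coe_le_norm _).trans (hC p)⟩,
      fun p x => by simp, fun p => (U m p).continuous.comp (AddCircle.continuous_mk' _)⟩
  intro k
  induction k generalizing m with
  | zero => exact h0 m
  | succ k ih =>
    refine ⟨h0 m, fun p x => ((hrel m p).hasDerivAt x).differentiableAt, ?_⟩
    have e : (fun p => _root_.deriv fun x : ℝ => U m p (x : AddCircle (2 * π))) =
        fun p (x : ℝ) => U (m + 1) p (x : AddCircle (2 * π)) :=
      funext fun p => funext fun x => ((hrel m p).hasDerivAt x).deriv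
    have := ih (m + 1)
    rw [← e] at this
    exact this

theorem exists_bound_of_const_outside {V : Type*} [NormedAddCommGroup V] [NormedSpace ℝ V]
    {u : ℝ → V} (hu : ContDiff ℝ 2 u) {r : ℝ} (hr : ∀ t, r ≤ |t| → u t = u 0) :
    (∃ C, ∀ t, ‖u t‖ ≤ C) ∧ (∃ C, ∀ t, ‖deriv u t‖ ≤ C) ∧ ∃ C, ∀ t, ‖deriv (deriv u) t‖ ≤ C := by
  have hs : HasCompactSupport fun t => u t - u 0 :=
    HasCompactSupport.intro (isCompact_Icc (a := -r) (b := r)) fun t ht => by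
      have : r ≤ |t| := by
        by_contra hlt
        exact ht (abs_le.1 (not_le.1 hlt).le)
      rw [hr t this, sub_self]
  have h1 : ContDiff ℝ 1 (deriv u) := (contDiff_succ_iff_deriv (n := 1)).1 hu |>.2.2
  have h2 : Continuous (deriv (deriv u)) := h1.continuous_deriv le_rfl
  have hd : deriv (fun t => u t - u 0) = deriv u := funext fun t => deriv_sub_const _
  have hs1 := hs.deriv
  rw [hd] at hs1
  refine ⟨?_, h1.continuous.bounded_above_of_compact_support hs1,
    h2.bounded_above_of_compact_support hs1.deriv⟩
  obtain ⟨C, hC⟩ := (hu.continuous.sub continuous_const).bounded_above_of_compact_support hs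
  refine ⟨C + ‖u 0‖, fun t => ?_⟩
  have := norm_add_le (u t - u 0) (u 0)
  rw [sub_add_cancel] at this
  exact this.trans (by gcongr; exact hC t)

theorem circleToC_coe {𝕜 : Type} [RCLike 𝕜] (f : smoothCircle 𝕜) (x : ℝ) :
    circleToC f (x : AddCircle (2 * π)) = f.1 x := Function.Periodic.lift_coe f.2.2 x

theorem isPrimitive_circleDeriv (f : smoothCircle ℝ) :
    IsPrimitive (circleToC f) (circleToC (circleDeriv f)) := fun x => by
  have h0 : circleToC f 0 = f.1 0 := circleToC_coe f 0
  have h1 : integralCLM x (circleToC (circleDeriv f)) = ∫ y in (0 : ℝ)..x, deriv f.1 y :=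
    intervalIntegral.integral_congr fun y _ => circleToC_coe _ y
  rw [h0, h1, circleToC_coe, intervalIntegral.integral_deriv_eq_sub
    (fun y _ => f.2.1.differentiable (by simp) y)
    ((circleDeriv f).2.1.continuous.intervalIntegrable _ _)]
  ring

/-- A smooth function that is the identity near `0`, with values in a compact subinterval of
`(-ε, ε)`, and vanishing outside of `(-ε/2, ε/2)`. -/
theorem exists_cutoff {ε : ℝ} (hε : 0 < ε) : ∃ χ : ℝ → ℝ, ContDiff ℝ ∞ χ ∧ χ =ᶠ[𝓝 0] id ∧
    (∀ t, χ t ∈ Ioo (-ε) ε) ∧ ∀ t, ε / 2 ≤ |t| → χ t = 0 := by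
  let f : ContDiffBump (0 : ℝ) := ⟨ε / 4, ε / 2, by positivity, by linarith⟩
  have hz : ∀ t, ε / 2 ≤ |t| → f t = 0 := fun t ht =>
    f.zero_of_le_dist (by simpa [f] using ht)
  refine ⟨fun t => f t * t, f.contDiff.mul contDiff_id, ?_, fun t => ?_, fun t ht => ?_⟩
  · filter_upwards [f.eventuallyEq_one] with t ht
    rw [ht]
    simp
  · rw [mem_Ioo, ← abs_lt]
    simp only
    rcases le_or_gt (ε / 2) |t| with h | h
    · rw [hz t h]
      simpa using hε
    · rw [abs_mul, abs_of_nonneg f.nonneg]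
      have := mul_le_mul_of_nonneg_right (f.le_one (x := t)) (abs_nonneg t)
      linarith
  · simp only [hz t ht, zero_mul]

/-- A variation of the function `1` with `∫ α⁻¹ = 2π` gives a variation of the density `α⁻¹`
which is defined for all values of the parameter. -/
theorem exists_densVar {ε : ℝ} (hε : 0 < ε) {α : ℝ → PosCircle}
    (hα : IsSmoothFamily 2 (Ioo (-ε) ε) (fun τ => (α τ).1)) (hα0 : ∀ θ : ℝ, (α 0).1.1 θ = 1)
    (hnorm : ∀ τ ∈ Ioo (-ε) ε, ∫ θ in (0 : ℝ)..(2 * π), ((α τ).1.1 θ)⁻¹ = 2 * π)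
    {β : ℝ → ℝ} (hβ : ∀ θ : ℝ, HasDerivAt (fun τ => (α τ).1.1 θ) (β θ) 0) :
    ∃ η η₁ η₂ : ℝ → ℝ → ℝ, DensVar η η₁ η₂ ∧ (∀ᶠ t in 𝓝 0, ∀ x, η t x = ((α t).1.1 x)⁻¹) ∧
      ∀ x, η₁ 0 x = -β x := by
  obtain ⟨χ, hχ, hχ0, hχm, hχz⟩ := exists_cutoff hε
  have hχ00 : χ 0 = 0 := hχ0.eq_of_nhds
  -- Replacing the parameter `t` by `χ t` makes the family global, and constant for large `t`.
  set u : ℕ → ℝ → C(AddCircle (2 * π), ℝ) := fun m t => circleToC (circleDeriv^[m] (α (χ t)).1)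
    with hu
  have hu2 : ∀ m, ContDiff ℝ 2 (u m) := fun m =>
    (hα m).comp_contDiff (hχ.of_le (by exact_mod_cast le_top)) hχm
  have hu1 : ∀ m, ContDiff ℝ 1 (deriv (u m)) := fun m =>
    (contDiff_succ_iff_deriv (n := 1)).1 (hu2 m) |>.2.2
  have hout : ∀ m t, ε / 2 ≤ |t| → u m t = u m 0 := fun m t ht => by
    simp only [hu, hχz t ht, hχ00]
  have hb := fun m => exists_bound_of_const_outside (hu2 m) (hout m)
  have hr0 : ∀ m t, IsPrimitive (u m t) (u (m + 1) t) := fun m t => by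
    simp only [hu, Function.iterate_succ_apply']
    exact isPrimitive_circleDeriv _
  have hd0 : ∀ m, Differentiable ℝ (u m) := fun m => (hu2 m).differentiable (by simp)
  have hd1 : ∀ m, Differentiable ℝ (deriv (u m)) := fun m => (hu1 m).differentiable (by simp)
  have hr1 : ∀ m t, IsPrimitive (deriv (u m) t) (deriv (u (m + 1)) t) := fun m t =>
    IsPrimitive.deriv (hr0 m) (hd0 m) (hd0 (m + 1)) t
  have hr2 : ∀ m t, IsPrimitive (deriv (deriv (u m)) t) (deriv (deriv (u (m + 1))) t) :=
    fun m t => IsPrimitive.deriv (hr1 m) (hd1 m) (hd1 (m + 1)) t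
  have hA : SmoothFam fun t (x : ℝ) => u 0 t x := smoothFam_of_isPrimitive (fun m => (hb m).1) hr0 0
  have hA1 : SmoothFam fun t (x : ℝ) => deriv (u 0) t x :=
    smoothFam_of_isPrimitive (U := fun m => deriv (u m)) (fun m => (hb m).2.1) hr1 0
  have hA2 : SmoothFam fun t (x : ℝ) => deriv (deriv (u 0)) t x :=
    smoothFam_of_isPrimitive (U := fun m => deriv (deriv (u m))) (fun m => (hb m).2.2) hr2 0
  have hdA : ∀ t (x : ℝ), HasDerivAt (fun t => u 0 t x) (deriv (u 0) t x) t := fun t x =>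
    hasDerivAt_eval (hd0 0 t).hasDerivAt x
  have hdA1 : ∀ t (x : ℝ), HasDerivAt (fun t => deriv (u 0) t x) (deriv (deriv (u 0)) t x) t :=
    fun t x => hasDerivAt_eval (hd1 0 t).hasDerivAt x
  have hval : ∀ t (x : ℝ), u 0 t x = (α (χ t)).1.1 x := fun t x => circleToC_coe _ x
  have hpos : ∀ t (y : AddCircle (2 * π)), 0 < u 0 t y := fun t y => by
    induction y using QuotientAddGroup.induction_on with
    | H x => exact (hval t x).symm ▸ (α (χ t)).2 x
  -- A uniform lower bound, by compactness of `[-ε, ε] × 𝕊`.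
  obtain ⟨c, hc, hcu⟩ : ∃ c, 0 < c ∧ ∀ t (x : ℝ), c ≤ u 0 t x := by
    have hcont : Continuous fun q : ℝ × AddCircle (2 * π) => u 0 q.1 q.2 :=
      (((hu2 0).continuous.comp continuous_fst).eval continuous_snd)
    obtain ⟨q, hq, hmin⟩ := (isCompact_Icc (a := -ε) (b := ε)).prod
      (isCompact_univ (X := AddCircle (2 * π))) |>.exists_isMinOn
      ⟨(0, 0), ⟨⟨by linarith, hε.le⟩, mem_univ _⟩⟩ hcont.continuousOn
    refine ⟨_, hpos q.1 q.2, fun t x => ?_⟩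
    by_cases ht : t ∈ Icc (-ε) ε
    · exact hmin (show (t, (x : AddCircle (2 * π))) ∈ _ from ⟨ht, mem_univ _⟩)
    · have h2 : ε / 2 ≤ |t| := by
        by_contra hlt
        exact ht (abs_le.1 ((not_le.1 hlt).le.trans (by linarith)))
      rw [hout 0 t h2]
      exact hmin (show ((0 : ℝ), (x : AddCircle (2 * π))) ∈ _ from
        ⟨⟨by linarith, hε.le⟩, mem_univ _⟩)
  have hne : ∀ t (x : ℝ), u 0 t x ≠ 0 := fun t x => (hpos t x).ne'
  have hη := hA.inv hc fun t x => (hcu t x).trans (le_abs_self _)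
  have hη1 := (hA1.mul (hη.mul hη)).const_mul (-1)
  have hη2 := ((hA2.mul (hη.mul hη)).const_mul (-1)).add
    (((hA1.mul hA1).mul (hη.mul (hη.mul hη))).const_mul 2)
  obtain ⟨C, hC0, hC⟩ := hA.bound
  refine ⟨_, _, _, ⟨hη, hη1, hη2, ⟨(C + 1)⁻¹, by positivity, fun t x => ?_⟩, fun t x => ?_,
    fun t x => ?_, fun t => ?_, fun x => ?_⟩, ?_, fun x => ?_⟩
  · refine inv_anti₀ (hpos t x) ?_
    have := (le_abs_self _).trans (hC t x)
    linarith
  · refine ((hdA t x).fun_inv (hne t x)).congr_deriv ?_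
    have := hne t x
    field_simp
  · have h1 := ((hdA t x).fun_inv (hne t x))
    refine (((hdA1 t x).fun_mul (h1.fun_mul h1)).const_mul (-1)).congr_deriv ?_
    have := hne t x
    field_simp
    ring
  · simp only [hval]
    exact hnorm _ (hχm t)
  · rw [hval, hχ00, hα0, inv_one]
  · filter_upwards [hχ0] with t ht x
    rw [hval, ht, id]
  · have h1 : HasDerivAt (fun t => u 0 t x) (β x) 0 := by
      refine (hβ x).congr_of_eventuallyEq ?_
      filter_upwards [hχ0] with t ht
      rw [hval, ht, id]
    rw [(hdA 0 x).unique h1, hval, hχ00, hα0]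
    simp

/-! ### Fourier series of smooth functions -/

/-- The mean value `(2π)⁻¹ ∫_0^{2π} f`. -/
def circMean (f : ℝ → ℂ) : ℂ := (2 * π : ℂ)⁻¹ * ∫ x in (0 : ℝ)..2 * π, f x

theorem circleCoeff_eq_circMean (f : ℝ → ℂ) (n : ℤ) :
    circleCoeff f n = circMean fun x => Complex.exp (-(Complex.I * n * x)) * f x := by
  rw [circleCoeff_eq, circMean, Complex.real_smul]
  push_cast
  rw [one_div]

theorem circMean_congr {f g : ℝ → ℂ} (h : ∀ x, f x = g x) : circMean f = circMean g := by
  rw [funext h]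

theorem circMean_const_mul (c : ℂ) (f : ℝ → ℂ) : circMean (fun x => c * f x) = c * circMean f := by
  rw [circMean, circMean, intervalIntegral.integral_const_mul]
  ring

theorem norm_circMean_le {f : ℝ → ℂ} {C : ℝ} (h : ∀ x, ‖f x‖ ≤ C) : ‖circMean f‖ ≤ C := by
  have h1 := intervalIntegral.norm_integral_le_of_norm_le_const (a := 0) (b := 2 * π)
    (fun x _ => h x)
  rw [sub_zero, abs_of_pos Real.two_pi_pos] at h1
  have h2 : ‖(2 * π : ℂ)‖ = 2 * π := by
    rw [show (2 * π : ℂ) = ((2 * π : ℝ) : ℂ) by push_cast; rfl, Complex.norm_real,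
      Real.norm_of_nonneg Real.two_pi_pos.le]
  rw [circMean, norm_mul, norm_inv, h2, inv_mul_le_iff₀ Real.two_pi_pos]
  linarith

theorem hasSum_circMean {ι : Type*} [Countable ι] {f : ι → ℝ → ℂ} {F : ℝ → ℂ} {b : ι → ℝ}
    (hf : ∀ i, Continuous (f i)) (hb : Summable b) (hfb : ∀ i x, ‖f i x‖ ≤ b i)
    (hF : ∀ x, HasSum (fun i => f i x) (F x)) :
    HasSum (fun i => circMean (f i)) (circMean F) := by
  refine HasSum.mul_left _ ?_
  refine intervalIntegral.hasSum_integral_of_dominated_convergence (fun i _ => b i)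
    (fun i => (hf i).aestronglyMeasurable) (fun i => Eventually.of_forall fun x _ => hfb i x)
    (Eventually.of_forall fun x _ => hb) intervalIntegrable_const
    (Eventually.of_forall fun x _ => hF x)

theorem norm_exp_neg_I_mul (n : ℤ) (x : ℝ) : ‖Complex.exp (-(Complex.I * n * x))‖ = 1 := by
  simp [Complex.norm_exp]

theorem norm_exp_I_mul (n : ℤ) (x : ℝ) : ‖Complex.exp (Complex.I * n * x)‖ = 1 := by
  simp [Complex.norm_exp]

theorem hasSum_circleCoeff {ι : Type*} [Countable ι] {f : ι → ℝ → ℂ} {F : ℝ → ℂ} {b : ι → ℝ}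
    (hf : ∀ i, Continuous (f i)) (hb : Summable b) (hfb : ∀ i x, ‖f i x‖ ≤ b i)
    (hF : ∀ x, HasSum (fun i => f i x) (F x)) (k : ℤ) :
    HasSum (fun i => circleCoeff (f i) k) (circleCoeff F k) := by
  simp only [circleCoeff_eq_circMean]
  refine hasSum_circMean (fun i => by have := hf i; fun_prop) hb (fun i x => ?_)
    fun x => (hF x).mul_left _
  rw [norm_mul, norm_exp_neg_I_mul, one_mul]
  exact hfb i x

theorem circMean_exp (n : ℤ) :
    circMean (fun x => Complex.exp (Complex.I * n * x)) = if n = 0 then 1 else 0 := by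
  have hpi : (π : ℂ) ≠ 0 := by exact_mod_cast Real.pi_ne_zero
  split_ifs with h
  · subst h
    simp only [circMean, Int.cast_zero, mul_zero, zero_mul, Complex.exp_zero,
      intervalIntegral.integral_const, sub_zero, Complex.real_smul, mul_one]
    push_cast
    field_simp
  · have hn : Complex.I * n ≠ 0 := mul_ne_zero Complex.I_ne_zero (by exact_mod_cast h)
    have h1 : Complex.exp (Complex.I * n * (2 * π : ℝ)) = 1 := by
      rw [Complex.exp_eq_one_iff]
      exact ⟨n, by push_cast; ring⟩
    rw [circMean, integral_exp_mul_complex hn, h1]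
    simp

theorem circleCoeff_exp (n k : ℤ) :
    circleCoeff (fun x => Complex.exp (Complex.I * n * x)) k = if n = k then 1 else 0 := by
  rw [circleCoeff_eq_circMean]
  have h := circMean_exp (n - k)
  simp only [sub_eq_zero] at h
  rw [← h]
  refine circMean_congr fun x => ?_
  rw [← Complex.exp_add]
  push_cast
  ring_nf

theorem circleCoeff_const_mul (c : ℂ) (f : ℝ → ℂ) (n : ℤ) :
    circleCoeff (fun x => c * f x) n = c * circleCoeff f n := circleCoeff_smul c f n

/-- Rapid decay of Fourier coefficients, with the weights `1 + |n|`. -/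
theorem summable_weight_circleCoeff (f : smoothCircle ℂ) (K : ℕ) :
    Summable fun n : ℤ => (1 + |(n : ℝ)|) ^ K * ‖circleCoeff f.1 n‖ := by
  have h := ((summable_pow_mul_circleCoeff f K).mul_left (2 ^ K)).add
    (hasSum_ite_eq (0 : ℤ) ‖circleCoeff f.1 0‖).summable
  refine Summable.of_nonneg_of_le (fun n => by positivity) (fun n => ?_) h
  rcases eq_or_ne n 0 with rfl | hn
  · simp
  · have h1 : (1 : ℝ) ≤ |(n : ℝ)| := by exact_mod_cast Int.one_le_abs hn
    rw [if_neg hn, add_zero, ← mul_assoc]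
    gcongr
    calc (1 + |(n : ℝ)|) ^ K ≤ (2 * |(n : ℝ)|) ^ K := by gcongr; linarith
      _ = 2 ^ K * |(n : ℝ)| ^ K := mul_pow _ _ _
      _ ≤ 2 ^ K * |(n : ℝ)| ^ (K + 1) := by gcongr; exact Nat.le_succ K

theorem summable_norm_circleCoeff (f : smoothCircle ℂ) :
    Summable fun n : ℤ => ‖circleCoeff f.1 n‖ := by
  simpa using summable_weight_circleCoeff f 0

/-- Fourier inversion. -/
theorem hasSum_fourier (f : smoothCircle ℂ) (x : ℝ) :
    HasSum (fun n : ℤ => circleCoeff f.1 n * Complex.exp (Complex.I * n * x)) (f.1 x) := by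
  have hcoe : ∀ n : ℤ, fourierCoeff (circleToC f) n = circleCoeff f.1 n := fun n => by
    rw [circleCoeff, fourierCoeffOn_eq_integral, fourierCoeff_eq_intervalIntegral _ n 0]
    simp only [zero_add, sub_zero]
    congr 1
    refine intervalIntegral.integral_congr fun y _ => ?_
    simp only [circleToC_coe, fourier_coe_apply, sub_zero]
  have hs : Summable (fourierCoeff (circleToC f)) := by
    refine Summable.of_norm ?_
    simp only [hcoe]
    exact summable_norm_circleCoeff f
  have h := has_pointwise_sum_fourier_series_of_summable hs (x : AddCircle (2 * π))
  rw [circleToC_coe] at h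
  refine h.congr_fun fun n => ?_
  rw [hcoe, smul_eq_mul, fourier_coe_apply]
  congr 2
  have hpi : (π : ℂ) ≠ 0 := by exact_mod_cast Real.pi_ne_zero
  push_cast
  field_simp

theorem eq_zero_of_circleCoeff {f : smoothCircle ℂ} (h : ∀ n, circleCoeff f.1 n = 0) : f = 0 := by
  ext x
  have := hasSum_fourier f x
  simp only [h, zero_mul] at this
  exact this.unique hasSum_zero

theorem conj_circleCoeff (g : ℝ → ℂ) (n : ℤ) : starRingEnd ℂ (circleCoeff g n) =
    circMean fun x => Complex.exp (Complex.I * n * x) * starRingEnd ℂ (g x) := by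
  rw [circleCoeff_eq_circMean, circMean, circMean, map_mul,
    ← intervalIntegral.intervalIntegral_conj]
  simp only [map_mul, ← Complex.exp_conj, map_neg, Complex.conj_I, Complex.conj_ofReal, map_intCast,
    map_inv₀, Complex.conj_ofNat, neg_mul, neg_neg]

/-- Parseval's identity. -/
theorem hasSum_parseval (f g : smoothCircle ℂ) :
    HasSum (fun k : ℤ => circleCoeff f.1 k * starRingEnd ℂ (circleCoeff g.1 k))
      (circMean fun x => f.1 x * starRingEnd ℂ (g.1 x)) := by
  obtain ⟨C, hC⟩ : ∃ C, ∀ x, ‖g.1 x‖ ≤ C := ⟨‖circleToC g‖, fun x => by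
    rw [← circleToC_coe g x]
    exact (circleToC g).norm_coe_le_norm _⟩
  simp only [conj_circleCoeff, ← circMean_const_mul, ← mul_assoc]
  refine hasSum_circMean (b := fun k => ‖circleCoeff f.1 k‖ * C) (fun k => ?_)
    ((summable_norm_circleCoeff f).mul_right C) (fun k x => ?_)
    fun x => (hasSum_fourier f x).mul_right _
  · have := g.2.1.continuous
    fun_prop
  · rw [norm_mul, norm_mul, norm_exp_I_mul, mul_one, RCLike.norm_conj]
    gcongr
    exact hC x

theorem circleCoeff_circleDeriv' (f : smoothCircle ℂ) (n : ℤ) :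
    circleCoeff (circleDeriv f).1 n = Complex.I * n * circleCoeff f.1 n := by
  rcases eq_or_ne n 0 with rfl | hn
  · have hp : f.1 (2 * π) = f.1 0 := by simpa using f.2.2 0
    have h1 : ∫ x in (0 : ℝ)..2 * π, deriv f.1 x = 0 := by
      rw [intervalIntegral.integral_deriv_eq_sub (fun y _ => f.2.1.differentiable (by simp) y)
        ((circleDeriv f).2.1.continuous.intervalIntegrable _ _), hp, sub_self]
    rw [circleCoeff_eq_circMean, circMean]
    simp only [Int.cast_zero, mul_zero, zero_mul, neg_zero, Complex.exp_zero, one_mul]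
    simp only [circleDeriv]
    rw [h1, mul_zero]
  · exact circleCoeff_circleDeriv f hn

/-- The Fourier coefficients of an absolutely convergent trigonometric series. -/
theorem circleCoeff_of_hasSum {c : ℤ → ℂ} (hc : Summable fun n => ‖c n‖) {F : ℝ → ℂ}
    (hF : ∀ x : ℝ, HasSum (fun n : ℤ => c n * Complex.exp (Complex.I * n * x)) (F x)) (k : ℤ) :
    circleCoeff F k = c k := by
  have h := hasSum_circleCoeff (b := fun n => ‖c n‖) (fun n => by fun_prop) hc (fun n x => by
    rw [norm_mul, norm_exp_I_mul, mul_one]) hF k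
  simp only [circleCoeff_const_mul, circleCoeff_exp, mul_ite, mul_one, mul_zero] at h
  exact h.unique (hasSum_ite_eq k (c k) |>.congr_fun fun n => by split_ifs with h <;> simp [h])

theorem circleCoeff_dnOp (f : smoothCircle ℂ) (k : ℤ) :
    circleCoeff (dnOp f).1 k = (k.natAbs : ℂ) * circleCoeff f.1 k := by
  have hn : ∀ n : ℤ, ‖((|n| : ℤ) : ℂ) * circleCoeff f.1 n‖ = |(n : ℝ)| ^ (0 + 1) *
      ‖circleCoeff f.1 n‖ := fun n => by
    rw [norm_mul, Complex.norm_intCast]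
    simp
  have hs : Summable fun n : ℤ => ‖((|n| : ℤ) : ℂ) * circleCoeff f.1 n‖ := by
    simp only [hn]
    exact summable_pow_mul_circleCoeff f 0
  rw [Nat.cast_natAbs]
  exact circleCoeff_of_hasSum hs (F := (dnOp f).1) (fun x => Summable.hasSum (Summable.of_norm (by
    simpa only [norm_mul, norm_exp_I_mul, mul_one] using hs))) k

/-- The sum of a Fourier series with rapidly decreasing coefficients. -/
def fourierSum (c : ℤ → ℂ) (hc : ∀ K : ℕ, Summable fun n : ℤ => (1 + |(n : ℝ)|) ^ K * ‖c n‖) :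
    smoothCircle ℂ :=
  ⟨fun x => ∑' n : ℤ, c n * Complex.exp (Complex.I * n * x), by
    refine contDiff_tsum (𝕜 := ℝ) (N := ⊤) (v := fun k (n : ℤ) => (1 + |(n : ℝ)|) ^ k * ‖c n‖)
      (fun n => ?_) (fun k _ => hc k) (fun k n x _ => ?_)
    · exact contDiff_const.mul (contDiff_const.mul Complex.ofRealCLM.contDiff).cexp
    · refine (norm_iteratedFDeriv_expI n _ k x).le.trans ?_
      gcongr
      linarith, fun x => by
    refine tsum_congr fun n => ?_
    congr 1
    rw [Complex.exp_eq_exp_iff_exists_int]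
    exact ⟨n, by push_cast; ring⟩⟩

theorem hasSum_fourierSum {c : ℤ → ℂ}
    (hc : ∀ K : ℕ, Summable fun n : ℤ => (1 + |(n : ℝ)|) ^ K * ‖c n‖) (x : ℝ) :
    HasSum (fun n : ℤ => c n * Complex.exp (Complex.I * n * x)) ((fourierSum c hc).1 x) := by
  refine Summable.hasSum (Summable.of_norm ?_)
  simpa only [norm_mul, norm_exp_I_mul, mul_one, pow_zero, one_mul] using hc 0

theorem circleCoeff_fourierSum {c : ℤ → ℂ}
    (hc : ∀ K : ℕ, Summable fun n : ℤ => (1 + |(n : ℝ)|) ^ K * ‖c n‖) (k : ℤ) :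
    circleCoeff (fourierSum c hc).1 k = c k :=
  circleCoeff_of_hasSum (by simpa using hc 0) (hasSum_fourierSum hc) k

/-! ### The arc length parameter of a density -/

/-- A smooth positive `2π`-periodic density of total mass `2π`. -/
structure Density (η : ℝ → ℝ) : Prop where
  contDiff : ContDiff ℝ ∞ η
  periodic : Function.Periodic η (2 * π)
  pos : ∀ x, 0 < η x
  integral : ∫ x in (0 : ℝ)..2 * π, η x = 2 * π

/-- The parameter `φ(x) = ∫_0^x η`. -/
def phase (η : ℝ → ℝ) (x : ℝ) : ℝ := ∫ y in (0 : ℝ)..x, η y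

namespace Density

variable {η : ℝ → ℝ} (D : Density η)
include D

theorem hasDerivAt_phase (x : ℝ) : HasDerivAt (phase η) (η x) x :=
  intervalIntegral.integral_hasDerivAt_right (D.contDiff.continuous.intervalIntegrable _ _)
    (D.contDiff.continuous.stronglyMeasurableAtFilter _ _) D.contDiff.continuous.continuousAt

theorem deriv_phase : deriv (phase η) = η := funext fun x => (D.hasDerivAt_phase x).deriv

theorem contDiff_phase : ContDiff ℝ ∞ (phase η) := by
  rw [contDiff_infty_iff_deriv, D.deriv_phase]
  exact ⟨fun x => (D.hasDerivAt_phase x).differentiableAt, D.contDiff⟩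

theorem phase_add_two_pi (x : ℝ) : phase η (x + 2 * π) = phase η x + 2 * π := by
  have h1 := D.periodic.intervalIntegral_add_eq x 0
  rw [zero_add, D.integral] at h1
  have h2 := intervalIntegral.integral_add_adjacent_intervals (μ := MeasureTheory.volume)
    (D.contDiff.continuous.intervalIntegrable 0 x)
    (D.contDiff.continuous.intervalIntegrable x (x + 2 * π))
  rw [phase, phase, ← h2, h1]

theorem strictMono_phase : StrictMono (phase η) :=
  strictMono_of_deriv_pos fun x => by rw [D.deriv_phase]; exact D.pos x

theorem phase_int (k : ℤ) : phase η (k * (2 * π)) = k * (2 * π) := by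
  have hp : Function.Periodic (fun x => phase η x - x) (2 * π) := fun x => by
    simp only [D.phase_add_two_pi]
    ring
  have h := hp.int_mul k 0
  simp only [zero_add, sub_zero, phase, intervalIntegral.integral_same] at h
  rw [phase]
  linarith

theorem surjective_phase : Function.Surjective (phase η) := fun y => by
  refine mem_range_of_exists_le_of_exists_ge D.contDiff_phase.continuous
    ⟨(⌊y / (2 * π)⌋ : ℤ) * (2 * π), ?_⟩ ⟨(⌈y / (2 * π)⌉ : ℤ) * (2 * π), ?_⟩
  · rw [D.phase_int, ← le_div_iff₀ Real.two_pi_pos]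
    exact Int.floor_le _
  · rw [D.phase_int, ← div_le_iff₀ Real.two_pi_pos]
    exact Int.le_ceil _

/-- The homeomorphism `φ`. -/
def phaseHomeo : ℝ ≃ₜ ℝ :=
  (StrictMono.orderIsoOfSurjective (phase η) D.strictMono_phase D.surjective_phase).toHomeomorph

theorem phaseHomeo_apply (x : ℝ) : D.phaseHomeo x = phase η x := rfl

theorem contDiff_symm : ContDiff ℝ ∞ D.phaseHomeo.symm :=
  D.phaseHomeo.contDiff_symm_deriv (f' := η) (fun x => (D.pos x).ne') D.hasDerivAt_phase
    D.contDiff_phase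

theorem symm_add_two_pi (y : ℝ) :
    D.phaseHomeo.symm (y + 2 * π) = D.phaseHomeo.symm y + 2 * π := by
  rw [D.phaseHomeo.symm_apply_eq, D.phaseHomeo_apply, D.phase_add_two_pi, ← D.phaseHomeo_apply,
    D.phaseHomeo.apply_symm_apply]

/-- The change of variables `f ↦ f ∘ φ⁻¹`. -/
def pull : smoothCircle ℂ →ₗ[ℂ] smoothCircle ℂ where
  toFun f := ⟨fun y => f.1 (D.phaseHomeo.symm y), f.2.1.comp D.contDiff_symm, fun y => by
    simp only [D.symm_add_two_pi, f.2.2 _]⟩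
  map_add' _ _ := rfl
  map_smul' _ _ := rfl

/-- The change of variables `f ↦ f ∘ φ`. -/
def push (f : smoothCircle ℂ) : smoothCircle ℂ :=
  ⟨fun x => f.1 (phase η x), f.2.1.comp D.contDiff_phase, fun x => by
    simp only [D.phase_add_two_pi, f.2.2 _]⟩

theorem pull_push (f : smoothCircle ℂ) : D.pull (D.push f) = f := by
  ext y
  change f.1 (phase η (D.phaseHomeo.symm y)) = f.1 y
  rw [← D.phaseHomeo_apply, D.phaseHomeo.apply_symm_apply]

theorem pull_phase (f : smoothCircle ℂ) (x : ℝ) : (D.pull f).1 (phase η x) = f.1 x := by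
  change f.1 (D.phaseHomeo.symm (phase η x)) = f.1 x
  rw [← D.phaseHomeo_apply, D.phaseHomeo.symm_apply_apply]

theorem pull_injective : Function.Injective D.pull := fun f g h => by
  ext x
  rw [← D.pull_phase f, ← D.pull_phase g, h]

theorem circMean_comp_phase {V : ℝ → ℂ} (hV : Continuous V) :
    circMean (fun x => η x * V (phase η x)) = circMean V := by
  have h := intervalIntegral.integral_deriv_smul_comp (a := 0) (b := 2 * π) (g := V)
    (fun x _ => D.hasDerivAt_phase x) D.contDiff.continuous.continuousOn hV
  have h0 : phase η 0 = 0 := by simp [phase]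
  have h1 : phase η (2 * π) = 2 * π := by simpa [h0] using D.phase_add_two_pi 0
  rw [h0, h1] at h
  rw [circMean, circMean, ← h]
  simp only [Complex.real_smul, Function.comp]

/-- The functions `e^{inφ}`, an orthonormal basis for the density `η`. -/
def expC (n : ℤ) : smoothCircle ℂ :=
  ⟨fun x => Complex.exp (Complex.I * n * phase η x),
    (contDiff_const.mul (Complex.ofRealCLM.contDiff.comp D.contDiff_phase)).cexp, fun x => by
    simp only [D.phase_add_two_pi]
    rw [Complex.exp_eq_exp_iff_exists_int]
    exact ⟨n, by push_cast; ring⟩⟩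

theorem expC_apply (n : ℤ) (x : ℝ) :
    (D.expC n).1 x = Complex.exp (Complex.I * n * phase η x) := rfl

theorem norm_expC (n : ℤ) (x : ℝ) : ‖(D.expC n).1 x‖ = 1 := norm_exp_I_mul n _

theorem conj_expC (n : ℤ) (x : ℝ) :
    starRingEnd ℂ ((D.expC n).1 x) = Complex.exp (-(Complex.I * n * phase η x)) := by
  rw [expC_apply, ← Complex.exp_conj]
  simp

theorem circleCoeff_pull (f : smoothCircle ℂ) (m : ℤ) :
    circleCoeff (D.pull f).1 m =
      circMean fun x => η x * (f.1 x * starRingEnd ℂ ((D.expC m).1 x)) := by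
  rw [circleCoeff_eq_circMean, ← D.circMean_comp_phase]
  · refine circMean_congr fun x => ?_
    rw [D.pull_phase, D.conj_expC]
    ring
  · have := (D.pull f).2.1.continuous
    fun_prop

/-- The Fourier coefficients of `e^{inφ}`. -/
def expCoeff (n k : ℤ) : ℂ := circleCoeff (D.expC n).1 k

theorem norm_expCoeff_le (n k : ℤ) : ‖D.expCoeff n k‖ ≤ 1 := by
  rw [expCoeff, circleCoeff_eq_circMean]
  exact norm_circMean_le fun x => by rw [norm_mul, norm_exp_neg_I_mul, one_mul, D.norm_expC]

theorem expCoeff_zero (k : ℤ) : D.expCoeff 0 k = if 0 = k then 1 else 0 := by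
  rw [← circleCoeff_exp 0 k, expCoeff]
  congr 1
  funext x
  simp [D.expC_apply]

/-- The matrix of `-i a ∂_θ` in the basis `e^{inφ}` is diagonal, since `a ∂_θ φ = 1`. -/
theorem hasSum_int_mul_expCoeff (m n : ℤ) :
    HasSum (fun k : ℤ => (k : ℂ) * (D.expCoeff n k * starRingEnd ℂ (D.expCoeff m k)))
      (if m = n then (n : ℂ) else 0) := by
  have h := (hasSum_parseval (circleDeriv (D.expC n)) (D.expC m)).mul_left (-Complex.I)
  have h1 : circMean (fun x => (circleDeriv (D.expC n)).1 x * starRingEnd ℂ ((D.expC m).1 x)) =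
      Complex.I * (if m = n then (n : ℂ) else 0) := by
    have hd : ∀ x, (circleDeriv (D.expC n)).1 x =
        Complex.I * n * η x * (D.expC n).1 x := fun x => by
      have h2 : HasDerivAt (fun x => (D.expC n).1 x)
          ((D.expC n).1 x * (Complex.I * n * η x)) x :=
        ((D.hasDerivAt_phase x).ofReal_comp.const_mul _).cexp
      change deriv (D.expC n).1 x = _
      rw [h2.deriv]
      ring
    have h3 : ∀ x, (circleDeriv (D.expC n)).1 x * starRingEnd ℂ ((D.expC m).1 x) =
        Complex.I * n * (η x * Complex.exp (Complex.I * (n - m : ℤ) * phase η x)) := fun x => by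
      rw [hd, D.conj_expC, D.expC_apply, mul_assoc _ (Complex.exp _), ← Complex.exp_add]
      push_cast
      ring_nf
    rw [circMean_congr h3, circMean_const_mul, D.circMean_comp_phase
      (V := fun y : ℝ => Complex.exp (Complex.I * (n - m : ℤ) * y)) (by fun_prop), circMean_exp]
    simp only [sub_eq_zero, eq_comm (a := n)]
    split_ifs <;> simp
  rw [h1, ← mul_assoc, neg_mul, Complex.I_mul_I, neg_neg, one_mul] at h
  refine h.congr_fun fun k => ?_
  rw [circleCoeff_circleDeriv']
  change _ = -Complex.I * (Complex.I * k * D.expCoeff n k * starRingEnd ℂ (D.expCoeff m k))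
  linear_combination (k * D.expCoeff n k * starRingEnd ℂ (D.expCoeff m k)) * Complex.I_sq

end Density

/-! ### The matrix of `aΛ` in the basis `e^{inφ}` -/

/-- The symbol `|k| - sgn(n) k` of the part of `Λ` that reverses orientation. -/
def kap (n k : ℤ) : ℂ := if n * k < 0 then 2 * (k.natAbs : ℂ) else 0

theorem kap_eq {n : ℤ} (hn : n ≠ 0) (k : ℤ) : kap n k = (k.natAbs : ℂ) - (n.sign : ℂ) * k := by
  unfold kap
  rcases lt_or_gt_of_ne hn with h | h
  · rw [Int.sign_eq_neg_one_of_neg h]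
    split_ifs with hk
    · have : 0 < k := by by_contra hk'; nlinarith
      obtain ⟨m, rfl⟩ := Int.eq_ofNat_of_zero_le this.le
      simp
      ring
    · have : k ≤ 0 := by by_contra hk'; exact hk (mul_neg_of_neg_of_pos h (by omega))
      obtain ⟨m, hm⟩ := Int.eq_ofNat_of_zero_le (a := -k) (by omega)
      obtain rfl : k = -m := by omega
      simp
  · rw [Int.sign_eq_one_of_pos h]
    split_ifs with hk
    · have : k < 0 := by by_contra hk'; nlinarith
      obtain ⟨m, hm⟩ := Int.eq_ofNat_of_zero_le (a := -k) (by omega)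
      obtain rfl : k = -m := by omega
      simp
      ring
    · have : 0 ≤ k := by by_contra hk'; exact hk (mul_neg_of_pos_of_neg h (by omega))
      obtain ⟨m, rfl⟩ := Int.eq_ofNat_of_zero_le this
      simp

theorem kap_zero_left (k : ℤ) : kap 0 k = 0 := by simp [kap]

theorem norm_kap_le (n k : ℤ) : ‖kap n k‖ ≤ 2 * (1 + |(k : ℝ)|) := by
  unfold kap
  split_ifs
  · rw [norm_mul, Complex.norm_natCast, Nat.cast_natAbs, Int.cast_abs]
    simp
  · rw [norm_zero]
    positivity

/-- The operator `aΛ`, which is conjugate to `Λ_a = a^{1/2} Λ a^{1/2}`. -/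
def weightedOp (a : PosCircle) (v : smoothCircle ℂ) : smoothCircle ℂ :=
  sqrtMulOp a (sqrtMulOp a (dnOp v))

theorem sqrtMulOp_sqrtMulOp (a : PosCircle) (v : smoothCircle ℂ) (x : ℝ) :
    (sqrtMulOp a (sqrtMulOp a v)).1 x = a.1.1 x * v.1 x := by
  change (√(a.1.1 x) : ℂ) * ((√(a.1.1 x) : ℂ) * v.1 x) = _
  rw [← mul_assoc, ← Complex.ofReal_mul, Real.mul_self_sqrt (a.2 x).le]

theorem sqrtMulOp_injective (a : PosCircle) : Function.Injective (sqrtMulOp a) := fun f g h => by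
  ext x
  have h1 : (√(a.1.1 x) : ℂ) * f.1 x = (√(a.1.1 x) : ℂ) * g.1 x :=
    congrFun (congrArg Subtype.val h) x
  refine mul_left_cancel₀ ?_ h1
  exact_mod_cast (Real.sqrt_pos.2 (a.2 x)).ne'

/-- The Fourier coefficients of a smooth function as an element of `ℓ²(ℤ)`. -/
def coeffVec : smoothCircle ℂ →ₗ[ℂ] HZ where
  toFun f := ⟨circleCoeff f.1, memlp_two_of_le (g := fun n => ‖circleCoeff f.1 n‖) (by
    obtain ⟨C, hC⟩ := norm_circleCoeff_bounded f
    refine Summable.of_nonneg_of_le (fun n => by positivity) (fun n => ?_)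
      ((summable_norm_circleCoeff f).mul_left C)
    rw [sq]
    exact mul_le_mul_of_nonneg_right (hC n) (norm_nonneg _)) fun _ => le_rfl⟩
  map_add' f g := by
    ext n
    exact circleCoeff_add f.2.1.continuous g.2.1.continuous n
  map_smul' c f := by
    ext n
    exact circleCoeff_smul c f.1 n

theorem coeffVec_apply (f : smoothCircle ℂ) (n : ℤ) : coeffVec f n = circleCoeff f.1 n := rfl

theorem coeffVec_injective : Function.Injective coeffVec := by
  rw [← LinearMap.ker_eq_bot, LinearMap.ker_eq_bot']
  intro f hf
  exact eq_zero_of_circleCoeff fun n => by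
    rw [← coeffVec_apply, hf]
    rfl

namespace Density

variable {η : ℝ → ℝ} (D : Density η)
include D

/-- The entry at `p = (m, n)` of the matrix of `aΛ - |n|` in the basis `e^{inφ}`. -/
def pertMat (p : ℤ × ℤ) : ℂ :=
  ∑' k : ℤ, kap p.2 k * (D.expCoeff p.2 k * starRingEnd ℂ (D.expCoeff p.1 k))

/-- The entry at `p = (m, n)` of the matrix of `aΛ` in the basis `e^{inφ}`. -/
def dnMat (p : ℤ × ℤ) : ℂ :=
  ∑' k : ℤ, (k.natAbs : ℂ) * (D.expCoeff p.2 k * starRingEnd ℂ (D.expCoeff p.1 k))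

theorem summable_natAbs_mul_expCoeff (n : ℤ) :
    Summable fun k : ℤ => ‖(k.natAbs : ℂ)‖ * ‖D.expCoeff n k‖ := by
  refine Summable.of_nonneg_of_le (fun k => by positivity) (fun k => ?_)
    (summable_weight_circleCoeff (D.expC n) 1)
  rw [pow_one, Complex.norm_natCast, Nat.cast_natAbs, Int.cast_abs]
  refine mul_le_mul_of_nonneg_right ?_ (norm_nonneg _)
  linarith

theorem hasSum_dnMat (p : ℤ × ℤ) :
    HasSum (fun k : ℤ => (k.natAbs : ℂ) * (D.expCoeff p.2 k * starRingEnd ℂ (D.expCoeff p.1 k)))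
      (D.dnMat p) := by
  refine Summable.hasSum (Summable.of_norm_bounded (D.summable_natAbs_mul_expCoeff p.2) fun k => ?_)
  rw [norm_mul, norm_mul, RCLike.norm_conj]
  exact mul_le_mul_of_nonneg_left
    (mul_le_of_le_one_right (norm_nonneg _) (D.norm_expCoeff_le _ _)) (norm_nonneg _)

theorem dnMat_herm (i j : ℤ) : D.dnMat (i, j) = starRingEnd ℂ (D.dnMat (j, i)) := by
  refine (D.hasSum_dnMat (i, j)).unique ?_
  refine ((D.hasSum_dnMat (j, i)).map (starRingEnd ℂ) Complex.continuous_conj).congr_fun fun k => ?_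
  simp only [Function.comp, map_mul, Complex.conj_natCast, Complex.conj_conj]
  ring

/-- The matrix of `aΛ` is `diag |n|` up to the terms with `kap`: subtract `sgn(n)` times the
diagonal matrix of `-i a ∂_θ`. -/
theorem hasSum_pertMat (p : ℤ × ℤ) :
    HasSum (fun k : ℤ => kap p.2 k * (D.expCoeff p.2 k * starRingEnd ℂ (D.expCoeff p.1 k)))
      (D.dnMat p - if p.1 = p.2 then (p.2.natAbs : ℂ) else 0) := by
  by_cases hn : p.2 = 0
  · have h0 : D.dnMat p = 0 := by
      refine (D.hasSum_dnMat p).unique (hasSum_zero.congr_fun fun k => ?_)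
      rw [hn, D.expCoeff_zero]
      by_cases hk : (0 : ℤ) = k
      · simp [← hk]
      · simp [hk]
    simp only [hn, kap_zero_left, zero_mul, h0, Int.natAbs_zero, Nat.cast_zero, ite_self, sub_zero]
    exact hasSum_zero
  · have h := (D.hasSum_dnMat p).sub
      ((D.hasSum_int_mul_expCoeff p.1 p.2).mul_left (p.2.sign : ℂ))
    have e : (p.2.sign : ℂ) * (if p.1 = p.2 then (p.2 : ℂ) else 0) =
        if p.1 = p.2 then (p.2.natAbs : ℂ) else 0 := by
      split_ifs
      · rw [← Int.cast_mul, Int.sign_mul_self_eq_natAbs]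
        simp
      · simp
    rw [e] at h
    refine h.congr_fun fun k => ?_
    rw [kap_eq hn]
    ring

theorem pertMat_eq (p : ℤ × ℤ) :
    D.pertMat p = D.dnMat p - if p.1 = p.2 then (p.2.natAbs : ℂ) else 0 :=
  (D.hasSum_pertMat p).tsum_eq

theorem pertMat_herm (i j : ℤ) : D.pertMat (i, j) = starRingEnd ℂ (D.pertMat (j, i)) := by
  rw [pertMat_eq, pertMat_eq, map_sub, ← D.dnMat_herm]
  congr 1
  by_cases h : i = j
  · simp [h]
  · simp [h, Ne.symm h]

theorem pertMat_zero_left (j : ℤ) : D.pertMat (0, j) = 0 := by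
  rw [D.pertMat_herm, pertMat]
  simp [kap_zero_left]

theorem hasSum_expC (v : smoothCircle ℂ) (x : ℝ) :
    HasSum (fun n : ℤ => circleCoeff (D.pull v).1 n * (D.expC n).1 x) (v.1 x) := by
  have := hasSum_fourier (D.pull v) (phase η x)
  rwa [D.pull_phase] at this

theorem hasSum_circleCoeff_expCoeff (v : smoothCircle ℂ) (k : ℤ) :
    HasSum (fun n : ℤ => circleCoeff (D.pull v).1 n * D.expCoeff n k) (circleCoeff v.1 k) := by
  have h := hasSum_circleCoeff (b := fun n => ‖circleCoeff (D.pull v).1 n‖)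
    (fun n => by have := (D.expC n).2.1.continuous; fun_prop)
    (summable_norm_circleCoeff (D.pull v)) (fun n x => by
    rw [norm_mul, D.norm_expC, mul_one]) (D.hasSum_expC v) k
  simp only [circleCoeff_const_mul] at h
  exact h

/-- The Fourier coefficients of `(aΛv) ∘ φ⁻¹` in terms of those of `v ∘ φ⁻¹`. -/
theorem hasSum_circleCoeff_weightedOp {a : PosCircle} (ha : ∀ x, η x = (a.1.1 x)⁻¹)
    (v : smoothCircle ℂ) (m : ℤ) :
    HasSum (fun n : ℤ => D.dnMat (m, n) * circleCoeff (D.pull v).1 n)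
      (circleCoeff (D.pull (weightedOp a v)).1 m) := by
  have h1 : circleCoeff (D.pull (weightedOp a v)).1 m =
      circMean fun x => (dnOp v).1 x * starRingEnd ℂ ((D.expC m).1 x) := by
    rw [D.circleCoeff_pull]
    refine circMean_congr fun x => ?_
    rw [weightedOp, sqrtMulOp_sqrtMulOp, ha]
    have : (a.1.1 x : ℂ) ≠ 0 := by exact_mod_cast (a.2 x).ne'
    push_cast
    field_simp
  have h2 := hasSum_parseval (dnOp v) (D.expC m)
  rw [← h1] at h2
  set F : ℤ × ℤ → ℂ := fun q => (q.1.natAbs : ℂ) * starRingEnd ℂ (D.expCoeff m q.1) *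
    (circleCoeff (D.pull v).1 q.2 * D.expCoeff q.2 q.1) with hF
  have hs : Summable F := by
    refine Summable.of_norm_bounded ((D.summable_natAbs_mul_expCoeff m).mul_of_nonneg
      (summable_norm_circleCoeff (D.pull v)) (fun k => by positivity) fun k => by positivity)
      fun q => ?_
    rw [hF]
    simp only [norm_mul, RCLike.norm_conj]
    exact mul_le_mul_of_nonneg_left
      (mul_le_of_le_one_right (norm_nonneg _) (D.norm_expCoeff_le _ _)) (by positivity)
  refine HasSum.swap_fiberwise hs (g := fun k => circleCoeff (dnOp v).1 k *
    starRingEnd ℂ (circleCoeff (D.expC m).1 k)) (fun k => ?_)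
    (h := fun n => D.dnMat (m, n) * circleCoeff (D.pull v).1 n) (fun n => ?_) h2
  · have h3 := (D.hasSum_circleCoeff_expCoeff v k).mul_left
      ((k.natAbs : ℂ) * starRingEnd ℂ (D.expCoeff m k))
    rw [circleCoeff_dnOp, mul_assoc, mul_comm (circleCoeff v.1 k), ← mul_assoc]
    exact h3
  · refine ((D.hasSum_dnMat (m, n)).mul_right _).congr_fun fun k => ?_
    simp only [hF]
    ring

variable (hR : RapidMat D.pertMat)
include hR

theorem summable_pertMat : Summable fun p => ‖D.pertMat p‖ := by simpa using hR 0

theorem circleCoeff_weightedOp {a : PosCircle} (ha : ∀ x, η x = (a.1.1 x)⁻¹)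
    (v : smoothCircle ℂ) (m : ℤ) : circleCoeff (D.pull (weightedOp a v)).1 m =
      (m.natAbs : ℂ) * coeffVec (D.pull v) m + opMat D.pertMat (coeffVec (D.pull v)) m := by
  have h1 := opMat_apply (D.summable_pertMat hR) (coeffVec (D.pull v)) m
  have h2 := (hasSum_ite_eq m ((m.natAbs : ℂ) * coeffVec (D.pull v) m)).add h1
  refine (D.hasSum_circleCoeff_weightedOp ha v m).unique (h2.congr_fun fun n => ?_)
  rw [D.pertMat_eq, ← coeffVec_apply]
  by_cases h : n = m
  · subst h
    simp
    ring
  · simp [h, Ne.symm h]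

/-- The equation of an eigenvector in terms of Fourier coefficients. -/
theorem weightedOp_eq_smul_iff {a : PosCircle} (ha : ∀ x, η x = (a.1.1 x)⁻¹)
    (v : smoothCircle ℂ) (μ : ℝ) :
    weightedOp a v = (μ : ℂ) • v ↔ coeffVec (D.pull v) ∈ eigM D.pertMat μ := by
  rw [mem_eigM, ← D.pull_injective.eq_iff, ← coeffVec_injective.eq_iff, map_smul, map_smul]
  constructor
  · intro h i
    rw [← D.circleCoeff_weightedOp hR ha, ← coeffVec_apply, h]
    rfl
  · intro h
    ext i
    rw [coeffVec_apply, D.circleCoeff_weightedOp hR ha, h i]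
    rfl

/-- The entries of an eigenvector of `diag |n| + R` decrease rapidly. -/
theorem summable_weight_of_mem_eigM {μ : ℝ} {w : HZ} (hw : w ∈ eigM D.pertMat μ) (K : ℕ) :
    Summable fun n : ℤ => (1 + |(n : ℝ)|) ^ K * ‖w n‖ := by
  have hs := D.summable_pertMat hR
  have hb : Summable fun n : ℤ => ∑' j, ‖D.pertMat (n, j)‖ * posWeight (n, j) ^ K := (hR K).prod
  -- For `|n| ≥ |μ| + 1` the eigenvalue equation bounds `w n` by the norm of row `n`.
  refine (hb.mul_right ‖w‖).of_norm_bounded_eventually ?_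
  have hfin : Set.Finite {n : ℤ | |(n : ℝ)| < |μ| + 1} := by
    obtain ⟨N, hN⟩ := exists_nat_gt (|μ| + 1)
    refine (Set.finite_Icc (-(N : ℤ)) N).subset fun n hn => ?_
    have h1 : |(n : ℝ)| < N := lt_trans hn hN
    have h2 : |n| < (N : ℤ) := by exact_mod_cast h1
    exact ⟨by have := (abs_lt.1 h2).1; omega, (abs_lt.1 h2).2.le⟩
  rw [Filter.eventually_cofinite]
  refine hfin.subset fun n hn => ?_
  by_contra hlt
  refine hn ?_
  have hn1 : |μ| + 1 ≤ |(n : ℝ)| := not_lt.1 hlt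
  have h1 := mem_eigM.1 hw n
  have h2 : ((μ : ℂ) - n.natAbs) * w n = opMat D.pertMat w n := by rw [sub_mul, ← h1]; ring
  have h3 : 1 ≤ ‖(μ : ℂ) - n.natAbs‖ := by
    have h4 : (n.natAbs : ℂ) = ((|(n : ℝ)| : ℝ) : ℂ) := by
      rw [← Int.cast_abs, Complex.ofReal_intCast, Nat.cast_natAbs]
    rw [h4, ← Complex.ofReal_sub, Complex.norm_real, Real.norm_eq_abs, abs_sub_comm]
    have := le_abs_self (|(n : ℝ)| - μ)
    have := le_abs_self μ
    linarith
  have h5 : ‖opMat D.pertMat w n‖ ≤ ∑' j, ‖D.pertMat (n, j)‖ * ‖w‖ := by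
    rw [← (opMat_apply hs w n).tsum_eq]
    refine tsum_of_norm_bounded ((hs.prod_factor n).mul_right _).hasSum fun j => ?_
    rw [norm_mul]
    exact mul_le_mul_of_nonneg_left (norm_coord_le w j) (norm_nonneg _)
  have h6 : ‖w n‖ ≤ ∑' j, ‖D.pertMat (n, j)‖ * ‖w‖ := by
    refine le_trans ?_ h5
    rw [← h2, norm_mul]
    exact le_mul_of_one_le_left (norm_nonneg _) h3
  rw [norm_mul, norm_norm, norm_pow, Real.norm_of_nonneg (by positivity)]
  refine (mul_le_mul_of_nonneg_left h6 (by positivity)).trans ?_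
  rw [tsum_mul_right, ← mul_assoc, ← tsum_mul_left]
  refine mul_le_mul_of_nonneg_right ?_ (norm_nonneg _)
  refine ((hs.prod_factor n).mul_left _).tsum_le_tsum (fun j => ?_) ((hR K).prod_factor n)
  rw [mul_comm]
  refine mul_le_mul_of_nonneg_left ?_ (norm_nonneg _)
  refine pow_le_pow_left₀ (by positivity) ?_ K
  exact le_mul_of_one_le_right (by positivity) (by simp)

/-- The eigenspaces of `Λ_a` and of `diag |n| + R` have the same dimensions. -/
theorem steklovMult_eq {a : PosCircle} (ha : ∀ x, η x = (a.1.1 x)⁻¹) {μ : ℝ} (hμ : μ ≠ 0) :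
    steklovMult a μ = Module.finrank ℂ (eigM D.pertMat μ) := by
  have hμ' : (μ : ℂ) ≠ 0 := by exact_mod_cast hμ
  set T : smoothCircle ℂ →ₗ[ℂ] HZ := coeffVec ∘ₗ D.pull ∘ₗ sqrtMulOp a with hT
  have hTi : Function.Injective T :=
    coeffVec_injective.comp (D.pull_injective.comp (sqrtMulOp_injective a))
  have hiff : ∀ u, u ∈ Module.End.eigenspace (steklovOp a) (μ : ℂ) ↔ T u ∈ eigM D.pertMat μ := by
    intro u
    rw [Module.End.mem_eigenspace_iff, hT, LinearMap.comp_apply, LinearMap.comp_apply,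
      ← D.weightedOp_eq_smul_iff hR ha, ← (sqrtMulOp_injective a).eq_iff, map_smul]
    rfl
  have hmap : (Module.End.eigenspace (steklovOp a) (μ : ℂ)).map T = eigM D.pertMat μ := by
    refine le_antisymm ?_ fun w hw => ?_
    · rintro _ ⟨u, hu, rfl⟩
      exact (hiff u).1 hu
    · have hc := D.summable_weight_of_mem_eigM hR hw
      set v := D.push (fourierSum w hc) with hv
      have hvw : coeffVec (D.pull v) = w := by
        ext n
        rw [coeffVec_apply, hv, D.pull_push, circleCoeff_fourierSum]
      have hve : weightedOp a v = (μ : ℂ) • v :=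
        (D.weightedOp_eq_smul_iff hR ha v μ).2 (hvw.symm ▸ hw)
      -- As `a Λ v = μ v` and `μ ≠ 0`, the function `v` lies in the image of `a^{1/2}`.
      have hTw : T ((μ : ℂ)⁻¹ • sqrtMulOp a (dnOp v)) = w := by
        have h1 : sqrtMulOp a ((μ : ℂ)⁻¹ • sqrtMulOp a (dnOp v)) = v := by
          rw [map_smul]
          change (μ : ℂ)⁻¹ • weightedOp a v = v
          rw [hve, inv_smul_smul₀ hμ']
        rw [hT, LinearMap.comp_apply, LinearMap.comp_apply, h1, hvw]
      exact ⟨_, (hiff _).2 (hTw.symm ▸ hw), hTw⟩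
  rw [steklovMult, ← hmap]
  exact (LinearEquiv.finrank_eq (Submodule.equivMapOfInjective T hTi _))

/-- If the perturbation is small, `zetaPert` of its matrix is the entire function `ζ_a - 2 ζ_R`. -/
theorem isSteklovZetaDiff {a : PosCircle} (ha : ∀ x, η x = (a.1.1 x)⁻¹)
    (hsmall : ∑' p, ‖D.pertMat p‖ ≤ 1 / 4) :
    IsSteklovZetaDiff a (zetaPert D.pertMat) where
  entire := differentiable_zetaPert hR
  hasSum s hs := by
    refine ((SmallHerm.hasSum_finrank_cpow ⟨D.summable_pertMat hR, hsmall, D.pertMat_herm⟩ hR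
      D.pertMat_zero_left hs)).congr_fun fun μ => ?_
    rw [D.steklovMult_eq hR ha (ne_of_gt μ.2)]

end Density

/-- Uniqueness of the continuation: by the identity theorem, an entire function is determined by
its values for `Re s > 1`. -/
theorem IsSteklovZetaDiff.eq_steklovZetaDiff {a : PosCircle} {F : ℂ → ℂ}
    (h : IsSteklovZetaDiff a F) : steklovZetaDiff a = F := by
  have hex : ∃ F, IsSteklovZetaDiff a F := ⟨F, h⟩
  have h' : IsSteklovZetaDiff a (steklovZetaDiff a) := by
    rw [steklovZetaDiff, dif_pos hex]
    exact hex.choose_spec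
  refine AnalyticOnNhd.eq_of_eventuallyEq (𝕜 := ℂ) (z₀ := 2)
    (fun z _ => h'.entire.analyticAt z) (fun z _ => h.entire.analyticAt z) ?_
  filter_upwards [(isOpen_lt continuous_const Complex.continuous_re).mem_nhds
    (show (1 : ℝ) < (2 : ℂ).re by norm_num)] with s hs
  exact add_left_cancel ((h'.hasSum s hs).unique (h.hasSum s hs))

/-! ### Oscillatory integrals along a variation of the density -/

theorem hasDerivAt_intervalIntegral_param {E : Type*} [NormedAddCommGroup E] [NormedSpace ℝ E]
    {F F' : ℝ → ℝ → E} (hF : ∀ t, Continuous (F t)) (hF' : ∀ t, Continuous (F' t))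
    {C : ℝ} (hC : ∀ t x, ‖F' t x‖ ≤ C) (hd : ∀ t x, HasDerivAt (fun t => F t x) (F' t x) t)
    (a b t : ℝ) : HasDerivAt (fun t => ∫ x in a..b, F t x) (∫ x in a..b, F' t x) t :=
  (intervalIntegral.hasDerivAt_integral_of_dominated_loc_of_deriv_le (s := univ)
    (bound := fun _ => C) univ_mem (Eventually.of_forall fun t => (hF t).aestronglyMeasurable)
    ((hF t).intervalIntegrable _ _) (hF' t).aestronglyMeasurable
    (Eventually.of_forall fun x _ t _ => hC t x) intervalIntegrable_const
    (Eventually.of_forall fun x _ t _ => hd t x)).2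

theorem hasDerivAt_circleCoeff {F F' : ℝ → ℝ → ℂ} (hF : ∀ t, Continuous (F t))
    (hF' : ∀ t, Continuous (F' t)) {C : ℝ} (hC : ∀ t x, ‖F' t x‖ ≤ C)
    (hd : ∀ t x, HasDerivAt (fun t => F t x) (F' t x) t) (k : ℤ) (t : ℝ) :
    HasDerivAt (fun t => circleCoeff (F t) k) (circleCoeff (F' t) k) t := by
  simp only [circleCoeff_eq_circMean, circMean]
  refine (hasDerivAt_intervalIntegral_param (C := C) (fun t => by have := hF t; fun_prop)
    (fun t => by have := hF' t; fun_prop) (fun t x => ?_)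
    (fun t x => (hd t x).const_mul _) 0 (2 * π) t).const_mul _
  rw [norm_mul, norm_exp_neg_I_mul, one_mul]
  exact hC t x

theorem SmoothFam.contDiff {P : Type*} {g : P → ℝ → ℝ} (hg : SmoothFam g) (p : P) :
    ContDiff ℝ ∞ (g p) := by
  have h : ∀ (k : ℕ) {g : P → ℝ → ℝ}, BddFam k g → ContDiff ℝ k (g p) := by
    intro k
    induction k with
    | zero => exact fun h => contDiff_zero.2 (h.2.2 p)
    | succ k ih =>
      intro g h
      rw [Nat.cast_succ, contDiff_succ_iff_deriv]
      exact ⟨h.2.1 p, by simp, ih h.2.2⟩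
  exact contDiff_infty.2 fun k => h k (hg k)

namespace DensVar

variable {η η₁ η₂ : ℝ → ℝ → ℝ} (V : DensVar η η₁ η₂)
include V

theorem density (t : ℝ) : Density (η t) := by
  obtain ⟨c, hc, hcη⟩ := V.lower
  exact ⟨V.smooth.contDiff t, V.smooth.periodic t, fun x => hc.trans_le (hcη t x), V.integral t⟩

theorem hasDerivAt_phase (x t : ℝ) :
    HasDerivAt (fun t => phase (η t) x) (phase (η₁ t) x) t := by
  obtain ⟨C, -, hC⟩ := V.smooth₁.bound
  exact hasDerivAt_intervalIntegral_param V.smooth.continuous V.smooth₁.continuous hC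
    V.hasDerivAt 0 x t

theorem hasDerivAt_phase₁ (x t : ℝ) :
    HasDerivAt (fun t => phase (η₁ t) x) (phase (η₂ t) x) t := by
  obtain ⟨C, -, hC⟩ := V.smooth₂.bound
  exact hasDerivAt_intervalIntegral_param V.smooth₁.continuous V.smooth₂.continuous hC
    V.hasDerivAt₁ 0 x t

theorem integral₁ (t : ℝ) : ∫ x in (0 : ℝ)..2 * π, η₁ t x = 0 := by
  have h1 := V.hasDerivAt_phase (2 * π) t
  have h2 : (fun t => phase (η t) (2 * π)) = fun _ => 2 * π := funext V.integral
  rw [h2] at h1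
  exact h1.unique (hasDerivAt_const t _)

theorem integral₂ (t : ℝ) : ∫ x in (0 : ℝ)..2 * π, η₂ t x = 0 := by
  have h1 := V.hasDerivAt_phase₁ (2 * π) t
  have h2 : (fun t => phase (η₁ t) (2 * π)) = fun _ => 0 := funext V.integral₁
  rw [h2] at h1
  exact h1.unique (hasDerivAt_const t _)

theorem smooth_phase₁ : SmoothFam fun t => phase (η₁ t) := V.smooth₁.primitive V.integral₁

theorem smooth_phase₂ : SmoothFam fun t => phase (η₂ t) := V.smooth₂.primitive V.integral₂

theorem continuous_phase (t : ℝ) : Continuous (phase (η t)) :=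
  (V.density t).contDiff_phase.continuous

/-- The oscillatory integral `(2π)⁻¹ ∫ g e^{i(nφ - kx)}`. -/
def oscInt (_ : DensVar η η₁ η₂) (g : ℝ → ℝ → ℂ) (n k : ℤ) (t : ℝ) : ℂ :=
  circleCoeff (fun x => g t x * Complex.exp (Complex.I * n * phase (η t) x)) k

theorem hasDerivAt_oscInt {g g₁ : ℝ → ℝ → ℂ} (hg : SmoothFam g) (hg₁ : SmoothFam g₁)
    (hd : ∀ t x, HasDerivAt (fun t => g t x) (g₁ t x) t) (n k : ℤ) (t : ℝ) :
    HasDerivAt (V.oscInt g n k) (V.oscInt g₁ n k t +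
      Complex.I * n * V.oscInt (fun t x => g t x * phase (η₁ t) x) n k t) t := by
  obtain ⟨A, hA0, hA⟩ := hg.bound
  obtain ⟨B, hB0, hB⟩ := hg₁.bound
  obtain ⟨C, hC0, hC⟩ := V.smooth_phase₁.bound
  have hE : ∀ t, Continuous fun x : ℝ => Complex.exp (Complex.I * n * phase (η t) x) := fun t => by
    have := V.continuous_phase t
    fun_prop
  have hp : ∀ t, Continuous fun x : ℝ => (phase (η₁ t) x : ℂ) := fun t =>
    Complex.continuous_ofReal.comp (V.smooth_phase₁.continuous t)
  have h := hasDerivAt_circleCoeff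
    (F := fun t x => g t x * Complex.exp (Complex.I * n * phase (η t) x))
    (F' := fun t x => g₁ t x * Complex.exp (Complex.I * n * phase (η t) x) + Complex.I * n *
      (g t x * phase (η₁ t) x * Complex.exp (Complex.I * n * phase (η t) x)))
    (C := B + ‖(n : ℂ)‖ * (A * C))
    (fun t => (hg.continuous t).mul (hE t))
    (fun t => ((hg₁.continuous t).mul (hE t)).add
      (continuous_const.mul (((hg.continuous t).mul (hp t)).mul (hE t))))
    (fun t x => ?_) (fun t x => ?_) k t
  · refine h.congr_deriv ?_
    have h1 := circleCoeff_add
      (f := fun x => g₁ t x * Complex.exp (Complex.I * n * phase (η t) x))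
      (g := fun x => Complex.I * n *
        (g t x * phase (η₁ t) x * Complex.exp (Complex.I * n * phase (η t) x)))
      ((hg₁.continuous t).mul (hE t))
      (continuous_const.mul (((hg.continuous t).mul (hp t)).mul (hE t))) k
    rw [circleCoeff_const_mul] at h1
    exact h1
  · refine (norm_add_le _ _).trans ?_
    simp only [norm_mul, norm_exp_I_mul, mul_one, Complex.norm_I, one_mul, Complex.norm_real]
    gcongr
    · exact hB t x
    · exact hA t x
    · exact hC t x
  · refine ((hd t x).fun_mul
      (((V.hasDerivAt_phase x t).ofReal_comp.const_mul (Complex.I * n)).cexp)).congr_deriv ?_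
    ring

theorem norm_oscInt_le {g : ℝ → ℝ → ℂ} {C : ℝ} (hC : ∀ t x, ‖g t x‖ ≤ C) (n k : ℤ) (t : ℝ) :
    ‖V.oscInt g n k t‖ ≤ C := by
  rw [oscInt, circleCoeff_eq_circMean]
  refine norm_circMean_le fun x => ?_
  rw [norm_mul, norm_mul, norm_exp_neg_I_mul, norm_exp_I_mul, one_mul, mul_one]
  exact hC t x

/-- If `n` and `k` have opposite signs, the phase `nφ - kx` has no stationary points. -/
theorem oscInt_decay {g : ℝ → ℝ → ℂ} (hg : SmoothFam g) (M : ℕ) :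
    ∃ C, ∀ n k t, n * k ≤ 0 → posWeight (n, k) ^ M * ‖V.oscInt g n k t‖ ≤ C := by
  obtain ⟨C₀, hC₀, hgC⟩ := hg.bound
  obtain ⟨c, hc, hcη⟩ := V.lower
  let P := {q : (ℤ × ℤ) × ℝ // q.1.1 * q.1.2 ≤ 0 ∧ 0 < |(q.1.1 : ℝ)| + |(q.1.2 : ℝ)|}
  let N : P → ℝ := fun q => |(q.1.1.1 : ℝ)| + |(q.1.1.2 : ℝ)|
  have hN : ∀ q, 0 < N q := fun q => q.2.2
  let F : P → ℝ → ℝ := fun q x => (q.1.1.1 : ℝ) / N q * η q.1.2 x + -(q.1.1.2 : ℝ) / N q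
  let Θ : P → ℝ → ℝ := fun q x => q.1.1.1 * phase (η q.1.2) x - q.1.1.2 * x
  have hF : SmoothFam F := by
    refine ((SmoothFam.const (c := fun q : P => (q.1.1.1 : ℝ) / N q) (C := 1) fun q => ?_).mul
      (V.smooth.comp fun q : P => q.1.2)).add
      (SmoothFam.const (c := fun q : P => -(q.1.1.2 : ℝ) / N q) (C := 1) fun q => ?_)
    · rw [norm_div, Real.norm_of_nonneg (hN q).le, Real.norm_eq_abs, div_le_one (hN q)]
      exact le_add_of_nonneg_right (abs_nonneg _)
    · rw [norm_div, Real.norm_of_nonneg (hN q).le, Real.norm_eq_abs, div_le_one (hN q), abs_neg]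
      exact le_add_of_nonneg_left (abs_nonneg _)
  have hNF : ∀ q x, N q * F q x = q.1.1.1 * η q.1.2 x - q.1.1.2 := fun q x => by
    have := (hN q).ne'
    simp only [F]
    field_simp
    ring
  have hcF : ∀ q x, min c 1 ≤ |F q x| := fun q x => by
    rw [← mul_le_mul_iff_right₀ (hN q), ← abs_of_pos (hN q), ← abs_mul, abs_of_pos (hN q), hNF]
    have h1 : (q.1.1.1 : ℝ) * q.1.1.2 ≤ 0 := by exact_mod_cast q.2.1
    have h2 := hcη q.1.2 x
    have h3 : min c 1 ≤ c := min_le_left _ _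
    have h4 : min c 1 ≤ 1 := min_le_right _ _
    have h5 : |(q.1.1.1 : ℝ) * η q.1.2 x - q.1.1.2| =
        |(q.1.1.1 : ℝ)| * η q.1.2 x + |(q.1.1.2 : ℝ)| := by
      have hη : 0 < η q.1.2 x := hc.trans_le h2
      rcases le_total 0 (q.1.1.1 : ℝ) with h | h
      · rcases h.eq_or_lt with h0 | h0
        · rw [← h0]; simp
        · have : (q.1.1.2 : ℝ) ≤ 0 := by by_contra hk; nlinarith
          rw [abs_of_nonneg h, abs_of_nonpos this, abs_of_nonneg (by nlinarith)]
          ring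
      · rcases h.eq_or_lt with h0 | h0
        · rw [h0]; simp
        · have : 0 ≤ (q.1.1.2 : ℝ) := by by_contra hk; nlinarith
          rw [abs_of_nonpos h, abs_of_nonneg this, abs_of_nonpos (by nlinarith)]
          ring
    rw [h5, add_mul]
    refine add_le_add (mul_le_mul_of_nonneg_left (h3.trans h2) (abs_nonneg _)) ?_
    exact mul_le_of_le_one_right (abs_nonneg _) h4
  have hΘ : ∀ q x, HasDerivAt (Θ q) (N q * F q x) x := fun q x => by
    rw [hNF]
    exact ((((V.density q.1.2).hasDerivAt_phase x).const_mul (q.1.1.1 : ℝ)).fun_sub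
      ((hasDerivAt_id x).const_mul (q.1.1.2 : ℝ))).congr_deriv (by rw [mul_one])
  have hper : ∀ q, Complex.exp (Complex.I * Θ q (2 * π)) = Complex.exp (Complex.I * Θ q 0) :=
    fun q => by
    have h1 : phase (η q.1.2) (2 * π) = 2 * π := V.integral q.1.2
    have h0 : phase (η q.1.2) 0 = 0 := by simp [phase]
    simp only [Θ, h1, h0]
    rw [Complex.exp_eq_exp_iff_exists_int]
    exact ⟨q.1.1.1 - q.1.1.2, by push_cast; ring⟩
  obtain ⟨C, hC⟩ := nonstationary_phase (lt_min hc one_pos) (fun q => (hN q).le) hF hcF hΘ hper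
    (2 * M) (hg.comp fun q : P => q.1.2)
  refine ⟨max C₀ (2 ^ (2 * M) * ((2 * π)⁻¹ * C)), fun n k t hnk => ?_⟩
  have hosc := V.norm_oscInt_le hgC n k t
  rcases (add_nonneg (abs_nonneg (n : ℝ)) (abs_nonneg (k : ℝ))).eq_or_lt with h0 | h0
  · refine le_trans ?_ (le_max_left _ _)
    have hn : |(n : ℝ)| = 0 := by linarith [abs_nonneg (n : ℝ), abs_nonneg (k : ℝ)]
    have hk : |(k : ℝ)| = 0 := by linarith [abs_nonneg (n : ℝ), abs_nonneg (k : ℝ)]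
    simpa [posWeight, hn, hk] using hosc
  · refine le_trans ?_ (le_max_right _ _)
    have h1 : (1 : ℝ) ≤ |(n : ℝ)| + |(k : ℝ)| := by
      have : (0 : ℝ) < ((|n| + |k| : ℤ) : ℝ) := by push_cast; exact h0
      have h2 : 0 < |n| + |k| := by exact_mod_cast this
      have : (1 : ℝ) ≤ ((|n| + |k| : ℤ) : ℝ) := by exact_mod_cast h2
      simpa using this
    have hw : posWeight (n, k) ≤ (2 * (|(n : ℝ)| + |(k : ℝ)|)) ^ 2 := by
      unfold posWeight
      nlinarith [abs_nonneg (n : ℝ), abs_nonneg (k : ℝ)]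
    have hw0 : 0 ≤ posWeight (n, k) := zero_le_one.trans (one_le_posWeight _)
    have h2 := hC ⟨((n, k), t), hnk, h0⟩
    have h3 : ‖V.oscInt g n k t‖ = (2 * π)⁻¹ *
        ‖∫ x in (0 : ℝ)..2 * π, g t x * Complex.exp (Complex.I *
          ((n * phase (η t) x - k * x : ℝ) : ℂ))‖ := by
      rw [oscInt, circleCoeff_eq_circMean, circMean, norm_mul, norm_inv]
      congr 1
      · congr 1
        rw [show (2 * π : ℂ) = ((2 * π : ℝ) : ℂ) by push_cast; rfl, Complex.norm_real,
          Real.norm_of_nonneg Real.two_pi_pos.le]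
      · congr 1
        refine intervalIntegral.integral_congr fun x _ => ?_
        rw [mul_left_comm, ← Complex.exp_add]
        push_cast
        ring_nf
    calc posWeight (n, k) ^ M * ‖V.oscInt g n k t‖
        ≤ ((2 * (|(n : ℝ)| + |(k : ℝ)|)) ^ 2) ^ M * ‖V.oscInt g n k t‖ := by gcongr
      _ = 2 ^ (2 * M) * ((|(n : ℝ)| + |(k : ℝ)|) ^ (2 * M) * ‖V.oscInt g n k t‖) := by
          rw [← pow_mul, mul_pow, mul_assoc]
      _ = 2 ^ (2 * M) * ((2 * π)⁻¹ * ((|(n : ℝ)| + |(k : ℝ)|) ^ (2 * M) *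
          ‖∫ x in (0 : ℝ)..2 * π, g t x * Complex.exp (Complex.I *
          ((n * phase (η t) x - k * x : ℝ) : ℂ))‖)) := by rw [h3]; ring
      _ ≤ _ := by
          have := Real.two_pi_pos
          gcongr

end DensVar

/-! ### The variation of the matrix of `aΛ` -/

theorem one_le_weight (n : ℤ) : (1 : ℝ) ≤ 1 + |(n : ℝ)| := le_add_of_nonneg_right (abs_nonneg _)

theorem summable_inv_weight_sq : Summable fun n : ℤ => ((1 + |(n : ℝ)|) ^ 2)⁻¹ := by
  have h := ((Real.summable_one_div_int_pow (p := 2)).2 one_lt_two).add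
    (hasSum_ite_eq (0 : ℤ) (1 : ℝ)).summable
  refine Summable.of_nonneg_of_le (fun n => by positivity) (fun n => ?_) h
  rcases eq_or_ne n 0 with rfl | hn
  · simp
  · rw [if_neg hn, add_zero, one_div, ← sq_abs (n : ℝ)]
    have : 0 < |(n : ℝ)| := by positivity
    gcongr
    linarith

theorem summable_inv_posWeight_sq : Summable fun p => (posWeight p ^ 2)⁻¹ := by
  refine (summable_inv_weight_sq.mul_of_nonneg summable_inv_weight_sq (fun _ => by positivity)
    fun _ => by positivity).congr fun p => ?_
  rw [posWeight, mul_pow, mul_inv]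

/-- Bounds for a family of coefficients `f n k t`: they grow at most quadratically in `n`, and
decrease rapidly when `n` and `k` have opposite signs. -/
structure OscBound (f : ℤ → ℤ → ℝ → ℂ) : Prop where
  poly : ∃ C, ∀ n k t, ‖f n k t‖ ≤ C * (1 + |(n : ℝ)|) ^ 2
  decay : ∀ M : ℕ, ∃ C, ∀ n k t, n * k ≤ 0 → posWeight (n, k) ^ M * ‖f n k t‖ ≤ C

theorem OscBound.add {f g : ℤ → ℤ → ℝ → ℂ} (hf : OscBound f) (hg : OscBound g) :
    OscBound fun n k t => f n k t + g n k t := by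
  refine ⟨?_, fun M => ?_⟩
  · obtain ⟨C, hC⟩ := hf.poly
    obtain ⟨D, hD⟩ := hg.poly
    refine ⟨C + D, fun n k t => (norm_add_le _ _).trans ?_⟩
    rw [add_mul]
    exact add_le_add (hC n k t) (hD n k t)
  · obtain ⟨C, hC⟩ := hf.decay M
    obtain ⟨D, hD⟩ := hg.decay M
    refine ⟨C + D, fun n k t hnk => ?_⟩
    have hw := one_le_posWeight (n, k)
    refine (mul_le_mul_of_nonneg_left (norm_add_le _ _) (by positivity)).trans ?_
    rw [mul_add]
    exact add_le_add (hC n k t hnk) (hD n k t hnk)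

/-- The sum over `k` of products of two families of coefficients that gives the matrix of the
perturbation. -/
def oscSum (f g : ℤ → ℤ → ℝ → ℂ) (t : ℝ) (p : ℤ × ℤ) : ℂ :=
  ∑' k : ℤ, kap p.2 k * (f p.2 k t * starRingEnd ℂ (g p.1 k t))

/-- The entry at `(m, n)` is `O((1 + |m|)²)` and decreases rapidly in `n`. -/
def RowBound (R : ℝ → ℤ × ℤ → ℂ) : Prop :=
  ∀ M : ℕ, ∃ C, 0 ≤ C ∧ ∀ t p, (1 + |(p.2 : ℝ)|) ^ M * ‖R t p‖ ≤ C * (1 + |(p.1 : ℝ)|) ^ 2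

theorem RowBound.add {R S : ℝ → ℤ × ℤ → ℂ} (hR : RowBound R) (hS : RowBound S) :
    RowBound fun t p => R t p + S t p := fun M => by
  obtain ⟨C, hC0, hC⟩ := hR M
  obtain ⟨D, hD0, hD⟩ := hS M
  refine ⟨C + D, add_nonneg hC0 hD0, fun t p => ?_⟩
  refine (mul_le_mul_of_nonneg_left (norm_add_le _ _) (by positivity)).trans ?_
  rw [mul_add, add_mul]
  exact add_le_add (hC t p) (hD t p)

/-- For Hermitian matrices, decay in one index gives decay in both: multiply the bounds for the
entries at `p` and at `p.swap`, which have the same absolute value. -/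
theorem RowBound.norm_le {R : ℝ → ℤ × ℤ → ℂ} (hR : RowBound R)
    (hH : ∀ t i j, R t (i, j) = starRingEnd ℂ (R t (j, i))) (K : ℕ) :
    ∃ C, 0 ≤ C ∧ ∀ t p, ‖R t p‖ * posWeight p ^ K ≤ C * (posWeight p ^ 2)⁻¹ := by
  obtain ⟨C, hC0, hC⟩ := hR (2 * K + 6)
  refine ⟨C, hC0, fun t p => ?_⟩
  have h1 := hC t p
  have h2 := hC t p.swap
  have h3 : ‖R t p.swap‖ = ‖R t p‖ := by rw [Prod.swap, hH, RCLike.norm_conj]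
  rw [h3, Prod.fst_swap, Prod.snd_swap] at h2
  have hw : posWeight p = (1 + |(p.1 : ℝ)|) * (1 + |(p.2 : ℝ)|) := rfl
  have hw1 := one_le_posWeight p
  have h4 := mul_le_mul h1 h2 (by positivity) (by positivity)
  have h5 : (‖R t p‖ * posWeight p ^ (K + 2)) ^ 2 * posWeight p ^ 2 ≤ C ^ 2 * posWeight p ^ 2 := by
    calc _ = (1 + |(p.2 : ℝ)|) ^ (2 * K + 6) * ‖R t p‖ *
          ((1 + |(p.1 : ℝ)|) ^ (2 * K + 6) * ‖R t p‖) := by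
          rw [hw]
          generalize 1 + |(p.1 : ℝ)| = x
          generalize 1 + |(p.2 : ℝ)| = y
          ring
      _ ≤ _ := h4
      _ = _ := by rw [hw]; ring
  have h6 := le_of_mul_le_mul_right h5 (by positivity)
  have h7 := abs_le_of_sq_le_sq h6 hC0
  rw [← div_eq_mul_inv, le_div_iff₀ (by positivity), mul_assoc, ← pow_add]
  exact (le_abs_self _).trans h7

section

variable {f g f₁ g₁ : ℤ → ℤ → ℝ → ℂ}

/-- Only those `k` with sign opposite to that of `n` contribute to `oscSum`, and there the first
factor decreases rapidly in `n` and `k`. -/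
theorem OscBound.norm_term_le (hf : OscBound f) (hg : OscBound g) (M : ℕ) :
    ∃ C, 0 ≤ C ∧ ∀ (p : ℤ × ℤ) (k : ℤ) (t : ℝ),
      (1 + |(p.2 : ℝ)|) ^ M * ‖kap p.2 k * (f p.2 k t * starRingEnd ℂ (g p.1 k t))‖ ≤
        C * (1 + |(p.1 : ℝ)|) ^ 2 * ((1 + |(k : ℝ)|) ^ 2)⁻¹ := by
  obtain ⟨A, hA⟩ := hf.decay (M + 3)
  obtain ⟨B, hB⟩ := hg.poly
  have hA0 : 0 ≤ A := le_trans (by have := one_le_posWeight (0, 0); positivity) (hA 0 0 0 (by simp))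
  have hB0 : 0 ≤ B := by simpa using (norm_nonneg _).trans (hB 0 0 0)
  refine ⟨2 * A * B, by positivity, fun p k t => ?_⟩
  have hn := one_le_weight p.2
  have hk := one_le_weight k
  by_cases h : p.2 * k < 0
  · have h1 := hA p.2 k t h.le
    have h2 : (1 + |(p.2 : ℝ)|) ^ M * (1 + |(k : ℝ)|) ^ 3 ≤ posWeight (p.2, k) ^ (M + 3) := by
      rw [posWeight, mul_pow]
      refine mul_le_mul (pow_le_pow_right₀ hn (by omega)) (pow_le_pow_right₀ hk (by omega))
        (by positivity) (by positivity)
    rw [← div_eq_mul_inv, le_div_iff₀ (by positivity), norm_mul, norm_mul, RCLike.norm_conj]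
    calc (1 + |(p.2 : ℝ)|) ^ M * (‖kap p.2 k‖ * (‖f p.2 k t‖ * ‖g p.1 k t‖)) * (1 + |(k : ℝ)|) ^ 2
        ≤ (1 + |(p.2 : ℝ)|) ^ M * (2 * (1 + |(k : ℝ)|) * (‖f p.2 k t‖ *
          (B * (1 + |(p.1 : ℝ)|) ^ 2))) * (1 + |(k : ℝ)|) ^ 2 := by
          gcongr
          · exact norm_kap_le _ _
          · exact hB _ _ _
      _ = 2 * B * (1 + |(p.1 : ℝ)|) ^ 2 *
          ((1 + |(p.2 : ℝ)|) ^ M * (1 + |(k : ℝ)|) ^ 3 * ‖f p.2 k t‖) := by ring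
      _ ≤ 2 * B * (1 + |(p.1 : ℝ)|) ^ 2 * (posWeight (p.2, k) ^ (M + 3) * ‖f p.2 k t‖) := by
          gcongr
      _ ≤ 2 * B * (1 + |(p.1 : ℝ)|) ^ 2 * A := by gcongr
      _ = _ := by ring
  · rw [kap, if_neg h, zero_mul, norm_zero, mul_zero]
    positivity

theorem OscBound.hasSum_oscSum (hf : OscBound f) (hg : OscBound g) (t : ℝ) (p : ℤ × ℤ) :
    HasSum (fun k : ℤ => kap p.2 k * (f p.2 k t * starRingEnd ℂ (g p.1 k t))) (oscSum f g t p) := by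
  obtain ⟨C, hC0, hC⟩ := hf.norm_term_le hg 0
  refine Summable.hasSum (Summable.of_norm_bounded
    (summable_inv_weight_sq.mul_left (C * (1 + |(p.1 : ℝ)|) ^ 2)) fun k => ?_)
  simpa only [pow_zero, one_mul] using hC p k t

theorem OscBound.rowBound (hf : OscBound f) (hg : OscBound g) : RowBound (oscSum f g) := fun M => by
  obtain ⟨C, hC0, hC⟩ := hf.norm_term_le hg M
  have hS : 0 ≤ ∑' n : ℤ, ((1 + |(n : ℝ)|) ^ 2)⁻¹ := tsum_nonneg fun n => by positivity
  refine ⟨C * ∑' n : ℤ, ((1 + |(n : ℝ)|) ^ 2)⁻¹, mul_nonneg hC0 hS, fun t p => ?_⟩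
  have hw : 0 < (1 + |(p.2 : ℝ)|) ^ M := by positivity
  have h1 : ‖oscSum f g t p‖ ≤ ∑' k : ℤ, ((1 + |(p.2 : ℝ)|) ^ M)⁻¹ *
      (C * (1 + |(p.1 : ℝ)|) ^ 2 * ((1 + |(k : ℝ)|) ^ 2)⁻¹) :=
    tsum_of_norm_bounded ((summable_inv_weight_sq.mul_left _).mul_left _).hasSum fun k => by
      rw [inv_mul_eq_div, le_div_iff₀ hw, mul_comm]
      exact hC p k t
  rw [tsum_mul_left, tsum_mul_left, inv_mul_eq_div, le_div_iff₀ hw] at h1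
  rw [mul_comm]
  exact h1.trans_eq (by ring)

theorem HasDerivAt.conj_comp {u : ℝ → ℂ} {u' : ℂ} {t : ℝ} (h : HasDerivAt u u' t) :
    HasDerivAt (fun t => starRingEnd ℂ (u t)) (starRingEnd ℂ u') t :=
  (Complex.conjCLE.toContinuousLinearMap.hasFDerivAt (x := u t)).comp_hasDerivAt t h

theorem OscBound.hasDerivAt_oscSum (hf : OscBound f) (hg : OscBound g) (hf₁ : OscBound f₁)
    (hg₁ : OscBound g₁) (hdf : ∀ n k t, HasDerivAt (f n k) (f₁ n k t) t)
    (hdg : ∀ n k t, HasDerivAt (g n k) (g₁ n k t) t) (p : ℤ × ℤ) (t : ℝ) :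
    HasDerivAt (fun t => oscSum f g t p) (oscSum f₁ g t p + oscSum f g₁ t p) t := by
  obtain ⟨A, hA0, hA⟩ := hf₁.norm_term_le hg 0
  obtain ⟨B, hB0, hB⟩ := hf.norm_term_le hg₁ 0
  simp only [pow_zero, one_mul] at hA hB
  have h := hasDerivAt_tsum (y₀ := t)
    (g := fun (k : ℤ) t => kap p.2 k * (f p.2 k t * starRingEnd ℂ (g p.1 k t)))
    (g' := fun (k : ℤ) t => kap p.2 k * (f₁ p.2 k t * starRingEnd ℂ (g p.1 k t)) +
      kap p.2 k * (f p.2 k t * starRingEnd ℂ (g₁ p.1 k t)))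
    ((summable_inv_weight_sq.mul_left (A * (1 + |(p.1 : ℝ)|) ^ 2)).add
      (summable_inv_weight_sq.mul_left (B * (1 + |(p.1 : ℝ)|) ^ 2)))
    (fun k t => (((hdf p.2 k t).fun_mul (hdg p.1 k t).conj_comp).const_mul
      (kap p.2 k)).congr_deriv (by ring))
    (fun k t => (norm_add_le _ _).trans (add_le_add (hA p k t) (hB p k t)))
    (hf.hasSum_oscSum hg t p).summable t
  refine h.congr_deriv ?_
  exact ((hf₁.hasSum_oscSum hg t p).add (hf.hasSum_oscSum hg₁ t p)).tsum_eq

end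

theorem smoothFam_one : SmoothFam fun (_ : ℝ) (_ : ℝ) => (1 : ℂ) :=
  SmoothFam.const (c := fun _ => 1) (C := 1) fun _ => by simp

theorem norm_I_mul_le (n : ℤ) : ‖Complex.I * n‖ ≤ (1 + |(n : ℝ)|) ^ 2 := by
  rw [norm_mul, Complex.norm_I, one_mul, Complex.norm_intCast]
  nlinarith [abs_nonneg (n : ℝ)]

namespace DensVar

variable {η η₁ η₂ : ℝ → ℝ → ℝ} (V : DensVar η η₁ η₂)
include V

theorem oscBound_mul_oscInt {g : ℝ → ℝ → ℂ} (hg : SmoothFam g) {c : ℤ → ℂ}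
    (hc : ∀ n : ℤ, ‖c n‖ ≤ (1 + |(n : ℝ)|) ^ 2) : OscBound fun n k t => c n * V.oscInt g n k t := by
  refine ⟨?_, fun M => ?_⟩
  · obtain ⟨C, hC0, hC⟩ := hg.bound
    refine ⟨C, fun n k t => ?_⟩
    rw [norm_mul, mul_comm C]
    exact mul_le_mul (hc n) (V.norm_oscInt_le hC n k t) (norm_nonneg _) (by positivity)
  · obtain ⟨C, hC⟩ := V.oscInt_decay hg (M + 2)
    refine ⟨C, fun n k t hnk => ?_⟩
    have hw := one_le_posWeight (n, k)
    have h1 : 1 + |(n : ℝ)| ≤ posWeight (n, k) :=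
      le_mul_of_one_le_right (by positivity) (one_le_weight k)
    refine le_trans ?_ (hC n k t hnk)
    rw [norm_mul, ← mul_assoc, pow_add]
    gcongr
    exact (hc n).trans (by gcongr)

/-- The coefficients of `e^{inφ}` along the variation. -/
def coef (n k : ℤ) (t : ℝ) : ℂ := (V.density t).expCoeff n k

/-- The first derivative of `coef`. -/
def coef₁ (n k : ℤ) (t : ℝ) : ℂ :=
  Complex.I * n * V.oscInt (fun t x => (phase (η₁ t) x : ℂ)) n k t

/-- The second derivative of `coef`. -/
def coef₂ (n k : ℤ) (t : ℝ) : ℂ :=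
  Complex.I * n * V.oscInt (fun t x => (phase (η₂ t) x : ℂ)) n k t +
    -(n : ℂ) ^ 2 * V.oscInt (fun t x => (phase (η₁ t) x : ℂ) * phase (η₁ t) x) n k t

theorem coef_eq : V.coef = V.oscInt fun _ _ => 1 := by
  funext n k t
  simp only [oscInt, one_mul]
  rfl

theorem hasDerivAt_coef (n k : ℤ) (t : ℝ) : HasDerivAt (V.coef n k) (V.coef₁ n k t) t := by
  rw [coef_eq]
  refine (V.hasDerivAt_oscInt smoothFam_one (g₁ := fun _ _ => 0)
    (SmoothFam.const (c := fun _ => 0) (C := 0) fun _ => by simp)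
    (fun t x => hasDerivAt_const _ _) n k t).congr_deriv ?_
  have : V.oscInt (fun _ _ => 0) n k t = 0 := by
    simp [oscInt, circleCoeff_eq_circMean, circMean]
  rw [this, zero_add, coef₁]
  simp only [one_mul]

theorem hasDerivAt_coef₁ (n k : ℤ) (t : ℝ) : HasDerivAt (V.coef₁ n k) (V.coef₂ n k t) t := by
  refine ((V.hasDerivAt_oscInt V.smooth_phase₁.ofReal V.smooth_phase₂.ofReal
    (fun t x => (V.hasDerivAt_phase₁ x t).ofReal_comp) n k t).const_mul
    (Complex.I * n)).congr_deriv ?_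
  rw [coef₂]
  linear_combination (n : ℂ) ^ 2 *
    V.oscInt (fun t x => (phase (η₁ t) x : ℂ) * phase (η₁ t) x) n k t * Complex.I_sq

theorem oscBound_coef : OscBound V.coef := by
  have h := V.oscBound_mul_oscInt smoothFam_one (c := fun _ => 1) fun n => by
    rw [norm_one]
    exact one_le_pow₀ (one_le_weight n)
  simp only [one_mul] at h
  rwa [coef_eq]

theorem oscBound_coef₁ : OscBound V.coef₁ :=
  V.oscBound_mul_oscInt V.smooth_phase₁.ofReal norm_I_mul_le

theorem oscBound_coef₂ : OscBound V.coef₂ :=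
  (V.oscBound_mul_oscInt V.smooth_phase₂.ofReal norm_I_mul_le).add
    (V.oscBound_mul_oscInt (V.smooth_phase₁.ofReal.mul V.smooth_phase₁.ofReal)
      (c := fun n => -(n : ℂ) ^ 2) fun n => by
      rw [norm_neg, norm_pow, Complex.norm_intCast]
      gcongr
      linarith)

/-- The matrix of `aΛ - |n|` along the variation. -/
def mat (t : ℝ) (p : ℤ × ℤ) : ℂ := (V.density t).pertMat p

/-- The first derivative of `mat`. -/
def mat₁ (t : ℝ) (p : ℤ × ℤ) : ℂ := oscSum V.coef₁ V.coef t p + oscSum V.coef V.coef₁ t p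

/-- The second derivative of `mat`. -/
def mat₂ (t : ℝ) (p : ℤ × ℤ) : ℂ :=
  (oscSum V.coef₂ V.coef t p + oscSum V.coef₁ V.coef₁ t p) +
    (oscSum V.coef₁ V.coef₁ t p + oscSum V.coef V.coef₂ t p)

theorem hasDerivAt_mat (p : ℤ × ℤ) (t : ℝ) : HasDerivAt (fun t => V.mat t p) (V.mat₁ t p) t :=
  V.oscBound_coef.hasDerivAt_oscSum V.oscBound_coef V.oscBound_coef₁ V.oscBound_coef₁
    V.hasDerivAt_coef V.hasDerivAt_coef p t

theorem hasDerivAt_mat₁ (p : ℤ × ℤ) (t : ℝ) : HasDerivAt (fun t => V.mat₁ t p) (V.mat₂ t p) t :=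
  (V.oscBound_coef₁.hasDerivAt_oscSum V.oscBound_coef V.oscBound_coef₂ V.oscBound_coef₁
    V.hasDerivAt_coef₁ V.hasDerivAt_coef p t).add
    (V.oscBound_coef.hasDerivAt_oscSum V.oscBound_coef₁ V.oscBound_coef₁ V.oscBound_coef₂
    V.hasDerivAt_coef V.hasDerivAt_coef₁ p t)

theorem mat_herm (t : ℝ) (i j : ℤ) : V.mat t (i, j) = starRingEnd ℂ (V.mat t (j, i)) :=
  (V.density t).pertMat_herm i j

theorem mat₁_herm (t : ℝ) (i j : ℤ) : V.mat₁ t (i, j) = starRingEnd ℂ (V.mat₁ t (j, i)) := by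
  refine (V.hasDerivAt_mat (i, j) t).unique ?_
  have h := (V.hasDerivAt_mat (j, i) t).conj_comp
  simp only [← V.mat_herm] at h
  exact h

theorem mat₂_herm (t : ℝ) (i j : ℤ) : V.mat₂ t (i, j) = starRingEnd ℂ (V.mat₂ t (j, i)) := by
  refine (V.hasDerivAt_mat₁ (i, j) t).unique ?_
  have h := (V.hasDerivAt_mat₁ (j, i) t).conj_comp
  simp only [← V.mat₁_herm] at h
  exact h

theorem phase_zero_param (x : ℝ) : phase (η 0) x = x := by
  rw [phase, intervalIntegral.integral_congr fun y _ => V.zero y]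
  simp

theorem coef_zero (n k : ℤ) : V.coef n k 0 = if n = k then 1 else 0 := by
  rw [← circleCoeff_exp n k, coef_eq, oscInt]
  simp only [one_mul, V.phase_zero_param]

theorem mat_zero (p : ℤ × ℤ) : V.mat 0 p = 0 := by
  refine (tsum_congr fun k => ?_).trans tsum_zero
  change kap p.2 k * (V.coef p.2 k 0 * _) = 0
  rw [coef_zero]
  split_ifs with h
  · rw [← h, kap, if_neg (not_lt.2 (mul_self_nonneg _)), zero_mul]
  · simp

/-- The matrix of `aΛ - |n|` along the variation is a variation of the zero matrix. -/
theorem matVar : MatVar V.mat V.mat₁ V.mat₂ where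
  zero := V.mat_zero
  hasDerivAt := V.hasDerivAt_mat
  hasDerivAt₁ := V.hasDerivAt_mat₁
  bound K := by
    have b := V.oscBound_coef
    have b₁ := V.oscBound_coef₁
    have b₂ := V.oscBound_coef₂
    obtain ⟨A, hA0, hA⟩ := (b.rowBound b).norm_le V.mat_herm K
    obtain ⟨B, hB0, hB⟩ := ((b₁.rowBound b).add (b.rowBound b₁)).norm_le V.mat₁_herm K
    obtain ⟨C, hC0, hC⟩ := (((b₂.rowBound b).add (b₁.rowBound b₁)).add
      ((b₁.rowBound b₁).add (b.rowBound b₂))).norm_le V.mat₂_herm K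
    refine ⟨fun p => (A + B + C) * (posWeight p ^ 2)⁻¹, summable_inv_posWeight_sq.mul_left _,
      fun t p => ⟨(hA t p).trans ?_, (hB t p).trans ?_, (hC t p).trans ?_⟩⟩
    all_goals
      have := one_le_posWeight p
      exact mul_le_mul_of_nonneg_right (by linarith) (by positivity)

end DensVar

/-! ### Symmetrization and convergence of the double series -/

theorem natCast_cpow_sub_one (z : ℂ) {n : ℕ} (hn : n ≠ 0) :
    (n : ℂ) ^ (-z - 1) = (n : ℂ) ^ (-z) / n := by
  rw [Complex.cpow_sub _ _ (Nat.cast_ne_zero.2 hn), Complex.cpow_one]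

theorem natCast_cpow_sub_two (z : ℂ) {n : ℕ} (hn : n ≠ 0) :
    (n : ℂ) ^ (-z - 2) = (n : ℂ) ^ (-z) / n ^ 2 := by
  rw [Complex.cpow_sub _ _ (Nat.cast_ne_zero.2 hn)]
  norm_cast

/-- Symmetrization of the second variation, off the diagonal. -/
theorem divDiff_symm_of_ne (z : ℂ) {n p : ℕ} (hn : n ≠ 0) (hp : p ≠ 0) (h : n ≠ p) :
    (8 * p * n ^ 2 * (-z * (n : ℂ) ^ (-z - 1)) + 16 * n ^ 2 * p ^ 2 * divDiff z n p) +
      (8 * n * p ^ 2 * (-z * (p : ℂ) ^ (-z - 1)) + 16 * p ^ 2 * n ^ 2 * divDiff z p n) =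
    2 * (n + p) ^ 2 * (4 * z *
      (((n : ℂ) ^ (-z) - (p : ℂ) ^ (-z)) / ((p : ℂ) ^ 2 - (n : ℂ) ^ 2) * p * n)) := by
  have hn' : (n : ℂ) ≠ 0 := Nat.cast_ne_zero.2 hn
  have hp' : (p : ℂ) ≠ 0 := Nat.cast_ne_zero.2 hp
  have h1 : (n : ℂ) - p ≠ 0 := sub_ne_zero.2 (by exact_mod_cast h)
  have h2 : (n : ℂ) + p ≠ 0 := by
    have : n + p ≠ 0 := by omega
    exact_mod_cast this
  have h3 : (p : ℂ) ^ 2 - (n : ℂ) ^ 2 = -((n - p) * (n + p)) := by ring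
  have h4 : ((p : ℂ) - n) ^ 2 = (n - p) ^ 2 := by ring
  rw [divDiff, divDiff, if_neg h, if_neg (Ne.symm h), natCast_cpow_sub_one z hn,
    natCast_cpow_sub_one z hp, h3, h4]
  generalize (n : ℂ) ^ (-z) = X
  generalize (p : ℂ) ^ (-z) = Y
  field_simp
  ring

/-- Symmetrization of the second variation, on the diagonal. -/
theorem divDiff_symm_self (z : ℂ) {n : ℕ} (hn : n ≠ 0) :
    8 * n * n ^ 2 * (-z * (n : ℂ) ^ (-z - 1)) + 16 * n ^ 2 * n ^ 2 * divDiff z n n =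
    (n + n) ^ 2 * (2 * z ^ 2 * (n : ℂ) ^ (-z)) := by
  have hn' : (n : ℂ) ≠ 0 := Nat.cast_ne_zero.2 hn
  rw [divDiff, if_pos rfl, natCast_cpow_sub_one z hn, natCast_cpow_sub_two z hn]
  generalize (n : ℂ) ^ (-z) = X
  field_simp
  ring

/-- A function on `ℤ × ℤ` supported where the signs are opposite. -/
theorem hasSum_of_opposite_signs {a : ℤ × ℤ → ℂ} {g : ℕ+ × ℕ+ → ℂ} {c : ℂ} (hg : HasSum g c)
    (h0 : ∀ i j, ¬ i * j < 0 → a (i, j) = 0) (h1 : ∀ q : ℕ+ × ℕ+, a ((q.1 : ℤ), -(q.2 : ℤ)) = g q)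
    (h2 : ∀ q : ℕ+ × ℕ+, a (-(q.1 : ℤ), (q.2 : ℤ)) = g q) : HasSum a (c + c) := by
  have hsplit : a = fun p => (if 0 < p.1 then a p else 0) + if p.1 < 0 then a p else 0 := by
    funext p
    rcases lt_trichotomy p.1 0 with h | h | h
    · simp [h, h.le.not_gt]
    · have : a p = 0 := h0 p.1 p.2 (by rw [h]; simp)
      simp [h, this]
    · simp [h, h.le.not_gt]
  have hpos : ∀ n : ℤ, 0 < n → ∃ m : ℕ+, (m : ℤ) = n := fun n hn =>
    ⟨⟨n.toNat, by omega⟩, by simp [hn.le]⟩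
  have hi1 : Function.Injective fun q : ℕ+ × ℕ+ => ((q.1 : ℤ), -(q.2 : ℤ)) := fun q r h => by
    simp only [Prod.mk.injEq, neg_inj, Nat.cast_inj, PNat.coe_inj] at h
    exact Prod.ext h.1 h.2
  have hi2 : Function.Injective fun q : ℕ+ × ℕ+ => (-(q.1 : ℤ), (q.2 : ℤ)) := fun q r h => by
    simp only [Prod.mk.injEq, neg_inj, Nat.cast_inj, PNat.coe_inj] at h
    exact Prod.ext h.1 h.2
  rw [hsplit]
  refine HasSum.add ?_ ?_
  · rw [← hi1.hasSum_iff]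
    · refine hg.congr_fun fun q => ?_
      simp only [Function.comp]
      rw [if_pos (by exact_mod_cast q.1.pos), h1]
    · rintro ⟨i, j⟩ hij
      split_ifs with hi
      · refine h0 i j fun hlt => hij ?_
        have hj : 0 < -j := by by_contra hj; nlinarith
        obtain ⟨m, rfl⟩ := hpos i hi
        obtain ⟨l, hl⟩ := hpos (-j) hj
        exact ⟨(m, l), by simp [hl]⟩
      · rfl
  · rw [← hi2.hasSum_iff]
    · refine hg.congr_fun fun q => ?_
      simp only [Function.comp]
      rw [if_pos (by have := q.1.pos; omega), h2]
    · rintro ⟨i, j⟩ hij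
      split_ifs with hi
      · refine h0 i j fun hlt => hij ?_
        have hj : 0 < j := by by_contra hj; nlinarith
        obtain ⟨m, hm⟩ := hpos (-i) (by simpa using hi)
        obtain ⟨l, rfl⟩ := hpos j hj
        exact ⟨(m, l), by simp [hm]⟩
      · rfl

theorem hasSum_diag {ι : Type*} [DecidableEq ι] {d : ι → ℂ} {c : ℂ} (h : HasSum d c) :
    HasSum (fun q : ι × ι => if q.1 = q.2 then d q.1 else 0) c := by
  have hi : Function.Injective fun i : ι => (i, i) := fun i j h => (Prod.ext_iff.1 h).1
  rw [← hi.hasSum_iff]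
  · exact h.congr_fun fun i => by simp
  · rintro ⟨i, j⟩ hij
    refine if_neg fun h => hij ⟨i, ?_⟩
    simp only at h
    rw [← h]

theorem norm_natCast_cpow_le {z : ℂ} {K : ℕ} (hK : ‖z‖ ≤ K) (n : ℕ+) :
    ‖(n : ℂ) ^ (-z)‖ ≤ (n : ℝ) ^ K := by
  have h1 : (1 : ℝ) ≤ (n : ℝ) := by exact_mod_cast one_le (a := n)
  rw [Complex.norm_natCast_cpow_of_pos n.pos, ← Real.rpow_natCast]
  refine Real.rpow_le_rpow_of_exponent_le h1 ?_
  rw [Complex.neg_re]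
  exact (neg_le_abs _).trans ((Complex.abs_re_le_norm z).trans hK)

section decay

variable (f : smoothCircle ℂ)

/-- Rapid decay of the Fourier coefficients at `p + n`. -/
theorem summable_pow_mul_sq_circleCoeff (K : ℕ) : Summable fun q : ℕ+ × ℕ+ =>
    ((q.1 : ℝ) * q.2) ^ K * ‖circleCoeff f.1 ((q.2 : ℤ) + (q.1 : ℤ))‖ ^ 2 := by
  have h2 : Summable fun n : ℕ+ => 1 / (n : ℝ) ^ 2 :=
    ((Real.summable_one_div_nat_pow (p := 2)).2 one_lt_two).comp_injective PNat.coe_injective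
  have hb := summable_weight_circleCoeff f (K + 2)
  set C := ∑' j : ℤ, (1 + |(j : ℝ)|) ^ (K + 2) * ‖circleCoeff f.1 j‖ with hC
  have hle : ∀ j : ℤ, (1 + |(j : ℝ)|) ^ (K + 2) * ‖circleCoeff f.1 j‖ ≤ C := fun j =>
    hb.le_tsum j fun i _ => by positivity
  refine Summable.of_nonneg_of_le (fun q => by positivity) (fun q => ?_)
    ((h2.mul_of_nonneg h2 (fun _ => by positivity) fun _ => by positivity).mul_left (C ^ 2))
  have hn : (0 : ℝ) < q.1 := by exact_mod_cast q.1.pos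
  have hp : (0 : ℝ) < q.2 := by exact_mod_cast q.2.pos
  have h := pow_le_pow_left₀ (by positivity) (hle ((q.2 : ℤ) + (q.1 : ℤ))) 2
  have he : |((((q.2 : ℤ) + (q.1 : ℤ)) : ℤ) : ℝ)| = q.1 + q.2 := by
    push_cast
    rw [abs_of_pos (by positivity), add_comm]
  rw [he] at h
  rw [one_div_mul_one_div, mul_one_div, le_div_iff₀ (by positivity)]
  refine le_trans ?_ h
  have h3 : (q.1 : ℝ) * q.2 ≤ (1 + ((q.1 : ℝ) + q.2)) ^ 2 := by nlinarith
  calc _ = ((q.1 : ℝ) * q.2) ^ (K + 2) * ‖circleCoeff f.1 ((q.2 : ℤ) + (q.1 : ℤ))‖ ^ 2 := by ring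
    _ ≤ ((1 + ((q.1 : ℝ) + q.2)) ^ 2) ^ (K + 2) *
        ‖circleCoeff f.1 ((q.2 : ℤ) + (q.1 : ℤ))‖ ^ 2 := by gcongr
    _ = _ := by rw [mul_pow, ← pow_mul, ← pow_mul, mul_comm 2]

theorem norm_ofReal_sq (x : ℂ) : ‖((‖x‖ : ℝ) : ℂ) ^ 2‖ = ‖x‖ ^ 2 := by simp

theorem summable_offDiag (z : ℂ) : Summable fun q : ℕ+ × ℕ+ => if q.1 = q.2 then (0 : ℂ) else
    ((q.1 : ℂ) ^ (-z) - (q.2 : ℂ) ^ (-z)) / ((q.2 : ℂ) ^ 2 - (q.1 : ℂ) ^ 2) * (q.2 : ℂ) * (q.1 : ℂ)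
      * (‖circleCoeff f.1 ((q.2 : ℤ) + (q.1 : ℤ))‖ : ℂ) ^ 2 := by
  obtain ⟨K, hK⟩ := exists_nat_ge ‖z‖
  refine Summable.of_norm_bounded ((summable_pow_mul_sq_circleCoeff f (K + 1)).mul_left 2)
    fun q => ?_
  have hn : (1 : ℝ) ≤ q.1 := by exact_mod_cast one_le (a := q.1)
  have hp : (1 : ℝ) ≤ q.2 := by exact_mod_cast one_le (a := q.2)
  split_ifs with h
  · rw [norm_zero]
    positivity
  · have hden : 1 ≤ ‖(q.2 : ℂ) ^ 2 - (q.1 : ℂ) ^ 2‖ := by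
      have h1 : ((q.2 : ℕ) : ℤ) ^ 2 - ((q.1 : ℕ) : ℤ) ^ 2 ≠ 0 := fun h0 => h (by
        have h2 : ((q.2 : ℕ) : ℤ) ^ 2 = ((q.1 : ℕ) : ℤ) ^ 2 := by linarith
        have h3 : (q.2 : ℕ) ^ 2 = (q.1 : ℕ) ^ 2 := by exact_mod_cast h2
        exact (PNat.coe_inj.1 (Nat.pow_left_injective (two_ne_zero) h3)).symm)
      have h2 : (1 : ℝ) ≤ ((|((q.2 : ℕ) : ℤ) ^ 2 - ((q.1 : ℕ) : ℤ) ^ 2| : ℤ) : ℝ) := by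
        exact_mod_cast Int.one_le_abs h1
      rw [Int.cast_abs] at h2
      have h3 := Complex.norm_intCast (((q.2 : ℕ) : ℤ) ^ 2 - ((q.1 : ℕ) : ℤ) ^ 2)
      rw [← h3] at h2
      simpa using h2
    have hnum : ‖(q.1 : ℂ) ^ (-z) - (q.2 : ℂ) ^ (-z)‖ ≤ 2 * ((q.1 : ℝ) * q.2) ^ K := by
      have h1 := norm_natCast_cpow_le hK q.1
      have h2 := norm_natCast_cpow_le hK q.2
      have h3 : (q.1 : ℝ) ^ K ≤ ((q.1 : ℝ) * q.2) ^ K := by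
        gcongr
        exact le_mul_of_one_le_right (by positivity) hp
      have h4 : (q.2 : ℝ) ^ K ≤ ((q.1 : ℝ) * q.2) ^ K := by
        gcongr
        exact le_mul_of_one_le_left (by positivity) hn
      refine (norm_sub_le _ _).trans ?_
      linarith
    rw [norm_mul, norm_mul, norm_mul, norm_div, norm_ofReal_sq, Complex.norm_natCast,
      Complex.norm_natCast]
    have hq : ‖(q.1 : ℂ) ^ (-z) - (q.2 : ℂ) ^ (-z)‖ / ‖(q.2 : ℂ) ^ 2 - (q.1 : ℂ) ^ 2‖ ≤
        2 * ((q.1 : ℝ) * q.2) ^ K := (div_le_self (norm_nonneg _) hden).trans hnum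
    calc _ ≤ 2 * ((q.1 : ℝ) * q.2) ^ K * q.2 * q.1 *
          ‖circleCoeff f.1 ((q.2 : ℤ) + (q.1 : ℤ))‖ ^ 2 := by gcongr
      _ = _ := by ring

theorem summable_onDiag (z : ℂ) : Summable fun n : ℕ+ =>
    (n : ℂ) ^ (-z) * (‖circleCoeff f.1 (2 * (n : ℤ))‖ : ℂ) ^ 2 := by
  obtain ⟨K, hK⟩ := exists_nat_ge ‖z‖
  have hi : Function.Injective fun n : ℕ+ => (n, n) := fun i j h => (Prod.ext_iff.1 h).1
  refine Summable.of_norm_bounded ((summable_pow_mul_sq_circleCoeff f K).comp_injective hi)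
    fun n => ?_
  have hn : (1 : ℝ) ≤ n := by exact_mod_cast one_le (a := n)
  rw [norm_mul, norm_ofReal_sq, Function.comp, two_mul]
  gcongr
  refine (norm_natCast_cpow_le hK n).trans ?_
  gcongr
  exact le_mul_of_one_le_right (by positivity) hn

end decay

/-! ### The coefficients of the second variation -/

theorem MatVar.rapidMat₁ {R R₁ R₂ : ℝ → ℤ × ℤ → ℂ} (h : MatVar R R₁ R₂) (t : ℝ) :
    RapidMat (R₁ t) := fun K => by
  obtain ⟨b, hb, hbR⟩ := h.bound K
  refine Summable.of_nonneg_of_le (fun p => ?_) (fun p => (hbR t p).2.1) hb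
  have := one_le_posWeight p
  positivity

theorem RapidMat.summable_mul_levelFun {N : ℤ × ℤ → ℂ} (hN : RapidMat N) (z : ℂ) (k : YZ) :
    Summable fun p => N p * levelFun z p k := by
  obtain ⟨K, hK⟩ := exists_nat_ge ‖z‖
  refine Summable.of_norm_bounded ((hN K).mul_left (2 * (rexp (π * K) * 2 ^ K) * ‖k‖)) fun p => ?_
  rw [norm_mul]
  calc ‖N p‖ * ‖levelFun z p k‖ ≤ ‖N p‖ * (‖levelFun z p‖ * ‖k‖) := by
        gcongr
        exact ContinuousLinearMap.le_opNorm _ _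
    _ ≤ ‖N p‖ * (2 * (rexp (π * K) * 2 ^ K) * posWeight p ^ K * ‖k‖) := by
        gcongr
        exact norm_levelFun_le hK p
    _ = _ := by ring

theorem kap_self (n : ℤ) : kap n n = 0 := by
  rw [kap, if_neg (not_lt.2 (mul_self_nonneg n))]

namespace DensVar

variable {η η₁ η₂ : ℝ → ℝ → ℝ} (V : DensVar η η₁ η₂)
include V

/-- The direction `β = ∂α/∂t = -∂η/∂t` at `t = 0`. -/
def dirC : smoothCircle ℂ :=
  ⟨fun x => ((-η₁ 0 x : ℝ) : ℂ), Complex.ofRealCLM.contDiff.comp (V.smooth₁.contDiff 0).neg,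
    fun x => by simp only [V.smooth₁.periodic 0 x]⟩

/-- The primitive of `-β` as a smooth function. -/
def phaseC : smoothCircle ℂ :=
  ⟨fun x => (phase (η₁ 0) x : ℂ), Complex.ofRealCLM.contDiff.comp (V.smooth_phase₁.contDiff 0),
    fun x => by simp only [V.smooth_phase₁.periodic 0 x]⟩

/-- The Fourier coefficients of a primitive of `-β`; for `j = 0` this says that `β` has mean
zero. -/
theorem circleCoeff_phaseC (j : ℤ) :
    Complex.I * j * circleCoeff V.phaseC.1 j = -circleCoeff V.dirC.1 j := by
  have h1 := circleCoeff_circleDeriv' V.phaseC j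
  have h2 : (circleDeriv V.phaseC).1 = fun x => (-1 : ℂ) * V.dirC.1 x := by
    funext x
    have hd : HasDerivAt (phase (η₁ 0)) (η₁ 0 x) x :=
      intervalIntegral.integral_hasDerivAt_right ((V.smooth₁.continuous 0).intervalIntegrable _ _)
        ((V.smooth₁.continuous 0).stronglyMeasurableAtFilter _ _)
        (V.smooth₁.continuous 0).continuousAt
    change deriv (fun x => (phase (η₁ 0) x : ℂ)) x = -1 * ((-η₁ 0 x : ℝ) : ℂ)
    rw [hd.ofReal_comp.deriv]
    simp
  rw [← h1, h2, circleCoeff_const_mul]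
  ring

/-- The direction is real. -/
theorem norm_circleCoeff_dirC_neg (j : ℤ) :
    ‖circleCoeff V.dirC.1 (-j)‖ = ‖circleCoeff V.dirC.1 j‖ := by
  rw [← RCLike.norm_conj (circleCoeff V.dirC.1 j), conj_circleCoeff, circleCoeff_eq_circMean]
  congr 1
  refine circMean_congr fun x => ?_
  change _ * ((-η₁ 0 x : ℝ) : ℂ) = _ * starRingEnd ℂ ((-η₁ 0 x : ℝ) : ℂ)
  rw [Complex.conj_ofReal]
  congr 2
  push_cast
  ring

theorem coef₁_zero {n k : ℤ} (hnk : n ≠ k) :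
    V.coef₁ n k 0 = n * circleCoeff V.dirC.1 (k - n) / (n - k) := by
  have h1 : V.oscInt (fun t x => (phase (η₁ t) x : ℂ)) n k 0 = circleCoeff V.phaseC.1 (k - n) := by
    rw [oscInt, circleCoeff_eq_circMean, circleCoeff_eq_circMean]
    refine circMean_congr fun x => ?_
    change _ = _ * (phase (η₁ 0) x : ℂ)
    rw [V.phase_zero_param, mul_left_comm, ← Complex.exp_add, mul_comm]
    congr 2
    push_cast
    ring
  have h2 := V.circleCoeff_phaseC (k - n)
  have h3 : (n : ℂ) - k ≠ 0 := sub_ne_zero.2 (by exact_mod_cast hnk)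
  rw [coef₁, h1, eq_div_iff h3, ← neg_neg (circleCoeff V.dirC.1 (k - n)), ← h2]
  push_cast
  ring

theorem norm_coef₁_zero {n k : ℤ} (hnk : n * k < 0) : ‖V.coef₁ n k 0‖ =
    |(n : ℝ)| * ‖circleCoeff V.dirC.1 (k - n)‖ / |(n : ℝ) - k| := by
  rw [V.coef₁_zero (by rintro rfl; nlinarith), norm_div, norm_mul, Complex.norm_intCast,
    ← Int.cast_sub, Complex.norm_intCast]
  push_cast
  rfl

theorem oscSum_coef_right (f : ℤ → ℤ → ℝ → ℂ) (p : ℤ × ℤ) :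
    oscSum f V.coef 0 p = kap p.2 p.1 * f p.2 p.1 0 := by
  rw [oscSum, tsum_eq_single p.1 fun k hk => ?_]
  · simp [V.coef_zero]
  · simp [V.coef_zero, Ne.symm hk]

theorem oscSum_coef_left (f : ℤ → ℤ → ℝ → ℂ) (p : ℤ × ℤ) : oscSum V.coef f 0 p = 0 := by
  refine (tsum_congr fun k => ?_).trans tsum_zero
  rw [V.coef_zero]
  split_ifs with h
  · rw [← h, kap_self, zero_mul]
  · simp

/-- At the constant density the unperturbed coefficients `coef n k 0` form the identity matrix, and
`kap` vanishes on the diagonal, which leaves a single term. -/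
theorem mat₁_zero (p : ℤ × ℤ) : V.mat₁ 0 p = kap p.2 p.1 * V.coef₁ p.2 p.1 0 := by
  rw [mat₁, V.oscSum_coef_right, V.oscSum_coef_left, add_zero]

/-- On the diagonal, only the products of two first derivatives contribute. -/
theorem hasSum_mat₂_zero (i : ℤ) :
    HasSum (fun k => 2 * kap i k * (‖V.coef₁ i k 0‖ : ℂ) ^ 2) (V.mat₂ 0 (i, i)) := by
  have h := (V.oscBound_coef₁.hasSum_oscSum V.oscBound_coef₁ 0 (i, i)).mul_left 2
  have e : V.mat₂ 0 (i, i) = 2 * oscSum V.coef₁ V.coef₁ 0 (i, i) := by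
    rw [mat₂, V.oscSum_coef_right, V.oscSum_coef_left, kap_self]
    ring
  rw [e]
  refine h.congr_fun fun k => ?_
  rw [Complex.mul_conj']
  ring

/-- For `n` and `k` of opposite signs, `|n - k| = |n| + |k|`. -/
theorem norm_coef₁_zero_eq (q : ℕ+ × ℕ+) {n k : ℤ} (hn : |n| = q.1) (hk : |k| = q.2)
    (h : n * k < 0) : ‖V.coef₁ n k 0‖ =
      q.1 * ‖circleCoeff V.dirC.1 ((q.2 : ℤ) + (q.1 : ℤ))‖ / ((q.1 : ℝ) + q.2) := by
  have hn' : |(n : ℝ)| = q.1 := by exact_mod_cast hn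
  rw [V.norm_coef₁_zero h, hn']
  have hp := q.1.pos
  have hp2 := q.2.pos
  rcases lt_or_gt_of_ne (show n ≠ 0 by rintro rfl; simp at h) with h0 | h0
  · have hk0 : 0 < k := by by_contra hk'; nlinarith
    rw [abs_of_neg h0] at hn
    rw [abs_of_pos hk0] at hk
    obtain rfl : n = -(q.1 : ℤ) := by omega
    subst hk
    congr 2
    · congr 2
      ring
    · push_cast
      rw [abs_of_neg]
      · ring
      · have : (0 : ℝ) < q.1 := by exact_mod_cast hp
        have : (0 : ℝ) < q.2 := by exact_mod_cast hp2
        linarith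
  · have hk0 : k < 0 := by by_contra hk'; nlinarith
    rw [abs_of_pos h0] at hn
    rw [abs_of_neg hk0] at hk
    obtain rfl : k = -(q.2 : ℤ) := by omega
    subst hn
    congr 2
    · rw [← V.norm_circleCoeff_dirC_neg]
      congr 2
      ring
    · push_cast
      rw [abs_of_pos]
      · ring
      · have : (0 : ℝ) < q.1 := by exact_mod_cast hp
        have : (0 : ℝ) < q.2 := by exact_mod_cast hp2
        linarith

/-- The squared norm of the Fourier coefficient of `β` at `p + n`. -/
def sqCoeff (q : ℕ+ × ℕ+) : ℂ := (‖circleCoeff V.dirC.1 ((q.2 : ℤ) + (q.1 : ℤ))‖ : ℂ) ^ 2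

theorem sqCoeff_swap (q : ℕ+ × ℕ+) : V.sqCoeff q.swap = V.sqCoeff q := by
  simp only [sqCoeff, Prod.fst_swap, Prod.snd_swap, add_comm]

/-- The first variation vanishes: `mat₁ 0` is zero on the diagonal, and the contour functionals of
the squared free resolvent are zero off the diagonal. -/
theorem first_variation_sum (z : ℂ) : ∑' p, V.mat₁ 0 p * levelFun z p (DY * DY) = 0 := by
  refine (tsum_congr fun p => ?_).trans tsum_zero
  obtain ⟨i, j⟩ := p
  by_cases h : i = j
  · rw [V.mat₁_zero, h, kap_self, zero_mul, zero_mul]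
  · rw [levelFun_DY_mul_DY_of_ne z h, mul_zero]

theorem summable_diagTerm (z : ℂ) : Summable fun q : ℕ+ × ℕ+ => 4 * (q.2 : ℂ) * (q.1 : ℂ) ^ 2 *
    (V.sqCoeff q / ((q.1 : ℂ) + q.2) ^ 2) * (-z * (q.1 : ℂ) ^ (-z - 1)) := by
  obtain ⟨K, hK⟩ := exists_nat_ge ‖z + 1‖
  refine Summable.of_norm_bounded
    ((summable_pow_mul_sq_circleCoeff V.dirC (K + 1)).mul_left (4 * ‖z‖)) fun q => ?_
  have hn : (1 : ℝ) ≤ q.1 := by exact_mod_cast one_le (a := q.1)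
  have hp : (1 : ℝ) ≤ q.2 := by exact_mod_cast one_le (a := q.2)
  have h1 : ‖(q.1 : ℂ) ^ (-z - 1)‖ ≤ (q.1 : ℝ) ^ K := by
    rw [← neg_add']
    exact norm_natCast_cpow_le hK q.1
  have h2 : ‖((q.1 : ℂ) + q.2) ^ 2‖ = ((q.1 : ℝ) + q.2) ^ 2 := by
    rw [norm_pow, ← Nat.cast_add, Complex.norm_natCast]
    push_cast
    rfl
  have h3 : ‖V.sqCoeff q‖ = ‖circleCoeff V.dirC.1 ((q.2 : ℤ) + (q.1 : ℤ))‖ ^ 2 :=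
    norm_ofReal_sq _
  simp only [norm_mul, norm_div, norm_neg, h2, h3, norm_pow, Complex.norm_natCast,
    Complex.norm_ofNat]
  set B := ‖circleCoeff V.dirC.1 ((q.2 : ℤ) + (q.1 : ℤ))‖ ^ 2
  have hB : 0 ≤ B := by positivity
  have h4 : (q.1 : ℝ) ^ 2 * (B / ((q.1 : ℝ) + q.2) ^ 2) ≤ B := by
    rw [← mul_div_assoc, div_le_iff₀ (by positivity), mul_comm]
    gcongr
    linarith
  have h5 : (q.2 : ℝ) * (q.1 : ℝ) ^ K ≤ ((q.1 : ℝ) * q.2) ^ (K + 1) := by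
    rw [mul_pow, pow_succ (q.2 : ℝ), mul_comm]
    have h6 : (q.1 : ℝ) ^ K ≤ (q.1 : ℝ) ^ (K + 1) := pow_le_pow_right₀ hn (Nat.le_succ K)
    have h7 : (q.2 : ℝ) ≤ (q.2 : ℝ) ^ K * q.2 :=
      le_mul_of_one_le_left (by positivity) (one_le_pow₀ hp)
    exact mul_le_mul h6 h7 (by positivity) (by positivity)
  calc _ = 4 * ‖z‖ * (q.2 * ((q.1 : ℝ) ^ 2 * (B / ((q.1 : ℝ) + q.2) ^ 2)) *
        ‖(q.1 : ℂ) ^ (-z - 1)‖) := by ring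
    _ ≤ 4 * ‖z‖ * (q.2 * B * (q.1 : ℝ) ^ K) := by gcongr
    _ = 4 * ‖z‖ * (q.2 * (q.1 : ℝ) ^ K * B) := by ring
    _ ≤ _ := by gcongr

theorem hasSum_diagTerm (z : ℂ) {c : ℂ} (hc : HasSum (fun q : ℕ+ × ℕ+ => 4 * (q.2 : ℂ) *
      (q.1 : ℂ) ^ 2 * (V.sqCoeff q / ((q.1 : ℂ) + q.2) ^ 2) * (-z * (q.1 : ℂ) ^ (-z - 1))) c) :
    HasSum (fun p : ℤ × ℤ => 2 * kap p.1 p.2 * (‖V.coef₁ p.1 p.2 0‖ : ℂ) ^ 2 *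
      levelFun z (p.1, p.1) (DY * DY)) (c + c) := by
  have hval : ∀ (q : ℕ+ × ℕ+) (n k : ℤ), |n| = q.1 → |k| = q.2 → n * k < 0 →
      2 * kap n k * (‖V.coef₁ n k 0‖ : ℂ) ^ 2 * levelFun z (n, n) (DY * DY) =
        4 * (q.2 : ℂ) * (q.1 : ℂ) ^ 2 *
          (V.sqCoeff q / ((q.1 : ℂ) + q.2) ^ 2) * (-z * (q.1 : ℂ) ^ (-z - 1)) := by
    intro q n k hn hk h
    have hn0 : n ≠ 0 := by rintro rfl; simp at h
    have hn1 : n.natAbs = (q.1 : ℕ) := by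
      rw [Int.abs_eq_natAbs] at hn
      exact_mod_cast hn
    have hk1 : k.natAbs = (q.2 : ℕ) := by
      rw [Int.abs_eq_natAbs] at hk
      exact_mod_cast hk
    rw [V.norm_coef₁_zero_eq q hn hk h, kap, if_pos h, levelFun_DY_mul_DY_diag z hn0, hn1, hk1,
      sqCoeff]
    push_cast
    rw [div_pow, mul_pow]
    ring
  refine hasSum_of_opposite_signs hc (fun i j hij => ?_)
    (fun q => hval q _ _ (by simp) (by simp) (by simp))
    fun q => hval q _ _ (by simp) (by simp) (by simp)
  simp only
  rw [kap, if_neg hij, mul_zero, zero_mul, zero_mul]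

/-- The contribution of the second derivatives of the matrix; the two choices of signs of `(n, k)`
give the same sum. -/
theorem second_variation_diag (z : ℂ) {c : ℂ} (hc : HasSum (fun q : ℕ+ × ℕ+ => 4 * (q.2 : ℂ) *
      (q.1 : ℂ) ^ 2 * (V.sqCoeff q / ((q.1 : ℂ) + q.2) ^ 2) * (-z * (q.1 : ℂ) ^ (-z - 1))) c) :
    ∑' p, V.mat₂ 0 p * levelFun z p (DY * DY) = c + c := by
  have h1 : HasSum (fun i : ℤ => V.mat₂ 0 (i, i) * levelFun z (i, i) (DY * DY)) (c + c) :=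
    HasSum.prod_fiberwise (V.hasSum_diagTerm z hc)
      fun i => (V.hasSum_mat₂_zero i).mul_right (levelFun z (i, i) (DY * DY))
  have h2 := hasSum_diag h1
  refine Eq.trans (tsum_congr fun p => ?_) h2.tsum_eq
  by_cases h : p.1 = p.2
  · rw [if_pos h, ← Prod.mk.eta (p := p), ← h]
  · rw [if_neg h, ← Prod.mk.eta (p := p), levelFun_DY_mul_DY_of_ne z h, mul_zero]

/-- The contribution of the products of two first derivatives of the matrix. -/
theorem second_variation_offDiag (z : ℂ) :
    ∃ c, HasSum (fun q : ℕ+ × ℕ+ => 4 * (q.1 : ℂ) ^ 2 * (q.2 : ℂ) ^ 2 *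
        (V.sqCoeff q / ((q.1 : ℂ) + q.2) ^ 2) * divDiff z q.1 q.2) c ∧
      ∑' p, V.mat₁ 0 p * levelFun z p (DY * opY (V.mat₁ 0) * DY * DY +
        DY * (DY * cutY (V.mat₁ 0) * DY)) = c + c := by
  set a : ℤ × ℤ → ℂ := fun p => V.mat₁ 0 p * levelFun z p (DY * opY (V.mat₁ 0) * DY * DY +
        DY * (DY * cutY (V.mat₁ 0) * DY)) with ha
  have hs : Summable a := (V.matVar.rapidMat₁ 0).summable_mul_levelFun z _
  have hval : ∀ (q : ℕ+ × ℕ+) (i j : ℤ), |i| = q.1 → |j| = q.2 → i * j < 0 →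
      a (i, j) = 4 * (q.1 : ℂ) ^ 2 * (q.2 : ℂ) ^ 2 *
        (V.sqCoeff q / ((q.1 : ℂ) + q.2) ^ 2) * divDiff z q.1 q.2 := by
    intro q i j hi hj h
    have hi0 : i ≠ 0 := by rintro rfl; simp at h
    have hj0 : j ≠ 0 := by rintro rfl; simp at h
    have hi1 : i.natAbs = (q.1 : ℕ) := by
      rw [Int.abs_eq_natAbs] at hi
      exact_mod_cast hi
    have hj1 : j.natAbs = (q.2 : ℕ) := by
      rw [Int.abs_eq_natAbs] at hj
      exact_mod_cast hj
    have h' : j * i < 0 := by rwa [mul_comm]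
    have hn : ‖V.mat₁ 0 (i, j)‖ = 2 * q.1 * (q.2 * ‖circleCoeff V.dirC.1
        ((q.1 : ℤ) + (q.2 : ℤ))‖ / ((q.2 : ℝ) + q.1)) := by
      rw [V.mat₁_zero, norm_mul, V.norm_coef₁_zero_eq q.swap hj hi h', kap, if_pos h', hi1]
      simp
    simp only [ha]
    rw [levelFun_second z (V.matVar.summable_norm₁ 0) hi0 hj0, V.mat₁_herm 0 j i, ← mul_assoc,
      Complex.mul_conj', hn, hi1, hj1, sqCoeff, add_comm (q.1 : ℤ), add_comm (q.1 : ℂ)]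
    push_cast
    rw [mul_pow, div_pow, mul_pow]
    ring
  have hi : Function.Injective fun q : ℕ+ × ℕ+ => ((q.1 : ℤ), -(q.2 : ℤ)) := fun q r h => by
    simp only [Prod.mk.injEq, neg_inj, Nat.cast_inj, PNat.coe_inj] at h
    exact Prod.ext h.1 h.2
  have hq : ∀ q : ℕ+ × ℕ+, a ((q.1 : ℤ), -(q.2 : ℤ)) = 4 * (q.1 : ℂ) ^ 2 * (q.2 : ℂ) ^ 2 *
        (V.sqCoeff q / ((q.1 : ℂ) + q.2) ^ 2) * divDiff z q.1 q.2 := fun q =>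
    hval q _ _ (by simp) (by simp) (by simp)
  have hsum : Summable fun q : ℕ+ × ℕ+ => 4 * (q.1 : ℂ) ^ 2 * (q.2 : ℂ) ^ 2 *
        (V.sqCoeff q / ((q.1 : ℂ) + q.2) ^ 2) * divDiff z q.1 q.2 := by
    simpa only [Function.comp_def, hq] using hs.comp_injective hi
  obtain ⟨c, hc⟩ := hsum
  refine ⟨c, hc, ?_⟩
  refine (hasSum_of_opposite_signs hc (fun i j hij => ?_) hq
    fun q => hval q _ _ (by simp) (by simp) (by simp)).tsum_eq
  simp only [ha]
  rw [V.mat₁_zero, kap, if_neg (by rwa [mul_comm]), zero_mul, zero_mul]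

/-- The second variation in closed form: after symmetrization in `n` and `p`, the terms with `n ≠ p`
and those with `n = p` are those of the two series. -/
theorem second_variation_sum (z : ℂ) :
    (∑' p, V.mat₂ 0 p * levelFun z p (DY * DY)) + 2 * ∑' p, V.mat₁ 0 p * levelFun z p
      (DY * opY (V.mat₁ 0) * DY * DY + DY * (DY * cutY (V.mat₁ 0) * DY)) =
    4 * z * (∑' q : ℕ+ × ℕ+, if q.1 = q.2 then (0 : ℂ) else
        ((q.1 : ℂ) ^ (-z) - (q.2 : ℂ) ^ (-z)) / ((q.2 : ℂ) ^ 2 - (q.1 : ℂ) ^ 2)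
          * (q.2 : ℂ) * (q.1 : ℂ) * (‖circleCoeff V.dirC.1 ((q.2 : ℤ) + (q.1 : ℤ))‖ : ℂ) ^ 2)
      + 2 * z ^ 2 * (∑' n : ℕ+, (n : ℂ) ^ (-z) *
        (‖circleCoeff V.dirC.1 (2 * (n : ℤ))‖ : ℂ) ^ 2) := by
  obtain ⟨c₁, hc₁⟩ := V.summable_diagTerm z
  have e₁ := V.second_variation_diag z hc₁
  obtain ⟨c₂, hc₂, e₂⟩ := V.second_variation_offDiag z
  rw [e₁, e₂]
  -- Symmetrize the double series under `(n, p) ↦ (p, n)`.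
  have hγ := (hc₁.mul_left 2).add (hc₂.mul_left 4)
  have hγ' := (Equiv.prodComm ℕ+ ℕ+).hasSum_iff.2 hγ
  have he := (hγ.add hγ').mul_left (1 / 2)
  have hoff := (summable_offDiag V.dirC z).hasSum.mul_left (4 * z)
  have hon := (hasSum_diag (summable_onDiag V.dirC z).hasSum).mul_left (2 * z ^ 2)
  have h := he.unique ((hoff.add hon).congr_fun fun q => ?_)
  · rw [← h]
    ring
  · obtain ⟨n, p⟩ := q
    simp only [Function.comp, Equiv.prodComm_apply, Prod.swap]
    have hsw : V.sqCoeff (p, n) = V.sqCoeff (n, p) := V.sqCoeff_swap (n, p)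
    have hnp : (n : ℂ) + p ≠ 0 := by
      have : (n : ℕ) + p ≠ 0 := by have := n.pos; omega
      exact_mod_cast this
    have hpn : (p : ℂ) + n = n + p := add_comm _ _
    rw [hsw, hpn]
    change _ = 4 * z * (if n = p then 0 else ((n : ℂ) ^ (-z) - (p : ℂ) ^ (-z)) /
      ((p : ℂ) ^ 2 - (n : ℂ) ^ 2) * p * n * V.sqCoeff (n, p)) + _
    have hS : V.sqCoeff (n, p) = V.sqCoeff (n, p) / ((n : ℂ) + p) ^ 2 * ((n : ℂ) + p) ^ 2 :=
      (div_mul_cancel₀ _ (pow_ne_zero 2 hnp)).symm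
    by_cases hq : n = p
    · subst hq
      have h1 := divDiff_symm_self z n.ne_zero
      have h2 : (‖circleCoeff V.dirC.1 (2 * (n : ℤ))‖ : ℂ) ^ 2 = V.sqCoeff (n, n) := by
        rw [sqCoeff, two_mul]
      rw [if_pos rfl, if_pos rfl, h2]
      generalize V.sqCoeff (n, n) / ((n : ℂ) + n) ^ 2 = T at hS ⊢
      rw [hS]
      linear_combination T * h1
    · have h1 := divDiff_symm_of_ne z n.ne_zero p.ne_zero (fun h => hq (PNat.coe_inj.1 h))
      rw [if_neg hq, if_neg hq, mul_zero, add_zero]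
      generalize V.sqCoeff (n, p) / ((n : ℂ) + p) ^ 2 = T at hS ⊢
      rw [hS]
      linear_combination (T / 2) * h1

end DensVar

end

theorem proposition3p1 (ε : ℝ) (hε : 0 < ε) (α : ℝ → PosCircle)
    (hα : IsSmoothFamily 2 (Ioo (-ε) ε) (fun τ => (α τ).1))
    (hα0 : ∀ θ : ℝ, (α 0).1.1 θ = 1)
    (hnorm : ∀ τ ∈ Ioo (-ε) ε, ∫ θ in (0 : ℝ)..(2 * π), ((α τ).1.1 θ)⁻¹ = 2 * π)
    (β : ℝ → ℝ) (hβ : ∀ θ : ℝ, HasDerivAt (fun τ => (α τ).1.1 θ) (β θ) 0) :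
    (∀ᶠ τ in 𝓝 (0 : ℝ), IsSteklovZetaDiff (α τ) (steklovZetaDiff (α τ))) ∧
    ∀ z : ℂ,
      HasDerivAt (fun τ => steklovZeta (α τ) z) 0 0 ∧
      (∀ᶠ τ in 𝓝 (0 : ℝ), DifferentiableAt ℝ (fun t => steklovZeta (α t) z) τ) ∧
      Summable (fun q : ℕ+ × ℕ+ => if q.1 = q.2 then (0 : ℂ) else
        ((q.1 : ℂ) ^ (-z) - (q.2 : ℂ) ^ (-z)) / ((q.2 : ℂ) ^ 2 - (q.1 : ℂ) ^ 2)
          * (q.2 : ℂ) * (q.1 : ℂ)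
          * (‖circleCoeff (fun θ => (β θ : ℂ)) ((q.2 : ℤ) + (q.1 : ℤ))‖ : ℂ) ^ 2) ∧
      Summable (fun n : ℕ+ =>
        (n : ℂ) ^ (-z) * (‖circleCoeff (fun θ => (β θ : ℂ)) (2 * (n : ℤ))‖ : ℂ) ^ 2) ∧
      HasDerivAt (deriv fun τ => steklovZeta (α τ) z)
        (4 * z * (∑' q : ℕ+ × ℕ+, if q.1 = q.2 then (0 : ℂ) else
            ((q.1 : ℂ) ^ (-z) - (q.2 : ℂ) ^ (-z)) / ((q.2 : ℂ) ^ 2 - (q.1 : ℂ) ^ 2)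
              * (q.2 : ℂ) * (q.1 : ℂ)
              * (‖circleCoeff (fun θ => (β θ : ℂ)) ((q.2 : ℤ) + (q.1 : ℤ))‖ : ℂ) ^ 2)
          + 2 * z ^ 2 * (∑' n : ℕ+,
            (n : ℂ) ^ (-z) * (‖circleCoeff (fun θ => (β θ : ℂ)) (2 * (n : ℤ))‖ : ℂ) ^ 2)) 0 := by
  obtain ⟨η, η₁, η₂, V, hη, hβη⟩ := exists_densVar hε hα hα0 hnorm hβ
  have hdiff : ∀ᶠ t in 𝓝 (0 : ℝ), IsSteklovZetaDiff (α t) (zetaPert (V.mat t)) := by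
    filter_upwards [hη, V.matVar.eventually_small] with t ht hs
    exact (V.density t).isSteklovZetaDiff (V.matVar.rapidMat t) ht hs
  have hβ' : (fun θ => (β θ : ℂ)) = V.dirC.1 := by
    funext θ
    change (β θ : ℂ) = ((-η₁ 0 θ : ℝ) : ℂ)
    rw [hβη θ, neg_neg]
  refine ⟨?_, fun z => ?_⟩
  · filter_upwards [hdiff] with t ht
    rwa [ht.eq_steklovZetaDiff]
  have heq : (fun t => steklovZeta (α t) z) =ᶠ[𝓝 0]
      fun t => 2 * riemannZeta z + zetaPert (V.mat t) z := by
    filter_upwards [hdiff] with t ht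
    rw [steklovZeta, ht.eq_steklovZetaDiff]
  obtain ⟨h1, h2, h3⟩ := V.matVar.hasDerivAt_zetaPert z
  rw [V.first_variation_sum z] at h2
  rw [V.second_variation_sum z] at h3
  rw [hβ']
  refine ⟨(h2.const_add _).congr_of_eventuallyEq heq, ?_, summable_offDiag V.dirC z,
    summable_onDiag V.dirC z, ?_⟩
  · filter_upwards [h1, heq.eventuallyEq_nhds] with t ht he
    exact (ht.const_add _).congr_of_eventuallyEq he
  · refine HasDerivAt.congr_of_eventuallyEq ?_ heq.deriv
    rwa [deriv_const_add']
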